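/- Let $k$ be a field and let $A$ be a Hopf algebra over $k$ with coproduct $\Delta(a)=\sum a_1\otimes a_2$, counit $\varepsilon$ and bijective antipode $S$. Write $\otimes=\otimes_k$, $A^e=A\otimes A^{op}$, $\mathrm H^*(A,k)=\mathrm{Ext}_A^*(k,k)$ and $\mathrm{HH}^*(A)=\mathrm{Ext}_{A^e}^*(A,A)$; $A$ acts on $k$ by $\varepsilon$ and on tensor products over $k$ through $\Delta$. Regard $A^e$ as a right $A$-module through the algebra embedding $\delta:A\to A^e$, $\delta(a)=\sum a_1\otimes S(a_2)$; then $A^e\otimes_A k\cong A$, and the functor $A^e\otimes_A-$ induces an embedding $\iota:\mathrm H^*(A,k)\to \mathrm{HH}^*(A)$. The Gerstenhaber bracket on $\mathrm{HH}^*(A)$ is induced by the bracket of Hochschild cochains $\Phi\circ\Gamma-(-1)^{(m-1)(n-1)}\Gamma\circ\Phi$, where, for $\Phi:A^{\otimes m}\to A$ and $\Gamma:A^{\otimes n}\to A$, $$(\Phi\circ\Gamma)(a_1,\dots,a_{m+n-1})=\sum_{i=1}^{m}(-1)^{(i-1)(n-1)}\Phi(a_1,\dots,a_{i-1},\Gamma(a_i,\dots,a_{i+n-1}),a_{i+n},\dots,a_{m+n-1}).$$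 The Gerstenhaber bracket of $\alpha,\beta\in\mathrm H^*(A,k)$ is the element $\gamma\in\mathrm H^*(A,k)$ with $\iota(\gamma)=[\iota(\alpha),\iota(\beta)]$. Let $(P,d)$ with augmentation $\mu:P_0\to k$ be any projective resolution of the $A$-module $k$, and let $\Delta_P:P\to P\otimes P$ be any diagonal map, that is, an $A$-linear chain map lifting $k\cong k\otimes k$, where $P\otimes P$ has the differential $d(x\otimes y)=dx\otimes y+(-1)^{|x|}x\otimes dy$. A morphism $\psi:P\to P$ of degree $l$ consists of $A$-linear maps $P_i\to P_{i-l}$, and $\partial(\psi)=d\psi-(-1)^l\psi d$. For an $m$-cocycle $f\in\mathrm{Hom}_A(P_m,k)$ let $f\otimes1$ and $1\otimes f$ be the maps $P\otimes P\to P$ with $(f\otimes 1)(x\otimes y)=f(x)y$ and $(1\otimes f)(x\otimes y)=(-1)^{m|x|}f(y)x$, where $f$ is extended by $0$ to $P$. A homotopy lifting of $(f,\Delta_P)$ is a morphism $\psi_f:P\to P$ of degree $m-1$ such that $$\partial(\psi_f)=(f\otimes1-1\otimes f)\Delta_P$$ and such that $\mu\psi_f-(-1)^{m+1}f\varphi$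 is a coboundary in $\mathrm{Hom}_A(P,k)$ for some morphism $\varphi:P\to P$ of degree $-1$ with $\partial(\varphi)=(\mu\otimes1-1\otimes\mu)\Delta_P$. **Theorem.** Let $m,n\ge 0$ with $m+n\ge1$, let $f\in\mathrm{Hom}_A(P_m,k)$ and $g\in\mathrm{Hom}_A(P_n,k)$ be cocycles, and let $\psi_f,\psi_g$ be homotopy liftings of $(f,\Delta_P)$ and $(g,\Delta_P)$. Then $$[f,g]=f\psi_g-(-1)^{(m-1)(n-1)}g\psi_f\in\mathrm{Hom}_A(P_{m+n-1},k)$$ is a cocycle that represents the Gerstenhaber bracket of the classes of $f$ and $g$ in $\mathrm H^{m+n-1}(A,k)$, and this bracket is uniquely determined: every cocycle $h\in\mathrm{Hom}_A(P_{m+n-1},k)$ whose class is taken by $\iota$ to the bracket of the images of the classes of $f$ and $g$ is cohomologous to $[f,g]$. -/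

import Mathlib

open scoped TensorProduct

noncomputable section

namespace HopfBracket

/-! ### Modules over a Hopf algebra, projective resolutions of the trivial module -/

section Resolutions

variable (k : Type*) (A : Type*) [Field k] [Ring A] [HopfAlgebra k A]

/-- The trivial left `A`-module: the field `k` with `a • c = ε(a) c`. -/
def Triv (k : Type*) (A : Type*) [Field k] [Ring A] [HopfAlgebra k A] : Type _ := k

instance : AddCommGroup (Triv k A) := inferInstanceAs (AddCommGroup k)

instance : Module k (Triv k A) := inferInstanceAs (Module k k)

instance : Module A (Triv k A) :=
  Module.compHom (Triv k A) (Bialgebra.counitAlgHom k A).toRingHom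

/-- The identity of `k`, as a `k`-linear map from the trivial module to `k`. -/
def Triv.toField : Triv k A →ₗ[k] k := LinearMap.id

theorem Triv.smul_def (a : A) (c : Triv k A) :
    a • c = (Coalgebra.counit (R := k) a) • c := rfl

instance : IsScalarTower k A (Triv k A) where
  smul_assoc r a c := by
    simp only [Triv.smul_def, map_smul, smul_assoc]

variable {k A}
variable {P : ℕ → Type*} [∀ n, AddCommGroup (P n)] [∀ n, Module k (P n)] [∀ n, Module A (P n)]
  [∀ n, IsScalarTower k A (P n)]

/-- `⋯ → P 2 → P 1 → P 0 → k → 0`, with differentials `d n : P (n + 1) → P n` and augmentation `μ`,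
is a projective resolution of the trivial `A`-module `k`. -/
structure IsProjectiveResolution (d : ∀ n, P (n + 1) →ₗ[A] P n) (μ : P 0 →ₗ[A] Triv k A) :
    Prop where
  projective : ∀ n, Module.Projective A (P n)
  exact_succ : ∀ n, Function.Exact (d (n + 1)) (d n)
  exact_zero : Function.Exact (d 0) μ
  surjective : Function.Surjective μ

/-- Two cochains in `Hom_A(P i, k)` differ by a coboundary
(where `P (-1) = 0`, so that in degree `0` they must be equal). -/
def Cohomologous (d : ∀ n, P (n + 1) →ₗ[A] P n) :
    (i : ℕ) → (P i →ₗ[A] Triv k A) → (P i →ₗ[A] Triv k A) → Prop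
  | 0, u, v => u = v
  | i + 1, u, v => ∃ w : P i →ₗ[A] Triv k A, u - v = w ∘ₗ d i

/-- The diagonal action `a • (u ⊗ v) = ∑ a₁ u ⊗ a₂ v` of the Hopf algebra `A` on the tensor product
over `k` of two left `A`-modules. -/
def diagonalAction (U V : Type*) [AddCommGroup U] [Module k U] [Module A U] [IsScalarTower k A U]
    [AddCommGroup V] [Module k V] [Module A V] [IsScalarTower k A V] :
    A →ₐ[k] Module.End k (U ⊗[k] V) :=
  (Module.endTensorEndAlgHom (R := k) (S := k) (A := k) (M := U) (N := V)).comp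
    ((Algebra.TensorProduct.map (Algebra.lsmul k k U) (Algebra.lsmul k k V)).comp
      (Bialgebra.comulAlgHom k A))

/-- A diagonal map `Δ_P : P → P ⊗ P`: an `A`-linear chain map which lifts the canonical isomorphism
`k ≅ k ⊗ k`. Since `(P ⊗ P)_n` is the finite direct sum of the `P i ⊗ P j` with `i + j = n`,
a map `P n → (P ⊗ P)_n` is the family of its components `Δ i j n _ : P n → P i ⊗ P j`.
The differential of `P ⊗ P` is `d (x ⊗ y) = d x ⊗ y + (-1) ^ |x| x ⊗ d y`. -/
structure IsDiagonalMap (d : ∀ n, P (n + 1) →ₗ[A] P n) (μ : P 0 →ₗ[A] Triv k A)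
    (Δ : ∀ i j n : ℕ, i + j = n → P n →ₗ[k] P i ⊗[k] P j) : Prop where
  map_smul : ∀ (i j n : ℕ) (h : i + j = n) (a : A) (x : P n),
    Δ i j n h (a • x) = diagonalAction (P i) (P j) a (Δ i j n h x)
  comm : ∀ (i j n : ℕ) (h : i + j = n) (x : P (n + 1)),
    Δ i j n h (d n x) =
      ((d i).restrictScalars k).rTensor (P j) (Δ (i + 1) j (n + 1) (by omega) x)
        + (-1 : ℤ) ^ i •
          ((d j).restrictScalars k).lTensor (P i) (Δ i (j + 1) (n + 1) (by omega) x)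
  augmentation : ∀ x : P 0,
    TensorProduct.lid k k
        (TensorProduct.map (Triv.toField k A ∘ₗ μ.restrictScalars k)
          (Triv.toField k A ∘ₗ μ.restrictScalars k) (Δ 0 0 0 rfl x)) =
      Triv.toField k A (μ x)

/-- `f ⊗ 1 : U ⊗ V → k ⊗ V ≅ V`, `x ⊗ y ↦ f(x) y`. -/
def evalLeft {U : Type*} [AddCommGroup U] [Module k U] [Module A U] [IsScalarTower k A U]
    (V : Type*) [AddCommGroup V] [Module k V] (f : U →ₗ[A] Triv k A) : U ⊗[k] V →ₗ[k] V :=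
  (TensorProduct.lid k V).toLinearMap ∘ₗ
    (Triv.toField k A ∘ₗ f.restrictScalars k).rTensor V

/-- The unsigned map `U ⊗ V → U ⊗ k ≅ U`, `x ⊗ y ↦ f(y) x`. -/
def evalRight {V : Type*} [AddCommGroup V] [Module k V] [Module A V] [IsScalarTower k A V]
    (U : Type*) [AddCommGroup U] [Module k U] (f : V →ₗ[A] Triv k A) : U ⊗[k] V →ₗ[k] U :=
  (TensorProduct.rid k U).toLinearMap ∘ₗ
    (Triv.toField k A ∘ₗ f.restrictScalars k).lTensor U

/-- Morphisms `ψ : P → P` of degree `m - 1`. The degree is cohomological, a cochain `P m → k` having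
degree `m`: thus `ψ` consists of `A`-linear maps `P i → P j` for all `i`, `j` with
`i = j + (m - 1)`. In particular `DegreeMap A P 0` consists of the degree `-1` maps
`P i → P (i + 1)`. -/
abbrev DegreeMap (A : Type*) [Ring A] (P : ℕ → Type*) [∀ n, AddCommGroup (P n)]
    [∀ n, Module A (P n)] (m : ℕ) :=
  ∀ i j : ℕ, i + 1 = j + m → (P i →ₗ[A] P j)

/-- The composite `ψ d`, where `d` vanishes on `P 0`. -/
def DegreeMap.compD (d : ∀ n, P (n + 1) →ₗ[A] P n) {m : ℕ} (ψ : DegreeMap A P m) :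
    (i j : ℕ) → i = j + m → (P i →ₗ[A] P j)
  | 0, _, _ => 0
  | i + 1, j, h => ψ i j h ∘ₗ d i

/-- The equation `∂ψ = (f ⊗ 1 - 1 ⊗ f) Δ`, for `f : P m → k` and `ψ` of degree `m - 1`, where
`∂ψ = d ψ - (-1) ^ (m - 1) ψ d`. Here `1 ⊗ f` carries the usual sign
`(1 ⊗ f) (x ⊗ y) = (-1) ^ (m |x|) x f(y)`. The exponent `m + 1` has the parity of `m - 1`. -/
def BoundaryEq (d : ∀ n, P (n + 1) →ₗ[A] P n)
    (Δ : ∀ i j n : ℕ, i + j = n → P n →ₗ[k] P i ⊗[k] P j) {m : ℕ}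
    (f : P m →ₗ[A] Triv k A) (ψ : DegreeMap A P m) : Prop :=
  ∀ (i j : ℕ) (h : i = j + m) (x : P i),
    d j (ψ i (j + 1) (by omega) x) - (-1 : ℤ) ^ (m + 1) • ψ.compD d i j h x =
      evalLeft (P j) f (Δ m j i (by omega) x)
        - (-1 : ℤ) ^ (m * j) • evalRight (P j) f (Δ j m i (by omega) x)

/-- `ψ`, of degree `m - 1`, is a homotopy lifting of `(f, Δ)`: one has
`∂ψ = (f ⊗ 1 - 1 ⊗ f) Δ`, and `μ ψ` is homotopic to `(-1) ^ (m + 1) f φ` for some `φ : P → P` of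
degree `-1` with `∂φ = (μ ⊗ 1 - 1 ⊗ μ) Δ`. -/
def IsHomotopyLifting (d : ∀ n, P (n + 1) →ₗ[A] P n) (μ : P 0 →ₗ[A] Triv k A)
    (Δ : ∀ i j n : ℕ, i + j = n → P n →ₗ[k] P i ⊗[k] P j) {m : ℕ}
    (f : P m →ₗ[A] Triv k A) (ψ : DegreeMap A P m) : Prop :=
  BoundaryEq d Δ f ψ ∧
    ∃ φ : DegreeMap A P 0, BoundaryEq d Δ μ φ ∧
      ∀ (i : ℕ) (h : i + 1 = m),
        Cohomologous d i (μ ∘ₗ ψ i 0 (by omega)) ((-1 : ℤ) ^ (m + 1) • (f ∘ₗ φ i m (by omega)))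

/-- The cochain `[f, g] = f ψ_g - (-1) ^ ((m - 1) (n - 1)) g ψ_f` in `Hom_A(P r, k)`,
where `r = m + n - 1`. -/
def liftingBracket {m n r : ℕ} (h : r + 1 = m + n)
    (f : P m →ₗ[A] Triv k A) (g : P n →ₗ[A] Triv k A)
    (ψf : DegreeMap A P m) (ψg : DegreeMap A P n) : P r →ₗ[A] Triv k A :=
  f ∘ₗ ψg r m h - (-1 : ℤ) ^ ((m + 1) * (n + 1)) • (g ∘ₗ ψf r n (by omega))

end Resolutions

/-! ### The enveloping algebra and induction -/

section Induction

variable (k : Type*) (A : Type*) [Field k] [Ring A] [HopfAlgebra k A]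

/-- The enveloping algebra `A^e = A ⊗ A^op`. Left `A^e`-modules are the same as `A`-bimodules. -/
def Env (k : Type*) (A : Type*) [Field k] [Ring A] [Algebra k A] := A ⊗[k] Aᵐᵒᵖ

instance : Ring (Env k A) := inferInstanceAs (Ring (A ⊗[k] Aᵐᵒᵖ))

instance : Algebra k (Env k A) := inferInstanceAs (Algebra k (A ⊗[k] Aᵐᵒᵖ))

/-- The element `a ⊗ b` of `A^e`. -/
def Env.tmul (a b : A) : Env k A := a ⊗ₜ[k] MulOpposite.op b

/-- `A` as a left `A^e`-module: `(a ⊗ b) • x = a x b`. -/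
instance : Module (Env k A) A :=
  (TensorProduct.Algebra.module : Module (A ⊗[k] Aᵐᵒᵖ) A)

theorem Env.tmul_smul (a b x : A) : Env.tmul k A a b • x = a * x * b := by
  change TensorProduct.Algebra.moduleAux (a ⊗ₜ[k] MulOpposite.op b) x = _
  simp [TensorProduct.Algebra.moduleAux_apply, mul_assoc]

/-- The algebra embedding `δ : A → A^e`, `δ(a) = ∑ a₁ ⊗ S(a₂)`. -/
def delta : A →ₐ[k] Env k A :=
  (Algebra.TensorProduct.map (AlgHom.id k A) (HopfAlgebra.antipodeAlgHomOp k A)).comp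
    (Bialgebra.comulAlgHom k A)

section

variable (U : Type*) [AddCommGroup U] [Module k U] [Module A U]

/-- The `A^e`-submodule of `A^e ⊗_k U` spanned by all `x δ(a) ⊗ u - x ⊗ a u`. -/
def indRelations : Submodule (Env k A) (Env k A ⊗[k] U) :=
  Submodule.span (Env k A)
    {t | ∃ (x : Env k A) (a : A) (u : U), t = (x * delta k A a) ⊗ₜ[k] u - x ⊗ₜ[k] (a • u)}

/-- The induced module `A^e ⊗_A U`, where `A^e` is a right `A`-module through `δ`. -/
abbrev Ind := (Env k A ⊗[k] U) ⧸ indRelations k A U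

end

/-- Induction on morphisms: `x ⊗ u ↦ x ⊗ f(u)`. -/
def Ind.map {U V : Type*} [AddCommGroup U] [Module k U] [Module A U] [IsScalarTower k A U]
    [AddCommGroup V] [Module k V] [Module A V] [IsScalarTower k A V] (f : U →ₗ[A] V) :
    Ind k A U →ₗ[Env k A] Ind k A V :=
  (indRelations k A U).mapQ (indRelations k A V)
    (TensorProduct.AlgebraTensorModule.map LinearMap.id (f.restrictScalars k)) (by
      rw [indRelations, Submodule.span_le]
      rintro _ ⟨x, a, u, rfl⟩
      refine Submodule.subset_span ⟨x, a, f u, ?_⟩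
      simp)

instance : IsScalarTower k (Env k A) A where
  smul_assoc r x a := by
    exact LinearMap.congr_fun
      (map_smul (TensorProduct.Algebra.moduleAux (R := k) (A := A) (B := Aᵐᵒᵖ) (M := A)) r x) a

theorem delta_smul_one (a : A) :
    delta k A a • (1 : A) = algebraMap k A (Coalgebra.counit (R := k) a) := by
  have key : ∀ t : A ⊗[k] A,
      TensorProduct.Algebra.moduleAux
        (Algebra.TensorProduct.map (AlgHom.id k A) (HopfAlgebra.antipodeAlgHomOp k A) t) (1 : A) =
      LinearMap.mul' k A ((HopfAlgebra.antipode k (A := A)).lTensor A t) := by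
    intro t
    induction t using TensorProduct.induction_on with
    | zero => simp
    | add x y hx hy => simp only [map_add, LinearMap.add_apply, hx, hy]
    | tmul b c => simp [TensorProduct.Algebra.moduleAux_apply]
  exact (key _).trans (HopfAlgebra.mul_antipode_lTensor_comul_apply a)

/-- The isomorphism `A^e ⊗_A k ≅ A`, `(a ⊗ b) ⊗ c ↦ c a b`, as an `A^e`-linear map. -/
def indTrivToAlg : Ind k A (Triv k A) →ₗ[Env k A] A :=
  (indRelations k A (Triv k A)).liftQ
    (TensorProduct.AlgebraTensorModule.lift
      (((LinearMap.lsmul k (Env k A →ₗ[Env k A] A)).flip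
        (LinearMap.toSpanSingleton (Env k A) A 1)) ∘ₗ Triv.toField k A).flip) (by
      rw [indRelations, Submodule.span_le]
      rintro _ ⟨x, a, u, rfl⟩
      have h1 : x • algebraMap k A (Coalgebra.counit (R := k) a) =
          Coalgebra.counit (R := k) a • x • (1 : A) := by
        rw [Algebra.algebraMap_eq_smul_one, smul_comm]
      have h2 : Triv.toField k A (a • u) =
          Coalgebra.counit (R := k) a * Triv.toField k A u := rfl
      simp [mul_smul, delta_smul_one, h1, h2,
        smul_comm (Triv.toField k A u) (Coalgebra.counit (R := k) a)])

theorem indTrivToAlg_mk (a b : A) (c : Triv k A) :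
    indTrivToAlg k A (Submodule.Quotient.mk (Env.tmul k A a b ⊗ₜ[k] c)) =
      Triv.toField k A c • (a * b) := by
  change Triv.toField k A c • (Env.tmul k A a b • (1 : A)) = _
  rw [Env.tmul_smul, mul_one]

end Induction

/-! ### Hochschild cochains, the Gerstenhaber bracket, and the embedding of cohomology -/

section Hochschild

variable {k : Type*} {A : Type*} [Field k] [Ring A] [HopfAlgebra k A]

/-- The Hochschild coboundary of an `n`-cochain `φ` with values in an `A`-bimodule `M`:
`a₀ φ(a₁, …, aₙ) + ∑ i, (-1) ^ (i + 1) φ(…, aᵢ aᵢ₊₁, …) + (-1) ^ (n + 1) φ(a₀, …, aₙ₋₁) aₙ`.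
Cochains are `k`-multilinear maps `A ^ n → M`; the formula makes sense for all functions. -/
def hochschildD (k : Type*) {A : Type*} [Field k] [Ring A] [HopfAlgebra k A]
    {M : Type*} [AddCommGroup M] [Module (Env k A) M] {n : ℕ}
    (φ : (Fin n → A) → M) : (Fin (n + 1) → A) → M := fun a =>
  Env.tmul k A (a 0) 1 • φ (fun i => a i.succ)
    + ∑ i : Fin n, (-1 : ℤ) ^ ((i : ℕ) + 1) • φ (i.castSucc.contractNth (· * ·) a)
    + (-1 : ℤ) ^ (n + 1) • Env.tmul k A 1 (a (Fin.last n)) • φ (fun i => a i.castSucc)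

/-- Two `n`-cochains with values in `A` differ by the Hochschild coboundary of an
`(n - 1)`-cochain (in degree `0` they must be equal). -/
def HochschildCohomologous (k : Type*) {A : Type*} [Field k] [Ring A] [HopfAlgebra k A] :
    (n : ℕ) → ((Fin n → A) → A) → ((Fin n → A) → A) → Prop
  | 0, Φ, Φ' => Φ = Φ'
  | n + 1, Φ, Φ' =>
      ∃ w : MultilinearMap k (fun _ : Fin n => A) A, ∀ a, Φ a - Φ' a = hochschildD k w a

/-- The circle product `Φ ∘ Γ` of an `m`-cochain and an `n`-cochain, of degree `r = m + n - 1`: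
`∑ i < m, (-1) ^ (i (n - 1)) Φ(a₀, …, aᵢ₋₁, Γ(aᵢ, …, aᵢ₊ₙ₋₁), aᵢ₊ₙ, …, aᵣ₋₁)`.
The exponent `i (n + 1)` has the parity of `i (n - 1)`. -/
def circ {m n r : ℕ} (h : r + 1 = m + n) (Φ : (Fin m → A) → A) (Γ : (Fin n → A) → A) :
    (Fin r → A) → A := fun a =>
  ∑ i : Fin m, (-1 : ℤ) ^ ((i : ℕ) * (n + 1)) •
    Φ (fun j : Fin m =>
      if hlt : j < i then a ⟨j, by omega⟩
      else if heq : j = i then Γ (fun l : Fin n => a ⟨i + l, by omega⟩)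
      else a ⟨j + n - 1, by omega⟩)

/-- The Gerstenhaber bracket `Φ ∘ Γ - (-1) ^ ((m - 1) (n - 1)) Γ ∘ Φ` of Hochschild cochains. -/
def gerstenhaberBracket {m n r : ℕ} (h : r + 1 = m + n)
    (Φ : (Fin m → A) → A) (Γ : (Fin n → A) → A) : (Fin r → A) → A := fun a =>
  circ h Φ Γ a - (-1 : ℤ) ^ ((m + 1) * (n + 1)) • circ (by omega : r + 1 = n + m) Γ Φ a

variable {P : ℕ → Type*} [∀ n, AddCommGroup (P n)] [∀ n, Module k (P n)] [∀ n, Module A (P n)]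
  [∀ n, IsScalarTower k A (P n)]

/-- `θ` is a chain map from the bar resolution of `A` to `A^e ⊗_A P`, lifting the identity of
`A ≅ A^e ⊗_A k`. The bar resolution has terms `A ⊗ A^{⊗ n} ⊗ A`; an `A^e`-linear map from this
module to a bimodule `M` is the same as a `k`-multilinear map `A ^ n → M` (restrict to the
`1 ⊗ a ⊗ 1`), and composition with the bar differential becomes the Hochschild coboundary. -/
structure IsComparison (d : ∀ n, P (n + 1) →ₗ[A] P n) (μ : P 0 →ₗ[A] Triv k A)
    (θ : ∀ n, MultilinearMap k (fun _ : Fin n => A) (Ind k A (P n))) : Prop where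
  comm : ∀ (n : ℕ) (a : Fin (n + 1) → A),
    Ind.map k A (d n) (θ (n + 1) a) = hochschildD k (θ n) a
  augmentation : indTrivToAlg k A (Ind.map k A μ (θ 0 ![])) = 1

/-- The Hochschild cochain `Φ` represents the image, under the embedding of `H^*(A, k)` into
`HH^*(A)` induced by `A^e ⊗_A -`, of the class of the cocycle `f : P m → k`: up to a
coboundary, `Φ` is the composite `A^e ⊗_A f : A^e ⊗_A P m → A^e ⊗_A k ≅ A` with a comparison map
from the bar resolution. -/
def RepresentsImage (d : ∀ n, P (n + 1) →ₗ[A] P n) (μ : P 0 →ₗ[A] Triv k A) {m : ℕ}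
    (f : P m →ₗ[A] Triv k A) (Φ : (Fin m → A) → A) : Prop :=
  ∃ θ : ∀ n, MultilinearMap k (fun _ : Fin n => A) (Ind k A (P n)), IsComparison d μ θ ∧
    HochschildCohomologous k m Φ (fun a => indTrivToAlg k A (Ind.map k A f (θ m a)))

/-- The cocycle `h : P r → k` represents the Gerstenhaber bracket of the classes in `H^*(A, k)` of
the cocycles `f : P m → k` and `g : P n → k`, that is, the embedding into `HH^*(A)` takes the
class of `h` to the Gerstenhaber bracket of the images of the classes of `f` and `g`. -/
def RepresentsBracket (d : ∀ n, P (n + 1) →ₗ[A] P n) (μ : P 0 →ₗ[A] Triv k A) {m n r : ℕ}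
    (e : r + 1 = m + n) (f : P m →ₗ[A] Triv k A) (g : P n →ₗ[A] Triv k A)
    (h : P r →ₗ[A] Triv k A) : Prop :=
  h ∘ₗ d r = 0 ∧
    ∃ (Φ : MultilinearMap k (fun _ : Fin m => A) A) (Γ : MultilinearMap k (fun _ : Fin n => A) A),
      RepresentsImage d μ f Φ ∧ RepresentsImage d μ g Γ ∧
        RepresentsImage d μ h (gerstenhaberBracket e Φ Γ)

end Hochschild

end HopfBracket

end

open HopfBracket

set_option linter.unusedSectionVars false

noncomputable section

namespace HopfBracket

/-! Let `θ` be a comparison map from the bar resolution of `A` to the induced resolution, and let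
`F`, `G` be the Hochschild cochains obtained by composing the maps induced by `f`, `g` with `θ`. For
the diagonal of the bar resolution, which cuts a list in two, the insertion of `F` into `θ` already
satisfies the equation of a homotopy lifting: by `δ_ins` its boundary is a difference of two cup
products, and by `comm_box` this difference is `f ⊗ 1 - 1 ⊗ f` applied to the cup product of `θ`
with itself. Evaluating `g` on this insertion gives the circle product of `G` and `F`. What remains
is to compare the insertion with `ψ_f`, which belongs to the arbitrary diagonal `Δ_P`.

The two diagonals become homotopic after composition with `θ`, by some `u` (`exists_homotopy`).
Hence the difference of `ψ_f θ` and the insertion of `F`, corrected by `f ⊗ 1 - 1 ⊗ f` applied to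
`u`, is a chain map up to sign (`tot_defect`). Such a map is null-homotopic as soon as its
augmentation is a Hochschild coboundary (`null_homotopic`). This is where the condition on `μ ψ_f`
enters: the same argument for the augmentation `μ` and its lifting `φ` meets no obstruction, and
evaluating `f` on the resulting homotopy controls `f φ`. The insertion of the unit into `F`, which
appears there, vanishes because `θ` is chosen normalized. So `g ψ_f` induces the circle product of
`G` and `F` up to a coboundary and a term in `u` (`IsTotalComparison.lifting`). In the graded
commutator the two terms in `u` cancel, by the antisymmetry `evalLeft_comm_swap`.

The bracket of Hochschild cochains respects coboundaries (`listBracket_cohomologous`), and any two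
comparison maps are homotopic (`representsImage_iff`), so every choice of representatives gives the
same class. Uniqueness is injectivity of the embedding: applying the counit on the right turns `θ`
into a chain map from the bar resolution of `k` to `P`. Its composite with a chain map from `P` to
the bar resolution is homotopic to the identity, so a cocycle whose Hochschild cochain is a
coboundary is itself a coboundary (`cohomologous_zero`).

Two devices keep the algebra manageable. Cochains of all degrees are functions on lists, so their
identities are proved by recursion on the list. The resolution is replaced by the direct sum of its
terms, with the degree remembered only through sign operators. The induced module is replaced by `U
⊗ A` with diagonal left action (`indTo`, `indInv`). -/

/-- A bimodule over the `k`-algebra `A`, given by its left and right actions. -/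
structure Bimod (k A M : Type*) [Field k] [Ring A] [Algebra k A] [AddCommGroup M] [Module k M] where
  /-- the left action -/
  L : A →ₐ[k] Module.End k M
  /-- the right action -/
  R : A →ₗ[k] Module.End k M
  R_one : ∀ x, R 1 x = x
  R_mul : ∀ a b x, R (a * b) x = R b (R a x)
  comm : ∀ a b x, R b (L a x) = L a (R b x)

/-! ### Hochschild cochains of mixed degree as functions on lists. -/

section ListCochains

variable {k A M N W : Type*} [Field k] [Ring A] [Algebra k A] [AddCommGroup M] [Module k M]
  [AddCommGroup N] [Module k N] [AddCommGroup W] [Module k W]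

/-- `c`, a cochain of mixed degree written as a function on lists, is `k`-multilinear. -/
structure Multi (k : Type*) {A M : Type*} [Field k] [Ring A] [Algebra k A] [AddCommGroup M]
    [Module k M] (c : List A → M) : Prop where
  add : ∀ x a b z, c (x ++ (a + b) :: z) = c (x ++ a :: z) + c (x ++ b :: z)
  smul : ∀ x (r : k) a z, c (x ++ (r • a) :: z) = r • c (x ++ a :: z)

namespace Multi

variable {c e : List A → M}

theorem shift (hc : Multi k c) (a : A) : Multi k (fun l => c (a :: l)) :=
  ⟨fun x => hc.add (a :: x), fun x => hc.smul (a :: x)⟩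

theorem add_head (hc : Multi k c) (a b : A) (z : List A) :
    c ((a + b) :: z) = c (a :: z) + c (b :: z) := hc.add [] a b z

theorem smul_head (hc : Multi k c) (r : k) (a : A) (z : List A) :
    c ((r • a) :: z) = r • c (a :: z) := hc.smul [] r a z

theorem zero_mid (hc : Multi k c) (x z : List A) : c (x ++ 0 :: z) = 0 := by
  simpa using hc.smul x 0 0 z

theorem zero_head (hc : Multi k c) (z : List A) : c (0 :: z) = 0 := hc.zero_mid [] z

theorem of_head (h1 : ∀ a b z, c ((a + b) :: z) = c (a :: z) + c (b :: z))
    (h2 : ∀ (r : k) a z, c ((r • a) :: z) = r • c (a :: z))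
    (h3 : ∀ a, Multi k (fun l => c (a :: l))) : Multi k c where
  add x := by
    cases x with
    | nil => exact h1
    | cons y x => exact (h3 y).add x
  smul x := by
    cases x with
    | nil => exact h2
    | cons y x => exact (h3 y).smul x

theorem comp (hc : Multi k c) (T : M →ₗ[k] N) : Multi k (fun l => T (c l)) :=
  ⟨fun x a b z => by simp [hc.add], fun x r a z => by simp [hc.smul]⟩

theorem add' (hc : Multi k c) (he : Multi k e) : Multi k (c + e) :=
  ⟨fun x a b z => by simp only [Pi.add_apply, hc.add, he.add]; abel,
   fun x r a z => by simp [hc.smul, he.smul]⟩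

theorem zero : Multi k (0 : List A → M) := ⟨by simp, by simp⟩

theorem zsmul (hc : Multi k c) (t : ℤ) : Multi k (t • c) :=
  ⟨fun x a b z => by simp [hc.add], fun x r a z => by
    simp only [Pi.smul_apply, hc.smul]; exact smul_comm _ _ _⟩

theorem neg (hc : Multi k c) : Multi k (-c) := by simpa using hc.zsmul (-1)

theorem sub (hc : Multi k c) (he : Multi k e) : Multi k (c - e) := by
  rw [sub_eq_add_neg]; exact hc.add' he.neg

theorem of_nil (h : ∀ a l, c (a :: l) = 0) : Multi k c :=
  of_head (by simp [h]) (by simp [h]) (fun a => ⟨by simp [h], by simp [h]⟩)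

end Multi

/-- The operator `(-1) ^ n` on `n`-cochains, with `t` in place of `-1`. -/
def tau (t : ℤ) (c : List A → M) : List A → M := fun l => t ^ l.length • c l

theorem tau_nil (t : ℤ) (c : List A → M) : tau t c [] = c [] := by simp [tau]

theorem tau_shift (t : ℤ) (c : List A → M) (a : A) :
    (fun l => tau t c (a :: l)) = t • tau t (fun l => c (a :: l)) := by
  funext l; simp [tau, pow_succ', mul_smul]

namespace Bimod

variable (B : Bimod k A M) (B' : Bimod k A N)

/-- The part `c(a₁a₂, …) - c(a₁, a₂a₃, …) + ⋯ ± c(a₁, …) aₙ` of the Hochschild coboundary,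
up to sign. -/
def E : (List A → M) → List A → M
  | _, [] => 0
  | c, [a] => B.R a (c [])
  | c, a :: b :: l => c (a * b :: l) - E (fun x => c (a :: x)) (b :: l)

/-- `(a₁, …, aₙ) ↦ a₁ c(a₂, …, aₙ)`. -/
def lam (c : List A → M) : List A → M
  | [] => 0
  | a :: l => B.L a (c l)

/-- The Hochschild coboundary on cochains of mixed degree. -/
def δ (c : List A → M) : List A → M := B.lam c - B.E c

/-- `(b, …) ↦ c(a b, …)`, and `c · a` on the empty list. -/
def K (a : A) (c : List A → M) : List A → M
  | [] => B.R a (c [])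
  | b :: l => c (a * b :: l)

theorem E_nil (c : List A → M) : B.E c [] = 0 := rfl
theorem E_single (c : List A → M) (a : A) : B.E c [a] = B.R a (c []) := rfl
theorem E_cons (c : List A → M) (a b : A) (l : List A) :
    B.E c (a :: b :: l) = c (a * b :: l) - B.E (fun x => c (a :: x)) (b :: l) := rfl
theorem δ_nil (c : List A → M) : B.δ c [] = 0 := by simp [δ, lam, E]
theorem δ_cons (c : List A → M) (a : A) (l : List A) :
    B.δ c (a :: l) = B.L a (c l) - B.E c (a :: l) := rfl

/-- Freezing the first argument separates the product of `a` with its right neighbour, collected in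
`K a c`, from all later products. Inductions on the list in this file rest on this recursion. -/
theorem E_shift (c : List A → M) (a : A) :
    (fun l => B.E c (a :: l)) = B.K a c - B.E (fun l => c (a :: l)) := by
  funext l
  cases l with
  | nil => simp [K, E]
  | cons b l => simp [K, E]

theorem E_add (c e : List A → M) : B.E (c + e) = B.E c + B.E e := by
  funext l
  induction l generalizing c e with
  | nil => simp [E]
  | cons a l ih =>
    cases l with
    | nil => simp [E]
    | cons b l =>
      have h : (fun x => (c + e) (a :: x)) = (fun x => c (a :: x)) + fun x => e (a :: x) := rfl
      rw [E_cons, h, ih]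
      simp only [Pi.add_apply, E_cons]
      abel

/-- Only the right action occurs in `E`, so right linearity suffices; in particular `T` may be a
left multiplication or a scalar. -/
theorem E_comp {T : M →ₗ[k] N} (hT : ∀ a x, T (B.R a x) = B'.R a (T x)) (c : List A → M) :
    B'.E (fun l => T (c l)) = fun l => T (B.E c l) := by
  funext l
  induction l generalizing c with
  | nil => simp [E]
  | cons a l ih =>
    cases l with
    | nil => simp [E, hT]
    | cons b l => simp [E_cons, ih (fun x => c (a :: x))]

theorem E_zero : B.E 0 = 0 := by simpa using B.E_add 0 0

theorem E_neg (c : List A → M) : B.E (-c) = -B.E c := by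
  have := B.E_add c (-c)
  rw [add_neg_cancel, E_zero] at this
  exact (neg_eq_of_add_eq_zero_right this.symm).symm

theorem E_sub (c e : List A → M) : B.E (c - e) = B.E c - B.E e := by
  rw [sub_eq_add_neg, E_add, E_neg, sub_eq_add_neg]

theorem E_zsmul (t : ℤ) (c : List A → M) : B.E (t • c) = t • B.E c :=
  map_zsmul (AddMonoidHom.mk' B.E B.E_add) t c

theorem E_smul (r : k) (c : List A → M) : B.E (r • c) = r • B.E c := by
  exact B.E_comp B (T := LinearMap.lsmul k M r) (by simp) c

theorem lam_add (c e : List A → M) : B.lam (c + e) = B.lam c + B.lam e := by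
  funext l; cases l <;> simp [lam]

theorem δ_add (c e : List A → M) : B.δ (c + e) = B.δ c + B.δ e := by
  simp only [δ, lam_add, E_add]; abel

theorem δ_zsmul (t : ℤ) (c : List A → M) : B.δ (t • c) = t • B.δ c :=
  map_zsmul (AddMonoidHom.mk' B.δ B.δ_add) t c

theorem δ_zero : B.δ (0 : List A → M) = 0 :=
  map_zero (AddMonoidHom.mk' B.δ B.δ_add)

theorem δ_sub (c e : List A → M) : B.δ (c - e) = B.δ c - B.δ e :=
  map_sub (AddMonoidHom.mk' B.δ B.δ_add) c e

/-- A morphism of bimodules. -/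
structure IsHom (B : Bimod k A M) (B' : Bimod k A N) (T : M →ₗ[k] N) : Prop where
  L : ∀ a x, T (B.L a x) = B'.L a (T x)
  R : ∀ a x, T (B.R a x) = B'.R a (T x)

theorem lam_comp {T : M →ₗ[k] N} (hT : ∀ a x, T (B.L a x) = B'.L a (T x)) (c : List A → M) :
    B'.lam (fun l => T (c l)) = fun l => T (B.lam c l) := by
  funext l; cases l <;> simp [lam, hT]

variable {B B'} in
theorem IsHom.δ_comp {T : M →ₗ[k] N} (hT : IsHom B B' T) (c : List A → M) :
    B'.δ (fun l => T (c l)) = fun l => T (B.δ c l) := by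
  funext l
  simp [δ, B.lam_comp B' hT.L, B.E_comp B' hT.R]

/-- The first product contributes `(ab) c = a (b c)`, and in every other term the left factor `a`
comes out because the two actions commute. -/
theorem E_lam (c : List A → M) : B.E (B.lam c) = B.lam (B.δ c) := by
  funext l
  cases l with
  | nil => rfl
  | cons a l =>
    cases l with
    | nil => simp [E, lam, δ]
    | cons b l =>
      have h := congrFun (B.E_comp B (T := B.L a) (fun b x => (B.comm a b x).symm) c) (b :: l)
      simp only [E_cons, lam, δ_cons, map_sub] at h ⊢
      rw [h, map_mul]; rfl

theorem E_K (c : List A → M) (a b : A) (l : List A) :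
    B.E (B.K a c) (b :: l) = B.E c (a * b :: l) := by
  cases l with
  | nil => simp [E, K, B.R_mul]
  | cons e l => simp [E_cons, K, mul_assoc]

/-- By `E_shift` everything cancels by induction except the terms that multiply the first three
entries together; these agree by associativity, which is `E_K`. -/
theorem E_E (c : List A → M) : B.E (B.E c) = 0 := by
  funext l
  induction l generalizing c with
  | nil => rfl
  | cons a l ih =>
    cases l with
    | nil => simp [E]
    | cons b l =>
      rw [E_cons, E_shift, E_sub, Pi.sub_apply, ih, E_K]
      simp

theorem δ_δ (c : List A → M) : B.δ (B.δ c) = 0 := by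
  have h : B.E (B.δ c) = B.lam (B.δ c) := by
    conv_lhs => rw [δ, E_sub, E_E, E_lam, sub_zero]
  rw [δ, h, sub_self]

/-- `E` raises the degree by exactly one, so cochains of mixed degree can be treated one degree at a
time. -/
theorem E_congr {n : ℕ} {c e : List A → M} (h : ∀ l, l.length = n → c l = e l) :
    ∀ l, l.length = n + 1 → B.E c l = B.E e l := by
  intro l
  induction l generalizing c e n with
  | nil => simp
  | cons a l ih =>
    cases l with
    | nil => intro hl; simp at hl; simp [E, h [] (by simp [hl])]
    | cons b l =>
      intro hl
      simp at hl
      rw [E_cons, E_cons, h _ (by simp [hl]), ih (n := l.length)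
        (e := fun x => e (a :: x)) (fun x hx => h _ (by simp [hx, hl])) (by simp)]

theorem δ_congr {n : ℕ} {c e : List A → M} (h : ∀ l, l.length = n → c l = e l)
    (l : List A) (hl : l.length = n + 1) : B.δ c l = B.δ e l := by
  cases l with
  | nil => simp at hl
  | cons a l =>
    rw [δ_cons, δ_cons, B.E_congr h _ hl, h l (by simpa using hl)]

end Bimod

theorem Multi.E {c : List A → M} (B : Bimod k A M) (hc : Multi k c) : Multi k (B.E c) := by
  -- Induction on the position of the varying entry. Only the first two positions take part in the
  -- first product of the recursion for `E` and need their own computation.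
  suffices H : ∀ n (c : List A → M), Multi k c → ∀ x z : List A, x.length = n →
      (∀ a b, B.E c (x ++ (a + b) :: z) = B.E c (x ++ a :: z) + B.E c (x ++ b :: z)) ∧
      (∀ (r : k) a, B.E c (x ++ (r • a) :: z) = r • B.E c (x ++ a :: z)) from
    ⟨fun x a b z => (H _ c hc x z rfl).1 a b, fun x r a z => (H _ c hc x z rfl).2 r a⟩
  intro n
  induction n with
  | zero =>
    intro c hc x z hx
    obtain rfl := List.length_eq_zero_iff.mp hx
    cases z with
    | nil => simp [Bimod.E]
    | cons b z =>
      constructor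
      · intro a a'
        have h : (fun x => c ((a + a') :: x)) = (fun x => c (a :: x)) + fun x => c (a' :: x) := by
          funext x; exact hc.add_head _ _ _
        simp only [List.nil_append]
        rw [Bimod.E_cons, h, B.E_add, add_mul, hc.add_head, Pi.add_apply, Bimod.E_cons,
          Bimod.E_cons]
        abel
      · intro r a
        have h : (fun x => c ((r • a) :: x)) = r • (fun x => c (a :: x)) := by
          funext x; exact hc.smul_head _ _ _
        simp only [List.nil_append]
        rw [Bimod.E_cons, h, B.E_smul, smul_mul_assoc, hc.smul_head, Pi.smul_apply, Bimod.E_cons,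
          smul_sub]
  | succ n ih =>
    intro c hc x z hx
    obtain ⟨y, x, rfl⟩ := List.exists_cons_of_length_eq_add_one hx
    have hx' : x.length = n := by simpa using hx
    obtain ⟨h1, h2⟩ := ih _ (hc.shift y) x z hx'
    cases x with
    | nil =>
      simp only [List.nil_append, List.cons_append] at h1 h2 ⊢
      constructor
      · intro a b
        rw [Bimod.E_cons, Bimod.E_cons, Bimod.E_cons, mul_add, hc.add_head, h1]; abel
      · intro r a
        rw [Bimod.E_cons, Bimod.E_cons, mul_smul_comm, hc.smul_head, h2, smul_sub]
    | cons w x =>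
      simp only [List.cons_append] at h1 h2 ⊢
      constructor
      · intro a b
        rw [Bimod.E_cons, Bimod.E_cons, Bimod.E_cons, h1]
        have := hc.add (y * w :: x) a b z
        simp only [List.cons_append] at this
        rw [this]; abel
      · intro r a
        rw [Bimod.E_cons, Bimod.E_cons, h2]
        have := hc.smul (y * w :: x) r a z
        simp only [List.cons_append] at this
        rw [this, smul_sub]

theorem Multi.lam {c : List A → M} (B : Bimod k A M) (hc : Multi k c) : Multi k (B.lam c) :=
  .of_head (by simp [Bimod.lam]) (by simp [Bimod.lam]) (fun a => hc.comp (B.L a))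

theorem Multi.δ {c : List A → M} (B : Bimod k A M) (hc : Multi k c) : Multi k (B.δ c) :=
  (hc.lam B).sub (hc.E B)

/-! ### Cup products -/

/-- The cup product of two cochains with respect to a bilinear map. -/
def cup (π : M →ₗ[k] N →ₗ[k] W) : (List A → M) → (List A → N) → List A → W
  | c, e, [] => π (c []) (e [])
  | c, e, a :: l => π (c []) (e (a :: l)) + cup π (fun x => c (a :: x)) e l

section cup

variable (π : M →ₗ[k] N →ₗ[k] W)

theorem cup_cons (c : List A → M) (e : List A → N) (a : A) (l : List A) :
    cup π c e (a :: l) = π (c []) (e (a :: l)) + cup π (fun x => c (a :: x)) e l := rfl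

theorem cup_add_left (c c' : List A → M) (e : List A → N) :
    cup π (c + c') e = cup π c e + cup π c' e := by
  funext l
  induction l generalizing c c' with
  | nil => simp [cup]
  | cons a l ih =>
    have := ih (fun x => c (a :: x)) (fun x => c' (a :: x))
    simp only [cup_cons, Pi.add_apply, map_add, LinearMap.add_apply] at this ⊢
    rw [add_add_add_comm, ← this]; rfl

theorem cup_zsmul_left (t : ℤ) (c : List A → M) (e : List A → N) :
    cup π (t • c) e = t • cup π c e :=
  map_zsmul (AddMonoidHom.mk' (fun c => cup π c e) fun c c' => cup_add_left π c c' e) t c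

theorem cup_sub_left (c c' : List A → M) (e : List A → N) :
    cup π (c - c') e = cup π c e - cup π c' e :=
  map_sub (AddMonoidHom.mk' (fun c => cup π c e) fun c c' => cup_add_left π c c' e) c c'

theorem cup_zero_left (e : List A → N) : cup π 0 e = 0 :=
  map_zero (AddMonoidHom.mk' (fun c => cup π c e) fun c c' => cup_add_left π c c' e)

theorem cup_smul_left (r : k) (c : List A → M) (e : List A → N) :
    cup π (r • c) e = r • cup π c e := by
  funext l
  induction l generalizing c with
  | nil => simp [cup]
  | cons a l ih =>
    have := ih (fun x => c (a :: x))
    simp only [cup_cons, Pi.smul_apply, map_smul, LinearMap.smul_apply, smul_add] at this ⊢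
    rw [← this]; rfl

/-- Two bilinear maps intertwined by linear maps give intertwined cup products. -/
theorem cup_comp {M' N' W' : Type*} [AddCommGroup M'] [Module k M'] [AddCommGroup N'] [Module k N']
    [AddCommGroup W'] [Module k W'] (π' : M' →ₗ[k] N' →ₗ[k] W') (S : M → M') (T : N → N')
    (V : W →ₗ[k] W') (h : ∀ x y, V (π x y) = π' (S x) (T y)) (c : List A → M) (e : List A → N)
    (l : List A) :
    V (cup π c e l) = cup π' (fun l => S (c l)) (fun l => T (e l)) l := by
  induction l generalizing c with
  | nil => simp [cup, h]
  | cons a l ih => simp [cup_cons, h, ih]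

theorem Multi.cup {c : List A → M} {e : List A → N} (hc : Multi k c) (he : Multi k e) :
    Multi k (cup π c e) := by
  suffices H : ∀ n (c : List A → M), Multi k c → ∀ x z : List A, x.length = n →
      (∀ a b, HopfBracket.cup π c e (x ++ (a + b) :: z) =
        HopfBracket.cup π c e (x ++ a :: z) + HopfBracket.cup π c e (x ++ b :: z)) ∧
      (∀ (r : k) a, HopfBracket.cup π c e (x ++ (r • a) :: z) =
        r • HopfBracket.cup π c e (x ++ a :: z)) from
    ⟨fun x a b z => (H _ c hc x z rfl).1 a b, fun x r a z => (H _ c hc x z rfl).2 r a⟩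
  intro n
  induction n with
  | zero =>
    intro c hc x z hx
    obtain rfl := List.length_eq_zero_iff.mp hx
    constructor
    · intro a a'
      have h : (fun x => c ((a + a') :: x)) = (fun x => c (a :: x)) + fun x => c (a' :: x) := by
        funext x; exact hc.add_head _ _ _
      simp only [List.nil_append, cup_cons, h, cup_add_left, he.add_head, Pi.add_apply, map_add]
      abel
    · intro r a
      have h : (fun x => c ((r • a) :: x)) = r • (fun x => c (a :: x)) := by
        funext x; exact hc.smul_head _ _ _
      simp only [List.nil_append, cup_cons, h, cup_smul_left, he.smul_head, map_smul,
        Pi.smul_apply, smul_add]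
  | succ n ih =>
    intro c hc x z hx
    obtain ⟨y, x, rfl⟩ := List.exists_cons_of_length_eq_add_one hx
    have hx' : x.length = n := by simpa using hx
    obtain ⟨h1, h2⟩ := ih _ (hc.shift y) x z hx'
    have h3 := he.add (y :: x)
    have h4 := he.smul (y :: x)
    simp only [List.cons_append] at h3 h4 ⊢
    constructor
    · intro a b
      rw [cup_cons, cup_cons, cup_cons, h1, h3, map_add]; abel
    · intro r a
      rw [cup_cons, cup_cons, h2, h4, map_smul, smul_add]

end cup

/-- A bilinear map which is balanced and compatible with the outer actions. -/
structure IsBalanced (B : Bimod k A M) (B' : Bimod k A N) (B'' : Bimod k A W)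
    (π : M →ₗ[k] N →ₗ[k] W) : Prop where
  left : ∀ a x y, π (B.L a x) y = B''.L a (π x y)
  mid : ∀ a x y, π (B.R a x) y = π x (B'.L a y)
  right : ∀ a x y, π x (B'.R a y) = B''.R a (π x y)

/-- A product of neighbours lies in one of the two parts of the cut list. The extra terms at the
cut, the right action ending `E c` and the left action opening `δ e`, cancel because `π` is
balanced; `tau` supplies the sign of the length of the first part. -/
theorem IsBalanced.E_cup {B : Bimod k A M} {B' : Bimod k A N} {B'' : Bimod k A W}
    {π : M →ₗ[k] N →ₗ[k] W} (h : IsBalanced B B' B'' π) (c : List A → M) (e : List A → N) :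
    B''.E (cup π c e) = cup π (B.E c) e - cup π (tau (-1) c) (B'.δ e) := by
  funext l
  induction l generalizing c with
  | nil => simp [cup, Bimod.E, Bimod.δ_nil]
  | cons a l ih =>
    cases l with
    | nil =>
      simp [cup, Bimod.E, Bimod.δ_nil, Bimod.δ_cons, h.mid, h.right, tau_nil]
    | cons b l =>
      have h1 : (fun x => cup π c e (a :: x)) =
          (fun x => π (c []) (e (a :: x))) + cup π (fun x => c (a :: x)) e := rfl
      have h2 := congrFun (B'.E_comp B'' (T := π (c [])) (fun r x => h.right r _ x)
        (fun x => e (a :: x))) (b :: l)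
      rw [Bimod.E_cons, h1, B''.E_add, Pi.add_apply, ih, h2]
      simp only [Pi.sub_apply, cup_cons _ _ _ a, B.E_shift, tau_shift, cup_sub_left,
        cup_zsmul_left, Bimod.E_nil, map_zero, LinearMap.zero_apply, zero_add, tau_nil]
      rw [cup_cons _ (B.K a c)]
      simp only [Bimod.K, Bimod.δ_cons, h.mid, map_sub, Pi.smul_apply, Bimod.E_cons]
      rw [cup_cons _ c e (a * b)]
      module

theorem IsBalanced.δ_cup {B : Bimod k A M} {B' : Bimod k A N} {B'' : Bimod k A W}
    {π : M →ₗ[k] N →ₗ[k] W} (h : IsBalanced B B' B'' π) (c : List A → M) (e : List A → N) :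
    B''.δ (cup π c e) = cup π (B.δ c) e + cup π (tau (-1) c) (B'.δ e) := by
  have h1 : B''.lam (cup π c e) = cup π (B.lam c) e := by
    funext l
    cases l with
    | nil => simp [cup, Bimod.lam]
    | cons a l =>
      have h2 := cup_comp π π (B.L a) id (B''.L a) (fun x y => (h.left a x y).symm) c e l
      simpa [cup_cons, Bimod.lam] using h2
  have h3 : cup π (B.δ c) e = cup π (B.lam c) e - cup π (B.E c) e := cup_sub_left π _ _ e
  rw [Bimod.δ, h.E_cup, h1, h3]
  abel

end ListCochains

/-! ### Circle products and their coboundaries. -/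

section Insertion

variable {k A M N : Type*} [Field k] [Ring A] [Algebra k A] [AddCommGroup M] [Module k M]
  [AddCommGroup N] [Module k N]

variable (k A) in
/-- The algebra `A` as a bimodule over itself. -/
def Bimod.reg : Bimod k A A where
  L := Algebra.lmul k A
  R := (LinearMap.mul k A).flip
  R_one := by simp
  R_mul := by simp [mul_assoc]
  comm := by simp [mul_assoc]

/-- `∑ j, c(Φ(a₁, …, aⱼ), aⱼ₊₁, …, aₙ)`. -/
def insHead : (List A → A) → (List A → M) → List A → M
  | Φ, c, [] => c [Φ []]
  | Φ, c, a :: l => c (Φ [] :: a :: l) + insHead (fun x => Φ (a :: x)) c l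

/-- The circle product `c ∘ Φ`, the sum over `i ≤ j` of
`sⁱ c(a₁, …, aᵢ, Φ(aᵢ₊₁, …, aⱼ), aⱼ₊₁, …, aₙ)`. -/
def ins (s : ℤ) : (List A → M) → (List A → A) → List A → M
  | c, Φ, [] => insHead Φ c []
  | c, Φ, a :: l => insHead Φ c (a :: l) + s • ins s (fun x => c (a :: x)) Φ l

theorem insHead_nil (Φ : List A → A) (c : List A → M) : insHead Φ c [] = c [Φ []] := rfl
theorem insHead_cons (Φ : List A → A) (c : List A → M) (a : A) (l : List A) :
    insHead Φ c (a :: l) = c (Φ [] :: a :: l) + insHead (fun x => Φ (a :: x)) c l := rfl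
theorem ins_nil (s : ℤ) (c : List A → M) (Φ : List A → A) : ins s c Φ [] = c [Φ []] := rfl
theorem ins_cons (s : ℤ) (c : List A → M) (Φ : List A → A) (a : A) (l : List A) :
    ins s c Φ (a :: l) = insHead Φ c (a :: l) + s • ins s (fun x => c (a :: x)) Φ l := rfl

theorem insHead_add_right (Φ : List A → A) (c e : List A → M) :
    insHead Φ (c + e) = insHead Φ c + insHead Φ e := by
  funext l
  induction l generalizing Φ with
  | nil => simp [insHead]
  | cons a l ih => simp only [insHead_cons, Pi.add_apply, ih]; abel

theorem insHead_comp (T : M →ₗ[k] N) (Φ : List A → A) (c : List A → M) (l : List A) :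
    insHead Φ (fun l => T (c l)) l = T (insHead Φ c l) := by
  induction l generalizing Φ with
  | nil => simp [insHead]
  | cons a l ih => simp [insHead_cons, ih]

theorem insHead_add_left {c : List A → M} (hc : Multi k c) (Φ Ψ : List A → A) :
    insHead (Φ + Ψ) c = insHead Φ c + insHead Ψ c := by
  funext l
  induction l generalizing Φ Ψ with
  | nil => simp [insHead, hc.add_head]
  | cons a l ih =>
    have h : (fun x => (Φ + Ψ) (a :: x)) = (fun x => Φ (a :: x)) + fun x => Ψ (a :: x) := rfl
    rw [insHead_cons, h, ih]
    simp only [Pi.add_apply, insHead_cons, hc.add_head]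
    abel

theorem insHead_smul_left {c : List A → M} (hc : Multi k c) (r : k) (Φ : List A → A) :
    insHead (r • Φ) c = r • insHead Φ c := by
  funext l
  induction l generalizing Φ with
  | nil => simp [insHead, hc.smul_head]
  | cons a l ih =>
    have h : (fun x => (r • Φ) (a :: x)) = r • (fun x => Φ (a :: x)) := rfl
    rw [insHead_cons, h, ih]
    simp only [Pi.smul_apply, insHead_cons, hc.smul_head, smul_add]

theorem insHead_sub_left {c : List A → M} (hc : Multi k c) (Φ Ψ : List A → A) :
    insHead (Φ - Ψ) c = insHead Φ c - insHead Ψ c :=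
  map_sub (AddMonoidHom.mk' (fun Φ => insHead Φ c) (insHead_add_left hc)) Φ Ψ

theorem insHead_zsmul_left {c : List A → M} (hc : Multi k c) (t : ℤ) (Φ : List A → A) :
    insHead (t • Φ) c = t • insHead Φ c :=
  map_zsmul (AddMonoidHom.mk' (fun Φ => insHead Φ c) (insHead_add_left hc)) t Φ

theorem insHead_zero_left {c : List A → M} (hc : Multi k c) : insHead 0 c = 0 :=
  map_zero (AddMonoidHom.mk' (fun Φ => insHead Φ c) (insHead_add_left hc))

theorem ins_add_left (s : ℤ) (c e : List A → M) (Φ : List A → A) :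
    ins s (c + e) Φ = ins s c Φ + ins s e Φ := by
  funext l
  induction l generalizing c e with
  | nil => simp [ins, insHead]
  | cons a l ih =>
    have h : (fun x => (c + e) (a :: x)) = (fun x => c (a :: x)) + fun x => e (a :: x) := rfl
    rw [ins_cons, h, ih, insHead_add_right]
    simp only [Pi.add_apply, ins_cons, smul_add]
    abel

theorem ins_comp (s : ℤ) (T : M →ₗ[k] N) (Φ : List A → A) (c : List A → M) (l : List A) :
    ins s (fun l => T (c l)) Φ l = T (ins s c Φ l) := by
  induction l generalizing c with
  | nil => simp [ins, insHead]
  | cons a l ih =>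
    simp only [ins_cons, insHead_comp, ih, map_add, map_zsmul]

theorem ins_smul_left (s : ℤ) (r : k) (c : List A → M) (Φ : List A → A) :
    ins s (r • c) Φ = r • ins s c Φ := by
  funext l; exact ins_comp s (LinearMap.lsmul k M r) Φ c l

theorem ins_sub_left (s : ℤ) (c e : List A → M) (Φ : List A → A) :
    ins s (c - e) Φ = ins s c Φ - ins s e Φ :=
  map_sub (AddMonoidHom.mk' (fun c => ins s c Φ) fun c e => ins_add_left s c e Φ) c e

theorem ins_zero_left (s : ℤ) (Φ : List A → A) : ins s (0 : List A → M) Φ = 0 :=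
  map_zero (AddMonoidHom.mk' (fun c : List A → M => ins s c Φ) fun c e => ins_add_left s c e Φ)

theorem ins_add_right (s : ℤ) {c : List A → M} (hc : Multi k c) (Φ Ψ : List A → A) :
    ins s c (Φ + Ψ) = ins s c Φ + ins s c Ψ := by
  funext l
  induction l generalizing c with
  | nil => simp [ins, insHead, hc.add_head]
  | cons a l ih =>
    rw [ins_cons, ih (hc.shift a), insHead_add_left hc]
    simp only [Pi.add_apply, ins_cons, smul_add]
    abel

theorem ins_zero_right (s : ℤ) {c : List A → M} (hc : Multi k c) : ins s c 0 = 0 :=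
  map_zero (AddMonoidHom.mk' (fun Φ => ins s c Φ) (ins_add_right s hc))

theorem Multi.insHead {c : List A → M} {Φ : List A → A} (hΦ : Multi k Φ) (hc : Multi k c) :
    Multi k (insHead Φ c) := by
  suffices H : ∀ n (Φ : List A → A), Multi k Φ → ∀ x z : List A, x.length = n →
      (∀ a b, HopfBracket.insHead Φ c (x ++ (a + b) :: z) =
        HopfBracket.insHead Φ c (x ++ a :: z) + HopfBracket.insHead Φ c (x ++ b :: z)) ∧
      (∀ (r : k) a, HopfBracket.insHead Φ c (x ++ (r • a) :: z) =
        r • HopfBracket.insHead Φ c (x ++ a :: z)) from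
    ⟨fun x a b z => (H _ Φ hΦ x z rfl).1 a b, fun x r a z => (H _ Φ hΦ x z rfl).2 r a⟩
  intro n
  induction n with
  | zero =>
    intro Φ hΦ x z hx
    obtain rfl := List.length_eq_zero_iff.mp hx
    simp only [List.nil_append]
    constructor
    · intro a a'
      have h : (fun x => Φ ((a + a') :: x)) = (fun x => Φ (a :: x)) + fun x => Φ (a' :: x) := by
        funext x; exact hΦ.add_head _ _ _
      have h' := hc.add [Φ []] a a' z
      simp only [List.cons_append, List.nil_append] at h'
      rw [insHead_cons, h, insHead_add_left hc, h', Pi.add_apply, insHead_cons, insHead_cons]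
      abel
    · intro r a
      have h : (fun x => Φ ((r • a) :: x)) = r • (fun x => Φ (a :: x)) := by
        funext x; exact hΦ.smul_head _ _ _
      have h' := hc.smul [Φ []] r a z
      simp only [List.cons_append, List.nil_append] at h'
      rw [insHead_cons, h, insHead_smul_left hc, h', Pi.smul_apply, insHead_cons, smul_add]
  | succ n ih =>
    intro Φ hΦ x z hx
    obtain ⟨y, x, rfl⟩ := List.exists_cons_of_length_eq_add_one hx
    have hx' : x.length = n := by simpa using hx
    obtain ⟨h1, h2⟩ := ih _ (hΦ.shift y) x z hx'
    have h3 := hc.add (Φ [] :: y :: x)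
    have h4 := hc.smul (Φ [] :: y :: x)
    simp only [List.cons_append] at h3 h4 ⊢
    constructor
    · intro a b
      rw [insHead_cons, insHead_cons, insHead_cons, h1, h3]; abel
    · intro r a
      rw [insHead_cons, insHead_cons, h2, h4, smul_add]

theorem Multi.ins {c : List A → M} {Φ : List A → A} (hc : Multi k c) (hΦ : Multi k Φ) (s : ℤ) :
    Multi k (ins s c Φ) := by
  suffices H : ∀ n (c : List A → M), Multi k c → ∀ x z : List A, x.length = n →
      (∀ a b, HopfBracket.ins s c Φ (x ++ (a + b) :: z) =
        HopfBracket.ins s c Φ (x ++ a :: z) + HopfBracket.ins s c Φ (x ++ b :: z)) ∧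
      (∀ (r : k) a, HopfBracket.ins s c Φ (x ++ (r • a) :: z) =
        r • HopfBracket.ins s c Φ (x ++ a :: z)) from
    ⟨fun x a b z => (H _ c hc x z rfl).1 a b, fun x r a z => (H _ c hc x z rfl).2 r a⟩
  intro n
  induction n with
  | zero =>
    intro c hc x z hx
    obtain rfl := List.length_eq_zero_iff.mp hx
    simp only [List.nil_append]
    constructor
    · intro a a'
      have h : (fun x => c ((a + a') :: x)) = (fun x => c (a :: x)) + fun x => c (a' :: x) := by
        funext x; exact hc.add_head _ _ _
      rw [ins_cons, h, ins_add_left, (hΦ.insHead hc).add_head, Pi.add_apply, ins_cons, ins_cons,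
        smul_add]
      abel
    · intro r a
      have h : (fun x => c ((r • a) :: x)) = r • (fun x => c (a :: x)) := by
        funext x; exact hc.smul_head _ _ _
      rw [ins_cons, h, ins_smul_left, (hΦ.insHead hc).smul_head, Pi.smul_apply, ins_cons,
        smul_add, smul_comm]
  | succ n ih =>
    intro c hc x z hx
    obtain ⟨y, x, rfl⟩ := List.exists_cons_of_length_eq_add_one hx
    have hx' : x.length = n := by simpa using hx
    obtain ⟨h1, h2⟩ := ih _ (hc.shift y) x z hx'
    have h3 := (hΦ.insHead hc).add (y :: x)
    have h4 := (hΦ.insHead hc).smul (y :: x)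
    simp only [List.cons_append] at h3 h4 ⊢
    constructor
    · intro a b
      rw [ins_cons, ins_cons, ins_cons, h1, h3, smul_add]; abel
    · intro r a
      rw [ins_cons, ins_cons, h2, h4, smul_add, smul_comm]

variable (B : Bimod k A M)

/-- Neighbours are multiplied either among the arguments of `Φ` or after them. The product of the
value of `Φ` with the next entry occurs once as the last term of `E Φ` and once as the first term of
`E c`, with opposite signs. The last summand compensates for the prefix that uses up the whole list,
where `E c` has only a right action to offer. -/
theorem E_insHead {c : List A → M} (hc : Multi k c) (Φ : List A → A) :
    B.E (insHead Φ c) = insHead ((Bimod.reg k A).E Φ) c - insHead (tau (-1) Φ) (B.E c)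
      + fun l => B.R (tau (-1) Φ l) (c []) := by
  funext l
  induction l generalizing Φ with
  | nil => simp [insHead, Bimod.E, tau_nil, hc.zero_head]
  | cons a l ih =>
    cases l with
    | nil =>
      simp only [insHead, Bimod.E, Pi.add_apply, Pi.sub_apply, tau_nil, hc.zero_head]
      simp [Bimod.reg]
      abel
    | cons b l =>
      have h1 : (fun x => insHead Φ c (a :: x)) =
          (fun x => c (Φ [] :: a :: x)) + insHead (fun x => Φ (a :: x)) c := rfl
      rw [Bimod.E_cons, h1, B.E_add, Pi.add_apply, ih]
      simp only [Pi.add_apply, Pi.sub_apply, insHead_cons _ _ a, Bimod.E_shift, tau_shift,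
        insHead_sub_left hc, insHead_zsmul_left (hc.E B), Bimod.E_nil, hc.zero_head, tau_nil,
        Pi.smul_apply]
      have h3 : tau (-1) Φ (a :: b :: l) = (-1 : ℤ) • tau (-1) (fun x => Φ (a :: x)) (b :: l) :=
        congrFun (tau_shift (-1) Φ a) (b :: l)
      have h4 : (Bimod.reg k A).K a Φ [] = Φ [] * a := rfl
      rw [insHead_cons _ _ (a * b), insHead_cons ((Bimod.reg k A).K a Φ), h3, h4]
      simp only [Bimod.E_cons, Bimod.K, map_zsmul, LinearMap.smul_apply]
      module

/-- If `Φ` is inserted behind the first entry, the left action on that entry comes out and the two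
sides cancel. If it is inserted at the front, the value of `Φ` itself acts, which gives the cup
product. -/
theorem lam_ins {c : List A → M} (s : ℤ) (Φ : List A → A) :
    ins s (B.lam c) Φ - s • B.lam (ins s c Φ) = cup B.L.toLinearMap Φ c := by
  have h1 : ∀ l, insHead Φ (B.lam c) l = cup B.L.toLinearMap Φ c l := by
    intro l
    induction l generalizing Φ with
    | nil => simp [insHead, cup, Bimod.lam]
    | cons a l ih => rw [insHead_cons, ih, cup_cons]; rfl
  funext l
  cases l with
  | nil => simp [ins, h1, Bimod.lam]
  | cons a l =>
    have h2 : ins s (fun x => B.L a (c x)) Φ l = B.L a (ins s c Φ l) := ins_comp s (B.L a) Φ c l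
    simp [ins_cons, h1, Bimod.lam, h2]

theorem insHead_K (Φ : List A → A) (c : List A → M) (a : A) :
    insHead Φ (B.K a c) = insHead (fun x => a * Φ x) c := by
  funext l
  induction l generalizing Φ with
  | nil => rfl
  | cons b l ih => rw [insHead_cons, insHead_cons, ih]; rfl

/-- Here `t` is the parity sign of the degree of `Φ`, and `s = -t` is the sign picked up when `Φ`
moves past one entry. Products inside `Φ`, together with those of its value with the neighbours,
make up `δ Φ`; the cup product comes from the right action of a `Φ` inserted at the very end. -/
theorem E_ins {c : List A → M} (hc : Multi k c) {Φ : List A → A} {s t : ℤ} (ht : t * t = 1)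
    (hst : s = -t) (hΦ : tau (-1) Φ = t • Φ) :
    ins s (B.E c) Φ - s • B.E (ins s c Φ) = s • ins t c ((Bimod.reg k A).δ Φ)
      + cup B.R.flip (tau t c) Φ := by
  have hs : s * s = 1 := by rw [hst, neg_mul_neg, ht]
  have hst' : s * t = -1 := by rw [hst, neg_mul, ht]
  funext l
  induction l generalizing c with
  | nil =>
    simp [ins, insHead, Bimod.E, Bimod.δ_nil, hc.zero_head, cup, tau_nil]
  | cons a l ih =>
    have ih := ih (hc.shift a)
    -- The product of `a` with the value of `Φ` right behind it can be read as the left term of `δ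
    -- Φ` or as a product of neighbours in `c`.
    have key : insHead ((Bimod.reg k A).lam Φ) c (a :: l) = insHead Φ (B.K a c) l := by
      rw [insHead_cons, insHead_K]
      simp only [Bimod.lam, hc.zero_head, zero_add]
      rfl
    -- The subtracted term excludes products of `a` with an inserted value: in the coboundary of the
    -- circle product, `a` is multiplied only with the next entry of the list.
    have key2 : B.E (ins s c Φ) (a :: l) = B.E (insHead Φ c) (a :: l) +
        (ins s (B.K a c) Φ l - insHead Φ (B.K a c) l) -
        s • B.E (ins s (fun x => c (a :: x)) Φ) l := by
      cases l with
      | nil => simp [ins, Bimod.E]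
      | cons b l =>
        have h1 : (fun x => ins s c Φ (a :: x)) =
          (fun x => insHead Φ c (a :: x)) + s • ins s (fun x => c (a :: x)) Φ := rfl
        rw [Bimod.E_cons, h1, B.E_add, B.E_zsmul, Pi.add_apply, Pi.smul_apply, Bimod.E_cons,
          ins_cons, ins_cons]
        simp only [Bimod.K]
        module
    have h5 := congrFun (E_insHead B hc Φ) (a :: l)
    rw [hΦ, insHead_zsmul_left (hc.E B)] at h5
    simp only [Pi.sub_apply, Pi.add_apply, Pi.smul_apply, map_zsmul, LinearMap.smul_apply] at h5 ih
    have h6 : insHead ((Bimod.reg k A).δ Φ) c = _ := insHead_sub_left hc _ _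
    have h7 := congrFun h6 (a :: l)
    simp only [Pi.sub_apply, Pi.add_apply, Pi.smul_apply]
    rw [key2, h5, ins_cons, ins_cons, h7, Pi.sub_apply, key, Bimod.E_shift, ins_sub_left, cup_cons, tau_shift,
      cup_zsmul_left, tau_nil]
    simp only [Pi.sub_apply, Pi.smul_apply, LinearMap.flip_apply]
    generalize ins t (fun x => c (a :: x)) ((Bimod.reg k A).δ Φ) l = X1 at *
    generalize cup B.R.flip (tau t fun x => c (a :: x)) Φ l = X2 at *
    generalize ins s (B.E fun x => c (a :: x)) Φ l = X3 at *
    generalize B.E (ins s (fun x => c (a :: x)) Φ) l = X4 at *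
    subst hst
    -- The induction hypothesis eliminates the cup product of the tail; the identity that remains is
    -- one of coefficients and uses only `t * t = 1`.
    obtain rfl := eq_sub_of_add_eq' ih.symm
    match_scalars <;> simp <;> nlinarith

end Insertion

/-! ### The coboundary of a circle product, normalized cochains, contractions, and brackets. -/

section Homotopies

variable {k A M N X Y : Type*} [Field k] [Ring A] [Algebra k A] [AddCommGroup M] [Module k M]
  [AddCommGroup N] [Module k N] [AddCommGroup X] [Module k X] [AddCommGroup Y] [Module k Y]

/-- The Hochschild coboundary of a circle product. -/
theorem δ_ins (B : Bimod k A M) {c : List A → M} (hc : Multi k c) {Φ : List A → A} {s t : ℤ}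
    (ht : t * t = 1) (hst : s = -t) (hΦ : tau (-1) Φ = t • Φ) :
    ins s (B.δ c) Φ = s • B.δ (ins s c Φ) + cup B.L.toLinearMap Φ c - cup B.R.flip (tau t c) Φ
      - s • ins t c ((Bimod.reg k A).δ Φ) := by
  have h1 := lam_ins B s Φ (c := c)
  have h2 := E_ins B hc ht hst hΦ
  rw [Bimod.δ, ins_sub_left, Bimod.δ, smul_sub, eq_add_of_sub_eq h1, eq_add_of_sub_eq h2]
  abel

/-- The cochain vanishes outside of degree `n`. -/
def Supp (n : ℕ) (c : List A → M) : Prop := ∀ l, l.length ≠ n → c l = 0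

theorem Supp.tau {n : ℕ} {c : List A → M} (hc : Supp n c) (t : ℤ) : tau t c = t ^ n • c := by
  funext l
  by_cases hl : l.length = n
  · simp [HopfBracket.tau, hl]
  · simp [HopfBracket.tau, hc l hl]

/-- The unit cochain, concentrated in degree `0`. -/
def unitCochain : List A → A
  | [] => 1
  | _ :: _ => 0

theorem Multi.unitCochain : Multi k (unitCochain : List A → A) := .of_nil fun _ _ => rfl

theorem supp_unitCochain : Supp 0 (unitCochain : List A → A) := by
  intro l hl; cases l <;> simp_all [unitCochain]

theorem δ_unitCochain : (Bimod.reg k A).δ unitCochain = 0 := by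
  funext l
  cases l with
  | nil => exact Bimod.δ_nil _ _
  | cons a l =>
    have h (l : List A) : (Bimod.reg k A).E 0 l = 0 := by rw [Bimod.E_zero]; rfl
    cases l with
    | nil => simp [Bimod.δ_cons, Bimod.E, unitCochain, Bimod.reg]
    | cons b l =>
      have h' := h (b :: l)
      simp only [Bimod.δ_cons, Bimod.E_cons, unitCochain, map_zero, Pi.zero_apply]
      rw [show (fun _ : List A => (0 : A)) = 0 from rfl, h']
      simp

/-- The cochain vanishes as soon as one of its arguments is `1`. -/
def Normal (c : List A → M) : Prop := ∀ x z, c (x ++ 1 :: z) = 0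

theorem Normal.shift {c : List A → M} (hc : Normal c) (a : A) : Normal fun l => c (a :: l) :=
  fun x => hc (a :: x)

theorem Normal.E_one (B : Bimod k A M) {c : List A → M} (hc : Normal c) (z : List A) :
    B.E c (1 :: z) = c z := by
  cases z with
  | nil => simp [Bimod.E, B.R_one]
  | cons b z =>
    have h : (fun x => c (1 :: x)) = 0 := funext fun x => hc [] x
    rw [Bimod.E_cons, h, B.E_zero]; simp

/-- The products of `1` with its left and its right neighbour (or the right action of a final `1`)
yield the same value with opposite signs; all other terms still contain the entry `1`. -/
theorem Normal.E_cons (B : Bimod k A M) {c : List A → M} (hc : Normal c) (x z : List A) (a : A) :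
    B.E c (a :: x ++ 1 :: z) = 0 := by
  induction x generalizing c a with
  | nil => simp [Bimod.E_cons, (hc.shift a).E_one]
  | cons b x ih =>
    have h := ih (hc.shift a) b
    simp only [List.cons_append] at h ⊢
    rw [Bimod.E_cons, h, sub_zero]
    exact hc (a * b :: x) z

theorem Normal.δ (B : Bimod k A M) {c : List A → M} (hc : Normal c) : Normal (B.δ c) := by
  intro x z
  cases x with
  | nil => simp [Bimod.δ_cons, hc.E_one]
  | cons a x => rw [List.cons_append, Bimod.δ_cons, hc x z, ← List.cons_append, hc.E_cons]; simp

/-- Inserting the unit puts the entry `1` among the arguments. This vanishing is the reason for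
working with a normalized comparison map. -/
theorem Normal.ins_unitCochain {c : List A → M} (hc : Normal c) (hm : Multi k c) (s : ℤ) :
    ins s c unitCochain = 0 := by
  funext l
  induction l generalizing c with
  | nil => exact hc [] []
  | cons a l ih =>
    have h : (fun x : List A => (unitCochain (a :: x) : A)) = 0 := rfl
    rw [ins_cons, ih (hc.shift a) (hm.shift a), insHead_cons, h, insHead_zero_left hm]
    have := hc [] (a :: l)
    simp only [List.nil_append] at this
    simp [unitCochain, this]

/-! ### Solving cochain equations in a contractible complex -/

/-- A `k`-linear contraction of the complex `(X, D)` augmented by `ε : X → Y`. -/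
structure Contraction (D : X →ₗ[k] X) (ε : X →ₗ[k] Y) where
  /-- the contracting homotopy -/
  H : X →ₗ[k] X
  /-- the section of the augmentation -/
  j : Y →ₗ[k] X
  eq : ∀ x, D (H x) + H (D x) = x - j (ε x)
  ε_H : ∀ x, ε (H x) = 0
  ε_j : ∀ y, ε (j y) = y
  D_j : ∀ y, D (j y) = 0

/-- Successive approximations to the solution of `c = D u + κ δ u`. -/
def Contraction.approx {D : X →ₗ[k] X} {ε : X →ₗ[k] Y} (C : Contraction D ε) (B : Bimod k A X)
    (κ : ℤ) (c : List A → X) : ℕ → List A → X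
  | 0 => fun l => C.H (c l)
  | n + 1 => fun l => C.H ((c - κ • B.δ (C.approx B κ c n)) l)

/-- This single lemma replaces all uses of the comparison theorem for maps out of the bar
resolution. The equation `u = H (c - κ δ u)` is a recursion on the length of the list, since `δ u`
on lists of length `n + 1` involves `u` only on lists of length `n`. The contraction then turns it
into the equation wanted, and preserves normalization because `δ` does. -/
theorem Contraction.solve {D : X →ₗ[k] X} {ε : X →ₗ[k] Y} (C : Contraction D ε)
    {B : Bimod k A X} {B' : Bimod k A Y} (hD : B.IsHom B D) (hε : B.IsHom B' ε)
    (κ : ℤ) {c : List A → X} (hc : Multi k c) (hDc : (fun l => D (c l)) = κ • B.δ c)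
    (hεc : ∀ l, ε (c l) = 0) :
    ∃ u : List A → X, Multi k u ∧ c = (fun l => D (u l)) + κ • B.δ u ∧ (∀ l, ε (u l) = 0) ∧
      (Normal c → Normal u) := by
  set U := C.approx B κ c
  have hU : ∀ n, Multi k (U n) := by
    intro n
    induction n with
    | zero => exact hc.comp C.H
    | succ n ih => exact (hc.sub ((ih.δ B).zsmul κ)).comp C.H
  have hN : Normal c → ∀ n, Normal (U n) := by
    intro hn n
    induction n with
    | zero => intro x z; simp [U, approx, hn x z]
    | succ n ih =>
      intro x z
      simp only [U, approx, Pi.sub_apply, Pi.smul_apply]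
      rw [hn x z, (ih.δ B) x z]
      simp
  -- The approximation with index `n` is already correct on lists of length `n`, so the solution is
  -- read off diagonally.
  set u : List A → X := fun l => U l.length l
  have hu : ∀ l, u l = C.H ((c - κ • B.δ u) l) := by
    intro l
    cases l with
    | nil => simp [u, U, approx, Bimod.δ_nil]
    | cons a l =>
      have h := B.δ_congr (n := l.length) (c := u) (e := U l.length)
        (fun x hx => by simp only [u, hx]) (a :: l) (by simp)
      simp only [u, U, List.length_cons, approx, Pi.sub_apply, Pi.smul_apply] at h ⊢
      rw [h]
  have hεu : ∀ l, ε (u l) = 0 := fun l => by rw [hu, C.ε_H]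
  have hmu : Multi k u := by
    constructor
    · intro x a b z
      simp only [u, List.length_append, List.length_cons]
      exact (hU _).add _ _ _ _
    · intro x r a z
      simp only [u, List.length_append, List.length_cons]
      exact (hU _).smul _ _ _ _
  refine ⟨u, hmu, ?_, hεu, ?_⟩
  · have hεδ : ∀ l, ε (B.δ u l) = 0 := by
      intro l
      have := congrFun (hε.δ_comp u) l
      rw [show (fun l => ε (u l)) = 0 from funext hεu, B'.δ_zero] at this
      exact this.symm
    suffices H : ∀ n l, l.length = n → D (u l) = (c - κ • B.δ u) l by
      funext l
      have := H _ l rfl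
      simp only [Pi.sub_apply, Pi.add_apply] at this ⊢
      rw [this]; abel
    intro n
    induction n with
    | zero =>
      intro l hl
      obtain rfl := List.length_eq_zero_iff.mp hl
      have h1 := congrFun hDc []
      simp only [Pi.smul_apply, B.δ_nil, smul_zero] at h1
      have h2 := C.eq (c [])
      rw [h1, hεc] at h2
      rw [hu]
      simpa [B.δ_nil] using h2
    | succ n ih =>
      intro l hl
      -- Since `D` commutes with `δ`, the induction hypothesis gives `D δ u = δ (c - κ δ u) = δ c`
      -- in this degree, and this cancels against `D c = κ δ c`.
      have h1 : D ((c - κ • B.δ u) l) = 0 := by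
        have h2 := congrFun hDc l
        have h3 := congrFun (hD.δ_comp u) l
        simp only [Pi.sub_apply, Pi.smul_apply, map_sub, map_zsmul] at h2 ⊢
        rw [h2, ← h3, B.δ_congr ih l hl, B.δ_sub, B.δ_zsmul, B.δ_δ]
        simp
      have h2 : ε ((c - κ • B.δ u) l) = 0 := by
        simp [hεc, hεδ]
      have h3 := C.eq ((c - κ • B.δ u) l)
      rw [h1, h2] at h3
      rw [hu]
      simpa using h3
  · intro hn x z
    exact hN hn _ x z

/-! ### The bracket of cochains -/

/-- The Gerstenhaber bracket of an `m`-cochain and an `n`-cochain. -/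
def listBracket (m n : ℕ) (Φ Γ : List A → A) : List A → A :=
  ins ((-1) ^ (n + 1)) Φ Γ - (-1 : ℤ) ^ ((m + 1) * (n + 1)) • ins ((-1) ^ (m + 1)) Γ Φ

theorem listBracket_symm (m n : ℕ) (Φ Γ : List A → A) :
    listBracket n m Γ Φ = (-1 : ℤ) ^ ((m + 1) * (n + 1) + 1) • listBracket m n Φ Γ := by
  have h : ((-1 : ℤ) ^ ((m + 1) * (n + 1))) * ((-1 : ℤ) ^ ((m + 1) * (n + 1))) = 1 := by
    rw [← mul_pow]; simp
  simp only [listBracket]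
  rw [mul_comm (n + 1), pow_succ (-1 : ℤ) ((m + 1) * (n + 1)), smul_sub, smul_smul, mul_right_comm,
    h]
  module

theorem listBracket_add_left (m n : ℕ) {Γ : List A → A} (hΓ : Multi k Γ) (Φ Φ' : List A → A) :
    listBracket m n (Φ + Φ') Γ = listBracket m n Φ Γ + listBracket m n Φ' Γ := by
  simp only [listBracket, ins_add_left, ins_add_right _ hΓ, smul_add]
  abel

/-- Expand both circle products by `δ_ins`. As `Γ` is a cocycle, only coboundaries and cup products
of `b` with `Γ` remain, and the cup products cancel in the graded commutator. -/
theorem listBracket_coboundary (m n : ℕ) {b Γ : List A → A} (hb : Multi k b) (hs : Supp m b)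
    (hΓ : Multi k Γ) (hs' : Supp n Γ) (hδ : (Bimod.reg k A).δ Γ = 0) :
    ∃ w : List A → A, Multi k w ∧
      listBracket (m + 1) n ((Bimod.reg k A).δ b) Γ = (Bimod.reg k A).δ w := by
  set R := Bimod.reg k A
  have sq : ∀ i : ℕ, (-1 : ℤ) ^ i * (-1) ^ i = 1 := fun i => by rw [← mul_pow]; simp
  have h1 := δ_ins R hb (Φ := Γ) (s := (-1) ^ (n + 1)) (sq n) (by ring) (hs'.tau (-1))
  have h2 := δ_ins R hΓ (Φ := b) (s := (-1) ^ (m + 1)) (sq m) (by ring) (hs.tau (-1))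
  have hz : ins ((-1) ^ n) b (R.δ Γ) = 0 := by rw [hδ, ins_zero_right _ hb]
  rw [hz, smul_zero, sub_zero, hs.tau, cup_zsmul_left] at h1
  rw [hδ, ins_zero_left, hs'.tau, cup_zsmul_left] at h2
  -- With coefficients in `A`, both actions are the multiplication of `A`, so the two kinds of cup
  -- product in `δ_ins` coincide and can cancel.
  have e1 : R.R.flip = R.L.toLinearMap := by ext a b; simp [R, Bimod.reg]
  rw [e1] at h1 h2
  have h3 : ins ((-1) ^ m) Γ (R.δ b) = R.δ (ins ((-1) ^ (m + 1)) Γ b) +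
      (-1 : ℤ) ^ (m + 1) • (cup R.L.toLinearMap b Γ
        - ((-1 : ℤ) ^ m) ^ n • cup R.L.toLinearMap Γ b) := by
    have h4 : (-1 : ℤ) ^ (m + 1) • ins ((-1) ^ m) Γ (R.δ b) =
        (-1 : ℤ) ^ (m + 1) • R.δ (ins ((-1) ^ (m + 1)) Γ b) + (cup R.L.toLinearMap b Γ
        - ((-1 : ℤ) ^ m) ^ n • cup R.L.toLinearMap Γ b) := by
      rw [eq_comm, sub_eq_zero] at h2
      rw [← h2]; abel
    have h5 := congrArg (fun x => (-1 : ℤ) ^ (m + 1) • x) h4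
    simp only [smul_add, smul_smul, sq, one_smul] at h5
    exact h5
  -- The witness collects the exact parts of the two expansions; `m + 1 + 1` appears because the
  -- coboundary of `b` has degree `m + 1`.
  refine ⟨(-1 : ℤ) ^ (n + 1) • ins ((-1) ^ (n + 1)) b Γ
    - (-1 : ℤ) ^ ((m + 1 + 1) * (n + 1)) • ins ((-1) ^ (m + 1)) Γ b, ?_, ?_⟩
  · exact ((hb.ins hΓ _).zsmul _).sub ((hΓ.ins hb _).zsmul _)
  · have e2 : ((-1 : ℤ) ^ (m + 1 + 1)) = (-1) ^ m := by ring
    rw [listBracket, h1, R.δ_sub, R.δ_zsmul, R.δ_zsmul, e2, h3]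
    rcases neg_one_pow_eq_or ℤ m with hm | hm <;> rcases neg_one_pow_eq_or ℤ n with hn | hn <;>
    · simp only [pow_mul, pow_succ, hm, hn, one_pow]
      norm_num [hn]
      try abel

end Homotopies

/-! ### The bimodules `U ⊗ N` with diagonal left action, and the bimodule maps between them. -/

section Twist

variable {k A : Type*} [Field k] [Ring A] [HopfAlgebra k A]
variable {U V M N W : Type*} [AddCommGroup U] [Module k U] [Module A U] [IsScalarTower k A U]
  [AddCommGroup V] [Module k V] [Module A V] [IsScalarTower k A V]
  [AddCommGroup M] [Module k M] [AddCommGroup N] [Module k N] [AddCommGroup W] [Module k W]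

namespace Bimod

variable (U) in
/-- The action of `A ⊗ A` on `U ⊗ N` through the left actions on the factors. -/
def pairAct (B : Bimod k A N) : A ⊗[k] A →ₐ[k] Module.End k (U ⊗[k] N) :=
  (Module.endTensorEndAlgHom (R := k) (S := k) (A := k) (M := U) (N := N)).comp
    (Algebra.TensorProduct.map (Algebra.lsmul k k U) B.L)

theorem pairAct_tmul (B : Bimod k A N) (a b : A) (u : U) (y : N) :
    B.pairAct U (a ⊗ₜ b) (u ⊗ₜ y) = (a • u) ⊗ₜ B.L b y := rfl

/-- Compatibility with `A ⊗ A` is checked on pure tensors; applied to the coproduct of `a` it yields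
left linearity without expanding any coproduct. -/
theorem pairAct_comm {B : Bimod k A N} {U' N' : Type*} [AddCommGroup U'] [Module k U'] [Module A U']
    [IsScalarTower k A U'] [AddCommGroup N'] [Module k N'] {B' : Bimod k A N'}
    (T : U ⊗[k] N →ₗ[k] U' ⊗[k] N')
    (h : ∀ a b u y, T ((a • u) ⊗ₜ B.L b y) = B'.pairAct U' (a ⊗ₜ b) (T (u ⊗ₜ y)))
    (t : A ⊗[k] A) (z : U ⊗[k] N) : T (B.pairAct U t z) = B'.pairAct U' t (T z) := by
  induction t using TensorProduct.induction_on with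
  | zero => simp
  | add x y hx hy => simp only [map_add, LinearMap.add_apply, hx, hy]
  | tmul a b =>
    induction z using TensorProduct.induction_on with
    | zero => simp
    | add x y hx hy => simp only [map_add, hx, hy]
    | tmul u y => rw [pairAct_tmul, h]

variable (U) in
/-- The bimodule `U ⊗ N`, with `a (u ⊗ y) = ∑ a₁ u ⊗ a₂ y` and `(u ⊗ y) a = u ⊗ y a`. -/
def twist (B : Bimod k A N) : Bimod k A (U ⊗[k] N) where
  L := (B.pairAct U).comp (Bialgebra.comulAlgHom k A)
  R := LinearMap.lTensorHom U ∘ₗ B.R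
  R_one x := by
    have : B.R 1 = LinearMap.id := LinearMap.ext B.R_one
    simp [this]
  R_mul a b x := by
    have : B.R (a * b) = B.R b ∘ₗ B.R a := LinearMap.ext (B.R_mul a b)
    simp [this, LinearMap.lTensor_comp]
  comm a b x := by
    exact pairAct_comm (B := B) (B' := B) ((B.R b).lTensor U)
      (fun a c u y => by simp [pairAct_tmul, B.comm]) _ x

theorem twist_L (B : Bimod k A N) (a : A) :
    (B.twist U).L a = B.pairAct U (Coalgebra.comul (R := k) a) := rfl

theorem twist_R (B : Bimod k A N) (a : A) : (B.twist U).R a = (B.R a).lTensor U := rfl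

namespace IsHom

variable {B : Bimod k A M} {B' : Bimod k A N} {B'' : Bimod k A W}

theorem comp {S : N →ₗ[k] W} {T : M →ₗ[k] N} (hS : IsHom B' B'' S) (hT : IsHom B B' T) :
    IsHom B B'' (S ∘ₗ T) :=
  ⟨fun a x => by simp [hT.L, hS.L], fun a x => by simp [hT.R, hS.R]⟩

theorem add {S T : M →ₗ[k] N} (hS : IsHom B B' S) (hT : IsHom B B' T) : IsHom B B' (S + T) :=
  ⟨fun a x => by simp [hT.L, hS.L], fun a x => by simp [hT.R, hS.R]⟩

theorem sub {S T : M →ₗ[k] N} (hS : IsHom B B' S) (hT : IsHom B B' T) : IsHom B B' (S - T) :=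
  ⟨fun a x => by simp [hT.L, hS.L], fun a x => by simp [hT.R, hS.R]⟩

theorem zero : IsHom B B' 0 := ⟨by simp, by simp⟩

theorem lTensor {T : M →ₗ[k] N} (hT : IsHom B B' T) :
    IsHom (B.twist U) (B'.twist U) (T.lTensor U) where
  L a x := pairAct_comm (B := B) (B' := B') _ (fun a b u y => by simp [pairAct_tmul, hT.L]) _ x
  R a x := by
    have h : T ∘ₗ B.R a = B'.R a ∘ₗ T := LinearMap.ext (hT.R a)
    rw [twist_R, twist_R, ← LinearMap.comp_apply, ← LinearMap.lTensor_comp, h,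
      LinearMap.lTensor_comp]
    rfl

theorem rTensor (B : Bimod k A N) (φ : U →ₗ[A] V) :
    IsHom (B.twist U) (B.twist V) ((φ.restrictScalars k).rTensor N) where
  L a x := pairAct_comm (B := B) (B' := B) _ (fun a b u y => by simp [pairAct_tmul]) _ x
  R a x := by
    rw [twist_R, twist_R, ← LinearMap.comp_apply, LinearMap.rTensor_comp_lTensor,
      ← LinearMap.lTensor_comp_rTensor]
    rfl

end IsHom
end Bimod

theorem evalLeft_tmul (f : U →ₗ[A] Triv k A) (u : U) (y : N) :
    evalLeft N f (u ⊗ₜ y) = Triv.toField k A (f u) • y := by simp [evalLeft]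

theorem evalRight_tmul (f : V →ₗ[A] Triv k A) (u : U) (y : V) :
    evalRight U f (u ⊗ₜ y) = Triv.toField k A (f y) • u := by simp [evalRight]

theorem Triv.toField_smul (a : A) (c : Triv k A) :
    Triv.toField k A (a • c) = Coalgebra.counit (R := k) a * Triv.toField k A c := rfl

/-- Left linearity is the counit axiom: `∑ f(a₁ u) a₂ y = ∑ ε(a₁) f(u) a₂ y = f(u) a y`. -/
theorem isHom_evalLeft (B : Bimod k A N) (f : U →ₗ[A] Triv k A) :
    Bimod.IsHom (B.twist U) B (evalLeft N f) where
  L a x := by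
    have key : ∀ t : A ⊗[k] A, evalLeft N f (B.pairAct U t x) =
        B.L (TensorProduct.lid k A ((Coalgebra.counit (R := k) (A := A)).rTensor A t))
          (evalLeft N f x) := by
      intro t
      induction t using TensorProduct.induction_on with
      | zero => simp
      | add x y hx hy => simp only [map_add, LinearMap.add_apply, hx, hy]
      | tmul a b =>
        induction x using TensorProduct.induction_on with
        | zero => simp
        | add x y hx hy => simp only [map_add, hx, hy]
        | tmul u y =>
          simp [Bimod.pairAct_tmul, evalLeft_tmul, Triv.toField_smul, mul_smul]
          exact smul_comm _ _ _
    rw [Bimod.twist_L, key, Coalgebra.rTensor_counit_comul]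
    simp
  R a x := by
    induction x using TensorProduct.induction_on with
    | zero => simp
    | add x y hx hy => simp only [map_add, hx, hy]
    | tmul u y => simp [Bimod.twist_R, evalLeft_tmul]

variable (U) in
/-- The pairing `(u ⊗ a, y) ↦ u ⊗ a y`. -/
def box (B : Bimod k A N) : U ⊗[k] A →ₗ[k] N →ₗ[k] U ⊗[k] N :=
  TensorProduct.lift
    ((LinearMap.llcomp k N N (U ⊗[k] N)).compl₁₂ (TensorProduct.mk k U N) B.L.toLinearMap)

theorem box_tmul (B : Bimod k A N) (u : U) (a : A) (y : N) :
    box U B (u ⊗ₜ a) y = u ⊗ₜ B.L a y := rfl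

/-- The pairing models the identification of `(U ⊗ A) ⊗_A N` with `U ⊗ N`. With `N = U ⊗ A` it lets
two comparison maps be multiplied over `A`. -/
theorem box_balanced (B : Bimod k A N) :
    IsBalanced ((Bimod.reg k A).twist U) B (B.twist U) (box U B) where
  left a x y :=
    Bimod.pairAct_comm (B := Bimod.reg k A) (B' := B) ((box U B).flip y)
      (fun a b u c => by
        simp [box_tmul, Bimod.pairAct_tmul, Bimod.reg]) _ x
  mid a x y := by
    induction x using TensorProduct.induction_on with
    | zero => simp
    | add x y hx hy => simp only [map_add, LinearMap.add_apply, hx, hy]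
    | tmul u b => simp [Bimod.twist_R, box_tmul, Bimod.reg]
  right a x y := by
    induction x using TensorProduct.induction_on with
    | zero => simp
    | add x y hx hy => simp only [map_add, LinearMap.add_apply, hx, hy]
    | tmul u b => simp [Bimod.twist_R, box_tmul, B.comm]

variable (N) in
/-- The map `U ⊗ N → U ⊗ (U ⊗ N)` induced by a diagonal map `U → U ⊗ U`. -/
def diagMap (Δ : U →ₗ[k] U ⊗[k] U) : U ⊗[k] N →ₗ[k] U ⊗[k] (U ⊗[k] N) :=
  (TensorProduct.assoc k U U N).toLinearMap ∘ₗ Δ.rTensor N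

/-- Both sides act on three tensor factors through an iterated coproduct, and coassociativity
identifies the two iterations. -/
theorem isHom_diagMap (B : Bimod k A N) {Δ : U →ₗ[k] U ⊗[k] U}
    (hΔ : ∀ (a : A) (x : U), Δ (a • x) = diagonalAction U U a (Δ x)) :
    Bimod.IsHom (B.twist U) ((B.twist U).twist U) (diagMap N Δ) where
  L a x := by
    -- the action of `x ⊗ (y ⊗ z)` on triple tensors
    let G (p q : U) (n : N) : A ⊗[k] (A ⊗[k] A) →ₗ[k] U ⊗[k] (U ⊗[k] N) :=
      TensorProduct.map ((Algebra.lsmul k k U).toLinearMap.flip p)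
        (TensorProduct.map ((Algebra.lsmul k k U).toLinearMap.flip q) (B.L.toLinearMap.flip n))
    have h1 : ∀ (t : A ⊗[k] A) (p q : U) (n : N),
        (B.twist U).pairAct U t (p ⊗ₜ (q ⊗ₜ n)) =
          G p q n ((Coalgebra.comul (R := k) (A := A)).lTensor A t) := by
      intro t p q n
      induction t using TensorProduct.induction_on with
      | zero => simp
      | add x y hx hy => simp only [map_add, LinearMap.add_apply, hx, hy]
      | tmul a b =>
        rw [Bimod.pairAct_tmul, Bimod.twist_L, LinearMap.lTensor_tmul]
        generalize (Coalgebra.comul (R := k) b : A ⊗[k] A) = s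
        induction s using TensorProduct.induction_on with
        | zero => simp
        | add x y hx hy => simp only [map_add, LinearMap.add_apply, TensorProduct.tmul_add, hx, hy]
        | tmul c d => rfl
    have h2 : ∀ (x y : A) (p q : U) (n : N),
        TensorProduct.assoc k U U N (diagonalAction U U x (p ⊗ₜ[k] q) ⊗ₜ B.L y n) =
          G p q n (TensorProduct.assoc k A A A
            ((Coalgebra.comul (R := k) (A := A)).rTensor A (x ⊗ₜ y))) := by
      intro x y p q n
      rw [LinearMap.rTensor_tmul]
      change TensorProduct.assoc k U U N ((Module.endTensorEndAlgHom (R := k) (S := k) (A := k)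
        (M := U) (N := U) ((Algebra.TensorProduct.map (Algebra.lsmul k k U) (Algebra.lsmul k k U))
          (Coalgebra.comul (R := k) x)) (p ⊗ₜ[k] q)) ⊗ₜ B.L y n) = _
      generalize (Coalgebra.comul (R := k) x : A ⊗[k] A) = s
      induction s using TensorProduct.induction_on with
      | zero => simp
      | add x y hx hy => simp only [map_add, LinearMap.add_apply, TensorProduct.add_tmul, hx, hy]
      | tmul c d => rfl
    induction x using TensorProduct.induction_on with
    | zero => simp
    | add x y hx hy => simp only [map_add, hx, hy]
    | tmul u n =>
      -- A finite expansion of the coproduct is fixed before `Δ u` is varied, so that the induction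
      -- on `Δ u` compares sums over the same index set.
      obtain ⟨S, hS⟩ := TensorProduct.exists_finset (Coalgebra.comul (R := k) a)
      have hL : diagMap N Δ ((B.twist U).L a (u ⊗ₜ n)) = ∑ i ∈ S,
          TensorProduct.assoc k U U N (diagonalAction U U i.1 (Δ u) ⊗ₜ B.L i.2 n) := by
        simp only [Bimod.twist_L, hS, map_sum, LinearMap.sum_apply, Bimod.pairAct_tmul]
        simp [diagMap, hΔ]
      have hR : diagMap N Δ (u ⊗ₜ n) = TensorProduct.assoc k U U N (Δ u ⊗ₜ n) := rfl
      rw [hL, hR]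
      generalize Δ u = z
      induction z using TensorProduct.induction_on with
      | zero => simp
      | add x y hx hy =>
        simp only [map_add, TensorProduct.add_tmul, Finset.sum_add_distrib, hx, hy]
      | tmul p q =>
        simp only [h2]
        rw [TensorProduct.assoc_tmul, Bimod.twist_L, h1, ← Coalgebra.coassoc_apply]
        rw [hS]
        simp only [map_sum]
  R a x := by
    induction x using TensorProduct.induction_on with
    | zero => simp
    | add x y hx hy => simp only [map_add, hx, hy]
    | tmul u n =>
      simp only [diagMap, Bimod.twist_R, LinearMap.lTensor_tmul, LinearMap.comp_apply,
        LinearMap.rTensor_tmul, LinearEquiv.coe_coe]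
      generalize Δ u = z
      induction z using TensorProduct.induction_on with
      | zero => simp
      | add x y hx hy => simp only [map_add, TensorProduct.add_tmul, hx, hy]
      | tmul p q => simp

end Twist

/-! ### The total module of a resolution, with tensor differentials and contractions. -/

section Total

/-- The total module of a resolution with a diagonal map, the grading being recorded only by the
operators `sg t`, which multiply elements of degree `n` by `t ^ n`. -/
structure TotalComplex (k A U : Type*) [Field k] [Ring A] [HopfAlgebra k A] [AddCommGroup U]
    [Module k U] [Module A U] [IsScalarTower k A U] where
  /-- the differential -/
  D : U →ₗ[A] U
  /-- the sign operators -/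
  sg : ℤ → U →ₗ[A] U
  /-- the augmentation -/
  μ : U →ₗ[A] Triv k A
  /-- the diagonal map -/
  Δ : U →ₗ[k] U ⊗[k] U
  sg_D : ∀ t : ℤ, t * t = 1 → ∀ x, sg t (D x) = t • D (sg t x)
  μ_D : ∀ x, μ (D x) = 0
  μ_sg : ∀ t x, μ (sg t x) = μ x
  Δ_smul : ∀ (a : A) x, Δ (a • x) = diagonalAction U U a (Δ x)
  Δ_D : ∀ x, Δ (D x) = (D.restrictScalars k).rTensor U (Δ x) +
    TensorProduct.map ((sg (-1)).restrictScalars k) (D.restrictScalars k) (Δ x)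
  aug : ∀ x, TensorProduct.lid k k (TensorProduct.map (Triv.toField k A ∘ₗ μ.restrictScalars k)
    (Triv.toField k A ∘ₗ μ.restrictScalars k) (Δ x)) = Triv.toField k A (μ x)

variable {k A U N Y : Type*} [Field k] [Ring A] [HopfAlgebra k A] [AddCommGroup U]
    [Module k U] [Module A U] [IsScalarTower k A U] [AddCommGroup N] [Module k N]
    [AddCommGroup Y] [Module k Y]

namespace TotalComplex

variable (X : TotalComplex k A U)

/-- The augmentation with values in `k`. -/
def aug' : U →ₗ[k] k := Triv.toField k A ∘ₗ X.μ.restrictScalars k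

/-- The differential `D ⊗ 1 + σ ⊗ T` of `U ⊗ N`. -/
def tot (T : N →ₗ[k] N) : U ⊗[k] N →ₗ[k] U ⊗[k] N :=
  (X.D.restrictScalars k).rTensor N + T.lTensor U ∘ₗ ((X.sg (-1)).restrictScalars k).rTensor N

theorem tot_tmul (T : N →ₗ[k] N) (u : U) (y : N) :
    X.tot T (u ⊗ₜ y) = X.D u ⊗ₜ y + X.sg (-1) u ⊗ₜ T y := rfl

theorem isHom_tot {B : Bimod k A N} {T : N →ₗ[k] N} (hT : B.IsHom B T) :
    (B.twist U).IsHom (B.twist U) (X.tot T) :=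
  (Bimod.IsHom.rTensor B X.D).add (hT.lTensor.comp (Bimod.IsHom.rTensor B (X.sg (-1))))

/-- The contraction of `U ⊗ N` obtained from contractions of `U` and of `N`. -/
def contraction (C : Contraction (X.D.restrictScalars k) X.aug')
    (hH : ∀ x, X.sg (-1) (C.H x) = -C.H (X.sg (-1) x)) (hj : ∀ r, X.sg (-1) (C.j r) = C.j r)
    {T : N →ₗ[k] N} {ε : N →ₗ[k] Y} (C' : Contraction T ε) :
    Contraction (X.tot T) (ε ∘ₗ evalLeft N X.μ) where
  -- Contract the first factor; what this leaves is its projection onto the image of `j`, on which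
  -- the second factor is contracted.
  H := C.H.rTensor N + TensorProduct.map (C.j ∘ₗ X.aug') C'.H
  j := TensorProduct.mk k U N (C.j 1) ∘ₗ C'.j
  eq x := by
    induction x using TensorProduct.induction_on with
    | zero => simp
    | add x y hx hy =>
      rw [map_add, map_add, map_add, map_add, add_add_add_comm, hx, hy]
      simp only [map_add]; abel
    | tmul u y =>
      have h1 := C.eq u
      have h2 := C'.eq y
      have h3 : X.D (C.j (X.aug' u)) = 0 := C.D_j _
      have h4 : X.aug' (X.D u) = 0 := X.μ_D u
      have h5 : X.aug' (X.sg (-1) u) = X.aug' u := X.μ_sg _ u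
      have h6 : C.j (X.aug' u) = X.aug' u • C.j 1 := by rw [← map_smul]; simp
      rw [LinearMap.restrictScalars_apply, LinearMap.restrictScalars_apply] at h1
      simp only [LinearMap.add_apply, LinearMap.rTensor_tmul, TensorProduct.map_tmul, map_add,
        tot_tmul, LinearMap.comp_apply, hH, hj, h3, h4, h5, evalLeft_tmul, map_zero,
        TensorProduct.zero_tmul, TensorProduct.mk_apply, map_smul, TensorProduct.neg_tmul]
      rw [eq_sub_of_add_eq h1, eq_sub_of_add_eq h2, h6]
      have h7 : Triv.toField k A (X.μ u) = X.aug' u := rfl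
      simp only [TensorProduct.sub_tmul, TensorProduct.tmul_sub, h7]
      abel
  ε_H x := by
    induction x using TensorProduct.induction_on with
    | zero => simp
    | add x y hx hy => simp only [map_add, hx, hy, add_zero]
    | tmul u y =>
      have h1 : Triv.toField k A (X.μ (C.H u)) = 0 := C.ε_H u
      simp [evalLeft_tmul, C'.ε_H, h1]
  ε_j y := by
    have h1 : Triv.toField k A (X.μ (C.j 1)) = 1 := C.ε_j 1
    simp [evalLeft_tmul, C'.ε_j, h1]
  D_j y := by
    have h1 : X.D (C.j 1) = 0 := C.D_j 1
    simp [tot_tmul, h1, C'.D_j]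

variable (N) in
/-- The trivial contraction of a module placed in degree `0`. -/
def _root_.HopfBracket.Contraction.trivial : Contraction (0 : N →ₗ[k] N) LinearMap.id where
  H := 0
  j := LinearMap.id
  eq := by simp
  ε_H := by simp
  ε_j := by simp
  D_j := by simp

theorem tot_zero : X.tot (0 : N →ₗ[k] N) = (X.D.restrictScalars k).rTensor N := by
  simp [tot]

theorem tot_box {B : Bimod k A N} {T : N →ₗ[k] N} (hT : B.IsHom B T) (x : U ⊗[k] A) (y : N) :
    X.tot T (box U B x y) = box U B (X.tot 0 x) y +
      box U B (((X.sg (-1)).restrictScalars k).rTensor A x) (T y) := by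
  induction x using TensorProduct.induction_on with
  | zero => simp
  | add x y hx hy => simp only [map_add, LinearMap.add_apply, hx, hy]; abel
  | tmul u a => simp [box_tmul, tot_tmul, hT.L]

theorem diagMap_tot (x : U ⊗[k] N) : diagMap N X.Δ (X.tot 0 x) =
    X.tot (X.tot 0) (diagMap N X.Δ x) := by
  induction x using TensorProduct.induction_on with
  | zero => simp
  | add x y hx hy => simp only [map_add, hx, hy]
  | tmul u y =>
    simp only [tot_zero, diagMap, LinearMap.comp_apply, LinearMap.rTensor_tmul,
      LinearMap.restrictScalars_apply, X.Δ_D]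
    generalize X.Δ u = z
    induction z using TensorProduct.induction_on with
    | zero => simp
    | add x y hx hy =>
      simp only [map_add, TensorProduct.add_tmul] at hx hy ⊢
      rw [← hx, ← hy]; abel
    | tmul p q => simp [tot_tmul, TensorProduct.add_tmul]

/-- The map `f ⊗ 1 - 1 ⊗ f` from `U ⊗ (U ⊗ N)` to `U ⊗ N`, with `t = (-1) ^ deg f`. -/
def comm (N : Type*) [AddCommGroup N] [Module k N] (t : ℤ) (f : U →ₗ[A] Triv k A) :
    U ⊗[k] (U ⊗[k] N) →ₗ[k] U ⊗[k] N :=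
  evalLeft (U ⊗[k] N) f -
    (evalLeft N f).lTensor U ∘ₗ ((X.sg t).restrictScalars k).rTensor (U ⊗[k] N)

theorem comm_tmul (t : ℤ) (f : U →ₗ[A] Triv k A) (u : U) (y : U ⊗[k] N) :
    X.comm N t f (u ⊗ₜ y) = Triv.toField k A (f u) • y - X.sg t u ⊗ₜ evalLeft N f y := by
  simp [comm, evalLeft_tmul]

theorem isHom_comm (B : Bimod k A N) (t : ℤ) (f : U →ₗ[A] Triv k A) :
    ((B.twist U).twist U).IsHom (B.twist U) (X.comm N t f) :=
  (isHom_evalLeft _ f).sub ((isHom_evalLeft B f).lTensor.comp (Bimod.IsHom.rTensor _ (X.sg t)))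

/-- `f` is a cocycle of a degree whose parity is given by the sign `t`. -/
structure IsCocycle (t : ℤ) (f : U →ₗ[A] Triv k A) : Prop where
  sq : t * t = 1
  D : ∀ x, f (X.D x) = 0
  sg : ∀ x, f (X.sg (-1) x) = t • f x

/-- The equation `D ψ - s ψ D = (f ⊗ 1 - 1 ⊗ f) Δ`, where `s = -t`. -/
def TotalBoundaryEq (t : ℤ) (f : U →ₗ[A] Triv k A) (ψ : U →ₗ[A] U) : Prop :=
  ∀ x, X.D (ψ x) + t • ψ (X.D x) = evalLeft U f (X.Δ x) -
    evalRight U f (((X.sg t).restrictScalars k).rTensor U (X.Δ x))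

theorem evalLeft_tot (f : U →ₗ[A] Triv k A) (hf : ∀ x, f (X.D x) = 0) (x : U ⊗[k] N) :
    evalLeft N f (X.tot 0 x) = 0 := by
  induction x using TensorProduct.induction_on with
  | zero => simp
  | add x y hx hy => simp only [map_add, hx, hy, add_zero]
  | tmul u y => simp [tot_tmul, evalLeft_tmul, hf]

variable {X} in
-- As `f` kills boundaries, the only differentials left act on the factor that `f` does not touch;
-- moving them past `f` costs the sign `t`.
theorem IsCocycle.comm_tot {t : ℤ} {f : U →ₗ[A] Triv k A} (hf : X.IsCocycle t f)
    (z : U ⊗[k] (U ⊗[k] N)) :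
    X.tot 0 (X.comm N t f z) = t • X.comm N t f (X.tot (X.tot 0) z) := by
  induction z using TensorProduct.induction_on with
  | zero => simp
  | add x y hx hy => simp only [map_add, smul_add, hx, hy]
  | tmul u y =>
    simp only [tot_tmul, comm_tmul, map_add, hf.D, hf.sg, X.evalLeft_tot f hf.D, map_sub,
      X.sg_D t hf.sq, map_smul, map_zsmul, map_zero, zero_smul, TensorProduct.tmul_zero]
    simp only [LinearMap.zero_apply, TensorProduct.tmul_zero, smul_assoc, zero_sub,
      sub_zero, add_zero, smul_add, smul_neg, ← TensorProduct.smul_tmul', smul_smul, hf.sq,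
      one_smul]
    abel

variable {X} in
theorem TotalBoundaryEq.comm_diagMap {t : ℤ} {f : U →ₗ[A] Triv k A} {ψ : U →ₗ[A] U}
    (h : X.TotalBoundaryEq t f ψ) (x : U ⊗[k] N) :
    X.comm N t f (diagMap N X.Δ x) = X.tot 0 ((ψ.restrictScalars k).rTensor N x) +
      t • (ψ.restrictScalars k).rTensor N (X.tot 0 x) := by
  induction x using TensorProduct.induction_on with
  | zero => simp
  | add x y hx hy => simp only [map_add, hx, hy, smul_add]; abel
  | tmul u y =>
    have h1 : ∀ z : U ⊗[k] U, X.comm N t f (TensorProduct.assoc k U U N (z ⊗ₜ y)) =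
        (evalLeft U f z - evalRight U f (((X.sg t).restrictScalars k).rTensor U z)) ⊗ₜ y := by
      intro z
      induction z using TensorProduct.induction_on with
      | zero => simp
      | add x y hx hy => simp only [map_add, TensorProduct.add_tmul, hx, hy, add_sub_add_comm]
      | tmul p q =>
        simp [comm_tmul, evalLeft_tmul, evalRight_tmul, TensorProduct.sub_tmul,
          TensorProduct.smul_tmul']
    rw [diagMap, LinearMap.comp_apply, LinearMap.rTensor_tmul, LinearEquiv.coe_coe, h1, ← h u]
    simp [tot_tmul, TensorProduct.add_tmul, TensorProduct.smul_tmul']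

/-- This links homotopy liftings to circle products: applied to the cup product of a comparison map
with itself, `f ⊗ 1 - 1 ⊗ f` produces the left and the right cup product by the cochain of `f` that
occur in `δ_ins`. -/
theorem comm_box (t : ℤ) (f : U →ₗ[A] Triv k A) (x y : U ⊗[k] A) :
    X.comm A t f (box U ((Bimod.reg k A).twist U) x y) =
      ((Bimod.reg k A).twist U).L (evalLeft A f x) y -
      ((Bimod.reg k A).twist U).R (evalLeft A f y) (((X.sg t).restrictScalars k).rTensor A x) := by
  induction x using TensorProduct.induction_on with
  | zero => simp
  | add x y hx hy => simp only [map_add, LinearMap.add_apply, hx, hy, add_sub_add_comm]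
  | tmul u a =>
    rw [box_tmul, comm_tmul, (isHom_evalLeft (Bimod.reg k A) f).L]
    simp [evalLeft_tmul, Bimod.twist_R, Bimod.reg]

end TotalComplex
end Total

/-! ### Comparison maps into `U ⊗ A`, and the defect between a lifting and an insertion. -/

section TotalBracket

section
variable {k A M N W : Type*} [Field k] [Ring A] [Algebra k A] [AddCommGroup M] [Module k M]
  [AddCommGroup N] [Module k N] [AddCommGroup W] [Module k W]

theorem cup_comp_add {M' N' W' M'' N'' : Type*} [AddCommGroup M'] [Module k M'] [AddCommGroup N']
    [Module k N'] [AddCommGroup W'] [Module k W'] [AddCommGroup M''] [Module k M'']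
    [AddCommGroup N''] [Module k N''] (π : M →ₗ[k] N →ₗ[k] W) (π' : M' →ₗ[k] N' →ₗ[k] W')
    (π'' : M'' →ₗ[k] N'' →ₗ[k] W')
    (S : M → M') (T : N → N') (S' : M → M'') (T' : N → N'') (V : W →ₗ[k] W')
    (h : ∀ x y, V (π x y) = π' (S x) (T y) + π'' (S' x) (T' y)) (c : List A → M) (e : List A → N)
    (l : List A) :
    V (cup π c e l) = cup π' (fun l => S (c l)) (fun l => T (e l)) l +
      cup π'' (fun l => S' (c l)) (fun l => T' (e l)) l := by
  induction l generalizing c with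
  | nil => simp [cup, h]
  | cons a l ih => simp only [cup_cons, map_add, h, ih]; abel

theorem cup_unitCochain (B : Bimod k A M) (c : List A → M) :
    cup B.L.toLinearMap unitCochain c = c := by
  funext l
  cases l with
  | nil => simp [cup, unitCochain]
  | cons a l =>
    rw [cup_cons, show (fun x : List A => (unitCochain (a :: x) : A)) = 0 from rfl, cup_zero_left]
    simp [unitCochain]

end

variable {k A U : Type*} [Field k] [Ring A] [HopfAlgebra k A] [AddCommGroup U]
    [Module k U] [Module A U] [IsScalarTower k A U]

namespace TotalComplex
variable (X : TotalComplex k A U)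

variable (k A U) in
/-- The bimodule `U ⊗ A`. -/
abbrev indBimod : Bimod k A (U ⊗[k] A) := (Bimod.reg k A).twist U

/-- `θ` is a comparison map from the bar resolution to `U ⊗ A`. -/
structure IsTotalComparison (θ : List A → U ⊗[k] A) : Prop where
  multi : Multi k θ
  D : (fun l => X.tot 0 (θ l)) = (indBimod k A U).δ θ
  aug : ∀ l, evalLeft A X.μ (θ l) = unitCochain l
  sg : ∀ t : ℤ, (fun l => ((X.sg t).restrictScalars k).rTensor A (θ l)) = tau t θ

theorem isHom_ind_tot : (indBimod k A U).IsHom (indBimod k A U) (X.tot 0) := X.isHom_tot Bimod.IsHom.zero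

/-- A contraction of `U`, compatible with the signs. -/
structure SignedContraction extends Contraction (X.D.restrictScalars k) X.aug' where
  sg_H : ∀ x, X.sg (-1) (H x) = -H (X.sg (-1) x)
  sg_j : ∀ r, X.sg (-1) (j r) = j r

variable {X}

/-- The induced contraction of `U ⊗ A`. -/
def SignedContraction.ind (C : X.SignedContraction) :
    Contraction (X.tot (0 : A →ₗ[k] A)) (evalLeft A X.μ) :=
  X.contraction C.toContraction C.sg_H C.sg_j (.trivial A)

/-- The induced contraction of `U ⊗ (U ⊗ A)`. -/
def SignedContraction.ind₂ (C : X.SignedContraction) :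
    Contraction (X.tot (X.tot (0 : A →ₗ[k] A))) (evalLeft A X.μ ∘ₗ evalLeft (U ⊗[k] A) X.μ) :=
  X.contraction C.toContraction C.sg_H C.sg_j C.ind

variable {θ : List A → U ⊗[k] A}

theorem IsTotalComparison.cocycle (hθ : X.IsTotalComparison θ) {f : U →ₗ[A] Triv k A}
    (hf : ∀ x, f (X.D x) = 0) : (Bimod.reg k A).δ (fun l => evalLeft A f (θ l)) = 0 := by
  rw [(isHom_evalLeft (Bimod.reg k A) f).δ_comp, ← hθ.D]
  funext l
  exact X.evalLeft_tot f hf _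

theorem evalLeft_rTensor {V N : Type*} [AddCommGroup V] [Module k V] [Module A V]
    [IsScalarTower k A V] [AddCommGroup N] [Module k N]
    (f : V →ₗ[A] Triv k A) (φ : U →ₗ[A] V) (x : U ⊗[k] N) :
    evalLeft N f ((φ.restrictScalars k).rTensor N x) = evalLeft N (f ∘ₗ φ) x := by
  induction x using TensorProduct.induction_on with
  | zero => simp
  | add x y hx hy => simp only [map_add, hx, hy]
  | tmul u y => simp [evalLeft_tmul]

theorem evalLeft_zsmul {N : Type*} [AddCommGroup N] [Module k N] (t : ℤ)
    (f : U →ₗ[A] Triv k A) : evalLeft N (t • f) = t • evalLeft N f := by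
  ext u y; simp [evalLeft_tmul, mul_smul, Int.cast_smul_eq_zsmul]

theorem evalLeft_sub {N : Type*} [AddCommGroup N] [Module k N]
    (f g : U →ₗ[A] Triv k A) : evalLeft N (f - g) = evalLeft N f - evalLeft N g := by
  ext u y; simp [evalLeft_tmul, sub_smul]

theorem IsTotalComparison.tau_evalLeft (hθ : X.IsTotalComparison θ) {t : ℤ}
    {f : U →ₗ[A] Triv k A} (hf : X.IsCocycle t f) :
    tau (-1) (fun l => evalLeft A f (θ l)) = t • fun l => evalLeft A f (θ l) := by
  funext l
  have h := congrArg (evalLeft A f) (congrFun (hθ.sg (-1)) l)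
  have h2 : f ∘ₗ X.sg (-1) = t • f := LinearMap.ext hf.sg
  rw [evalLeft_rTensor, h2, evalLeft_zsmul] at h
  simp only [tau, map_zsmul] at h ⊢
  rw [← h]; rfl

theorem aug_diagMap (x : U ⊗[k] A) :
    evalLeft A X.μ (evalLeft (U ⊗[k] A) X.μ (diagMap A X.Δ x)) = evalLeft A X.μ x := by
  induction x using TensorProduct.induction_on with
  | zero => simp
  | add x y hx hy => simp only [map_add, hx, hy]
  | tmul u a =>
    rw [evalLeft_tmul, ← X.aug]
    simp only [diagMap, LinearMap.comp_apply, LinearMap.rTensor_tmul, LinearEquiv.coe_coe]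
    generalize X.Δ u = z
    induction z using TensorProduct.induction_on with
    | zero => simp
    | add x y hx hy => simp only [map_add, TensorProduct.add_tmul, add_smul, hx, hy]
    | tmul p q => simp [evalLeft_tmul, mul_smul]

theorem aug_box (x y : U ⊗[k] A) :
    evalLeft A X.μ (evalLeft (U ⊗[k] A) X.μ (box U (indBimod k A U) x y)) =
      (Bimod.reg k A).L (evalLeft A X.μ x) (evalLeft A X.μ y) := by
  induction x using TensorProduct.induction_on with
  | zero => simp
  | add x y hx hy => simp only [map_add, LinearMap.add_apply, hx, hy]
  | tmul u a =>
    rw [box_tmul, evalLeft_tmul, map_smul, (isHom_evalLeft (Bimod.reg k A) X.μ).L, evalLeft_tmul]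
    simp

/-- The two maps `(θ ⊗ θ) Δ` and `Δ θ` are homotopic. -/
theorem IsTotalComparison.exists_homotopy (hθ : X.IsTotalComparison θ) (C : X.SignedContraction) :
    ∃ u : List A → U ⊗[k] (U ⊗[k] A), Multi k u ∧
      cup (box U (indBimod k A U)) θ θ = (fun l => diagMap A X.Δ (θ l)) +
        (fun l => X.tot (X.tot 0) (u l)) + ((indBimod k A U).twist U).δ u := by
  have hD := X.isHom_tot (X.isHom_ind_tot)
  have hε := (isHom_evalLeft (Bimod.reg k A) X.μ).comp (isHom_evalLeft (indBimod k A U) X.μ)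
  have hΔ := isHom_diagMap (Bimod.reg k A) X.Δ_smul
  -- The cup product of `θ` with itself is a chain map by the Leibniz rule: the sign `tau (-1)`
  -- there matches the sign operator in the differential of a tensor product.
  have e1 : ∀ l, X.tot (X.tot 0) (cup (box U (indBimod k A U)) θ θ l) =
      ((indBimod k A U).twist U).δ (cup (box U (indBimod k A U)) θ θ) l := by
    intro l
    rw [(box_balanced (indBimod k A U)).δ_cup, ← hθ.D, ← hθ.sg]
    exact cup_comp_add _ _ _ _ id _ _ _ (fun x y => X.tot_box (X.isHom_ind_tot) x y) _ _ l
  have e2 : ∀ l, X.tot (X.tot 0) (diagMap A X.Δ (θ l)) =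
      ((indBimod k A U).twist U).δ (fun l => diagMap A X.Δ (θ l)) l := by
    intro l
    rw [hΔ.δ_comp, ← hθ.D, ← X.diagMap_tot]
  -- Both chain maps augment to the unit cochain, so their difference augments to zero and is a
  -- boundary in the contractible complex `U ⊗ (U ⊗ A)`.
  obtain ⟨u, hu, h, -, -⟩ := C.ind₂.solve (B := (indBimod k A U).twist U) (B' := Bimod.reg k A)
    hD hε 1 (c := cup (box U (indBimod k A U)) θ θ - fun l => diagMap A X.Δ (θ l))
    ((hθ.multi.cup _ hθ.multi).sub (hθ.multi.comp _))
    (by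
      funext l
      rw [one_smul, Bimod.δ_sub, Pi.sub_apply, Pi.sub_apply, ← e1, ← e2, map_sub])
    (by
      intro l
      rw [Pi.sub_apply, map_sub, LinearMap.comp_apply, LinearMap.comp_apply, aug_diagMap, hθ.aug,
        sub_eq_zero]
      have := cup_comp (box U (indBimod k A U)) (Bimod.reg k A).L.toLinearMap (evalLeft A X.μ)
        (evalLeft A X.μ) (evalLeft A X.μ ∘ₗ evalLeft (U ⊗[k] A) X.μ) (aug_box (X := X)) θ θ l
      rw [LinearMap.comp_apply] at this
      rw [this]
      have h := cup_unitCochain (Bimod.reg k A) unitCochain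
      simp only [hθ.aug]
      exact congrFun h l)
  refine ⟨u, hu, ?_⟩
  rw [add_assoc, add_comm, ← sub_eq_iff_eq_add, h, one_smul]

variable (X) in
/-- The difference between the morphism induced by `ψ` and the insertion of the cochain of `f`,
corrected by the homotopy `u`. -/
def defect (t : ℤ) (f : U →ₗ[A] Triv k A) (ψ : U →ₗ[A] U) (θ : List A → U ⊗[k] A)
    (u : List A → U ⊗[k] (U ⊗[k] A)) : List A → U ⊗[k] A :=
  (fun l => (ψ.restrictScalars k).rTensor A (θ l)) - ins (-t) θ (fun l => evalLeft A f (θ l))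
    + t • fun l => X.comm A t f (u l)

variable {u : List A → U ⊗[k] (U ⊗[k] A)}

theorem multi_defect (hθ : Multi k θ) (hu : Multi k u) (t : ℤ) (f : U →ₗ[A] Triv k A)
    (ψ : U →ₗ[A] U) : Multi k (X.defect t f ψ θ u) :=
  ((hθ.comp _).sub (hθ.ins (hθ.comp _) _)).add' ((hu.comp _).zsmul t)

/-- The lifting and the insertion fail to be chain maps by `f ⊗ 1 - 1 ⊗ f` applied to `Δ θ` and to
the cup product of `θ` with itself. These two differ by the boundary of `u`, which the third summand
of the defect absorbs. The sign `-t` is that of a map of degree one less than `f`. -/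
theorem tot_defect (hθ : X.IsTotalComparison θ)
    (hu : cup (box U (indBimod k A U)) θ θ = (fun l => diagMap A X.Δ (θ l)) +
        (fun l => X.tot (X.tot 0) (u l)) + ((indBimod k A U).twist U).δ u)
    {t : ℤ} {f : U →ₗ[A] Triv k A} (hf : X.IsCocycle t f) {ψ : U →ₗ[A] U}
    (hψ : X.TotalBoundaryEq t f ψ) :
    (fun l => X.tot 0 (X.defect t f ψ θ u l)) = (-t) • (indBimod k A U).δ (X.defect t f ψ θ u) := by
  set F : List A → A := fun l => evalLeft A f (θ l)
  have h1 : (fun l => X.tot 0 ((ψ.restrictScalars k).rTensor A (θ l))) =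
      (fun l => X.comm A t f (diagMap A X.Δ (θ l))) -
      t • (indBimod k A U).δ (fun l => (ψ.restrictScalars k).rTensor A (θ l)) := by
    funext l
    rw [(Bimod.IsHom.rTensor (Bimod.reg k A) ψ).δ_comp, ← hθ.D]
    simp only [Pi.sub_apply, hψ.comm_diagMap, Pi.smul_apply]
    abel
  -- The insertion is a lifting for the diagonal of the bar resolution: in `δ_ins` the term with `δ
  -- F` vanishes because `f` is a cocycle, and `comm_box` recognizes the two cup products.
  have h2 : (fun l => X.tot 0 (ins (-t) θ F l)) = (-t) • (indBimod k A U).δ (ins (-t) θ F) +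
      fun l => X.comm A t f (cup (box U (indBimod k A U)) θ θ l) := by
    have e1 := δ_ins (indBimod k A U) hθ.multi hf.sq rfl (hθ.tau_evalLeft hf)
    rw [hθ.cocycle hf.D, ins_zero_right _ hθ.multi, smul_zero, sub_zero, ← hθ.D] at e1
    have e2 : (fun l => X.tot 0 (ins (-t) θ F l)) = ins (-t) (fun l => X.tot 0 (θ l)) F :=
      funext fun l => (ins_comp (-t) (X.tot 0) F θ l).symm
    rw [e2, e1, add_sub_assoc]
    congr 1
    funext l
    have e3 := cup_comp_add (box U (indBimod k A U)) (indBimod k A U).L.toLinearMap (-(indBimod k A U).R.flip)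
      (evalLeft A f) id (((X.sg t).restrictScalars k).rTensor A) (evalLeft A f) (X.comm A t f)
      (fun x y => by rw [X.comm_box t f x y]; simp [sub_eq_add_neg]) θ θ l
    rw [e3]
    have e4 : ∀ (c : List A → U ⊗[k] A) (e : List A → A) (l : List A),
        cup (-(indBimod k A U).R.flip) c e l = -cup (indBimod k A U).R.flip c e l := by
      intro c e l
      induction l generalizing c with
      | nil => simp [cup]
      | cons a l ih => simp [cup_cons, ih]; abel
    have e5 := hθ.sg t
    rw [e4, e5, ← sub_eq_add_neg]
    rfl
  have h3 : (fun l => X.tot 0 (X.comm A t f (u l))) =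
      t • fun l => X.comm A t f (X.tot (X.tot 0) (u l)) :=
    funext fun l => hf.comm_tot (u l)
  have h4 : (fun l => X.comm A t f (cup (box U (indBimod k A U)) θ θ l)) =
      (fun l => X.comm A t f (diagMap A X.Δ (θ l))) +
      (fun l => X.comm A t f (X.tot (X.tot 0) (u l))) +
      (indBimod k A U).δ (fun l => X.comm A t f (u l)) := by
    rw [(X.isHom_comm (Bimod.reg k A) t f).δ_comp, hu]
    funext l
    simp
  have h5 : (fun l => X.tot 0 (X.defect t f ψ θ u l)) =
      (fun l => X.tot 0 ((ψ.restrictScalars k).rTensor A (θ l))) -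
      (fun l => X.tot 0 (ins (-t) θ F l)) + t • fun l => X.tot 0 (X.comm A t f (u l)) := by
    funext l; simp [defect, F]
  have ht : ∀ z : List A → U ⊗[k] A, t • t • z = z := fun z => by rw [smul_smul, hf.sq, one_smul]
  rw [h5, h1, h2, h3, h4, ht, defect, Bimod.δ_add, Bimod.δ_sub, Bimod.δ_zsmul, smul_add, neg_smul t (t • _), ht]
  module

/-- A chain map up to sign which augments to a coboundary is null-homotopic. -/
theorem SignedContraction.null_homotopic (C : X.SignedContraction) {t : ℤ} (ht : t * t = 1)
    {c : List A → U ⊗[k] A} (hc : Multi k c)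
    (hD : (fun l => X.tot 0 (c l)) = t • (indBimod k A U).δ c) {β : List A → A} (hβ : Multi k β)
    (hε : (fun l => evalLeft A X.μ (c l)) = (Bimod.reg k A).δ β) :
    ∃ v : List A → U ⊗[k] A, Multi k v ∧
      c = (fun l => X.tot 0 (v l)) + t • (indBimod k A U).δ v := by
  -- Lift `β` along the section of the augmentation. Subtracting `δ b` from `c` makes the
  -- augmentation zero, and `D b = 0` keeps the chain map equation intact.
  set b : List A → U ⊗[k] A := fun l => C.ind.j (β l)
  have hb : Multi k b := hβ.comp _
  have hεb : ∀ l, evalLeft A X.μ ((indBimod k A U).δ b l) = (Bimod.reg k A).δ β l := by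
    intro l
    have := congrFun ((isHom_evalLeft (Bimod.reg k A) X.μ).δ_comp b) l
    rw [← this]
    congr 1
    funext l
    exact C.ind.ε_j _
  have hDb : (fun l => X.tot 0 (b l)) = 0 := funext fun l => C.ind.D_j _
  have hDδ : ∀ l, X.tot 0 ((indBimod k A U).δ b l) = 0 := by
    intro l
    have := congrFun (X.isHom_ind_tot.δ_comp b) l
    rw [← this, hDb, Bimod.δ_zero]
    rfl
  obtain ⟨v, hv, h, -, -⟩ := C.ind.solve X.isHom_ind_tot (isHom_evalLeft (Bimod.reg k A) X.μ) t
    (c := c - (indBimod k A U).δ b) (hc.sub (hb.δ _))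
    (by
      rw [Bimod.δ_sub, Bimod.δ_δ, sub_zero, ← hD]
      funext l
      rw [Pi.sub_apply, map_sub, hDδ, sub_zero])
    (by
      intro l
      rw [Pi.sub_apply, map_sub, hεb, ← congrFun hε l, sub_self])
  -- The coefficient `t` is its own inverse, so `t • δ (t • b)` restores the `δ b` that was
  -- subtracted.
  refine ⟨v + t • b, hv.add' (hb.zsmul t), ?_⟩
  have e : (fun l => X.tot 0 ((v + t • b) l)) = fun l => X.tot 0 (v l) := by
    funext l
    have := congrFun hDb l
    simp only [Pi.zero_apply] at this
    simp [this]
  rw [e, Bimod.δ_add, Bimod.δ_zsmul, smul_add, smul_smul, ht, one_smul, ← add_assoc, ← h]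
  abel

end TotalComplex
end TotalBracket

/-! ### The bracket formula on the total module. -/

section TotalTheorem

variable {k A U : Type*} [Field k] [Ring A] [HopfAlgebra k A] [AddCommGroup U]
    [Module k U] [Module A U] [IsScalarTower k A U]

/-- An insertion evaluates its outer cochain on nonempty lists only, and there the unit cochain
vanishes. -/
theorem ins_unitCochain_left (s : ℤ) (Φ : List A → A) : ins s unitCochain Φ = 0 := by
  have h0 : ∀ (l : List A) (Φ : List A → A), insHead Φ (unitCochain : List A → A) l = 0 := by
    intro l
    induction l with
    | nil => intro Φ; rfl
    | cons a l ih => intro Φ; rw [insHead_cons, ih]; simp [unitCochain]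
  funext l
  cases l with
  | nil => rfl
  | cons a l =>
    rw [ins_cons, h0, show (fun x : List A => (unitCochain (a :: x) : A)) = 0 from rfl,
      ins_zero_left]
    simp

namespace TotalComplex
variable {X : TotalComplex k A U}

variable (X) in
/-- `f` is a cocycle of degree `m`. -/
structure IsDegCocycle (m : ℕ) (f : U →ₗ[A] Triv k A) : Prop where
  D : ∀ x, f (X.D x) = 0
  sg : ∀ (t : ℤ) x, f (X.sg t x) = t ^ m • f x

theorem IsDegCocycle.isCocycle {m : ℕ} {f : U →ₗ[A] Triv k A} (hf : X.IsDegCocycle m f) :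
    X.IsCocycle ((-1) ^ m) f :=
  ⟨by rw [← mul_pow]; simp, hf.D, hf.sg (-1)⟩

variable (X) in
/-- `ψ` is a homotopy lifting of the `m`-cocycle `f`. -/
def IsTotalLifting (m : ℕ) (f : U →ₗ[A] Triv k A) (ψ : U →ₗ[A] U) : Prop :=
  X.TotalBoundaryEq ((-1) ^ m) f ψ ∧ ∃ φ : U →ₗ[A] U, X.TotalBoundaryEq 1 X.μ φ ∧
    (∀ x, X.μ (φ x) = 0) ∧
    ∃ w : U →ₗ[A] Triv k A, ∀ x, X.μ (ψ x) + (-1 : ℤ) ^ m • f (φ x) = w (X.D x)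

variable {θ : List A → U ⊗[k] A} {u : List A → U ⊗[k] (U ⊗[k] A)}

/-- On `p ⊗ y` both sides are combinations of `g(p) f(y)` and `f(p) g(y)`. The antisymmetry is used
twice: with `μ` in place of one cocycle to compare augmentations, and for `f` and `g` to cancel the
corrections in the bracket. -/
theorem evalLeft_comm_swap {m n : ℕ} {f g : U →ₗ[A] Triv k A} (hf : X.IsDegCocycle m f)
    (hg : X.IsDegCocycle n g) (z : U ⊗[k] (U ⊗[k] A)) :
    evalLeft A f (X.comm A ((-1) ^ n) g z) =
      -((-1 : ℤ) ^ (m * n) • evalLeft A g (X.comm A ((-1) ^ m) f z)) := by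
  induction z using TensorProduct.induction_on with
  | zero => simp
  | add x y hx hy => simp only [map_add, smul_add, hx, hy]; abel
  | tmul p y =>
    simp only [comm_tmul, map_sub, map_smul, evalLeft_tmul, hf.sg, hg.sg, map_zsmul]
    rw [← pow_mul, ← pow_mul, mul_comm n m]
    have h : (-1 : ℤ) ^ (m * n) * (-1 : ℤ) ^ (m * n) = 1 := by rw [← mul_pow]; simp
    simp only [smul_sub, smul_assoc, smul_smul ((-1 : ℤ) ^ (m * n)) ((-1 : ℤ) ^ (m * n)), h,
      one_smul]
    abel

theorem isDegCocycle_μ : X.IsDegCocycle 0 X.μ := ⟨X.μ_D, fun t x => by simp [X.μ_sg]⟩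

/-- A cochain of `U ⊗ A` induced from a coboundary is a Hochschild coboundary. -/
theorem IsTotalComparison.evalLeft_comp_D (hθ : X.IsTotalComparison θ) (w : U →ₗ[A] Triv k A) :
    (fun l => evalLeft A (w ∘ₗ X.D) (θ l)) = (Bimod.reg k A).δ (fun l => evalLeft A w (θ l)) := by
  rw [(isHom_evalLeft (Bimod.reg k A) w).δ_comp, ← hθ.D]
  funext l
  rw [X.tot_zero, evalLeft_rTensor]

theorem evalLeft_defect (f g : U →ₗ[A] Triv k A) (t : ℤ) (ψ : U →ₗ[A] U) :
    (fun l => evalLeft A g (X.defect t f ψ θ u l)) =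
      (fun l => evalLeft A (g ∘ₗ ψ) (θ l))
        - ins (-t) (fun l => evalLeft A g (θ l)) (fun l => evalLeft A f (θ l))
        + t • fun l => evalLeft A g (X.comm A t f (u l)) := by
  funext l
  have h := ins_comp (-t) (evalLeft A g) (fun l => evalLeft A f (θ l)) θ l
  simp [defect, evalLeft_rTensor, h]

/-- Evaluating a null-homotopic cochain of `U ⊗ A` at a cocycle gives a coboundary. -/
theorem evalLeft_null_homotopic {g : U →ₗ[A] Triv k A} (hg : ∀ x, g (X.D x) = 0) {t : ℤ}
    {c v : List A → U ⊗[k] A} (h : c = (fun l => X.tot 0 (v l)) + t • (indBimod k A U).δ v) :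
    (fun l => evalLeft A g (c l)) = t • (Bimod.reg k A).δ (fun l => evalLeft A g (v l)) := by
  rw [(isHom_evalLeft (Bimod.reg k A) g).δ_comp, h]
  funext l
  simp [X.evalLeft_tot g hg]

/-- The cochain `g ψ`, for a homotopy lifting `ψ` of `f`, is cohomologous to the circle product of
the cochains of `g` and `f`, up to a term which depends only on `f`, `g`. -/
theorem IsTotalComparison.lifting (hθ : X.IsTotalComparison θ) (hN : Normal θ)
    (C : X.SignedContraction) (hm : Multi k u)
    (hu : cup (box U (indBimod k A U)) θ θ = (fun l => diagMap A X.Δ (θ l)) +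
        (fun l => X.tot (X.tot 0) (u l)) + ((indBimod k A U).twist U).δ u)
    {m : ℕ} {f g : U →ₗ[A] Triv k A} (hf : X.IsDegCocycle m f) (hg : ∀ x, g (X.D x) = 0)
    {ψ : U →ₗ[A] U} (hψ : X.IsTotalLifting m f ψ) :
    ∃ w : List A → A, Multi k w ∧ (fun l => evalLeft A (g ∘ₗ ψ) (θ l)) =
      ins ((-1) ^ (m + 1)) (fun l => evalLeft A g (θ l)) (fun l => evalLeft A f (θ l))
        - (-1 : ℤ) ^ m • (fun l => evalLeft A g (X.comm A ((-1) ^ m) f (u l)))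
        + (Bimod.reg k A).δ w := by
  obtain ⟨hψ, φ, hφ, hφμ, w, hw⟩ := hψ
  have hμ := isDegCocycle_μ (X := X)
  have haug : (fun l => evalLeft A X.μ (θ l)) = unitCochain := funext hθ.aug
  have hs : ((-1 : ℤ) ^ (m + 1)) = -(-1) ^ m := by ring
  -- the homotopy for the lifting of the augmentation
  have h1 : (fun l => evalLeft A X.μ (X.defect 1 X.μ φ θ u l)) = (Bimod.reg k A).δ 0 := by
    have e1 : X.μ ∘ₗ φ = 0 := LinearMap.ext hφμ
    have e2 : (fun l => evalLeft A X.μ (X.comm A 1 X.μ (u l))) = 0 := by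
      funext l
      generalize u l = z
      induction z using TensorProduct.induction_on with
      | zero => simp
      | add x y hx hy => simp only [map_add, hx, hy, Pi.zero_apply, add_zero]
      | tmul p y => simp [comm_tmul, evalLeft_tmul, X.μ_sg]
    have e3 : (fun l => evalLeft A (0 : U →ₗ[A] Triv k A) (θ l)) = 0 := by
      funext l; simp [evalLeft]
    rw [evalLeft_defect, e1, e2, e3, haug, ins_unitCochain_left, Bimod.δ_zero]
    simp
  obtain ⟨v, hv, hv'⟩ := C.null_homotopic (t := -1) (by norm_num)
    (multi_defect hθ.multi hm _ _ _)
    (by simpa using tot_defect hθ hu (t := 1) (by simpa using hμ.isCocycle) hφ)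
    Multi.zero h1
  have h2 := evalLeft_null_homotopic hf.D hv'
  rw [evalLeft_defect, haug, ← neg_one_zsmul] at h2
  -- Normalization of `θ` is used here: the cochain of the augmentation is the unit, and its
  -- insertion into the cochain of `f` must disappear.
  have e4 : ins (-1) (fun l => evalLeft A f (θ l)) unitCochain = 0 := by
    refine Normal.ins_unitCochain (k := k) (fun x z => ?_) (hθ.multi.comp _) _
    simp [hN x z]
  have e5 : (fun l => evalLeft A X.μ (X.comm A ((-1) ^ m) f (u l))) =
      -fun l => evalLeft A f (X.comm A 1 X.μ (u l)) := by
    funext l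
    have := evalLeft_comm_swap hμ hf (u l)
    simpa using this
  -- The condition on `μ ψ` contributes the coboundary from `w` and a term in `f φ`. The latter
  -- cancels against the correction in `u`, which by `e5` and `h2` equals the `f φ` term up to the
  -- coboundary coming from `v`.
  have h3 : (fun l => evalLeft A X.μ (X.defect ((-1) ^ m) f ψ θ u l)) =
      (Bimod.reg k A).δ ((fun l => evalLeft A w (θ l)) +
        (-1 : ℤ) ^ m • fun l => evalLeft A f (v l)) := by
    have e6 : X.μ ∘ₗ ψ = w ∘ₗ X.D - (-1 : ℤ) ^ m • (f ∘ₗ φ) := by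
      ext x
      have := hw x
      rw [← eq_sub_iff_add_eq] at this
      exact this
    have e7 : (fun l => evalLeft A (X.μ ∘ₗ ψ) (θ l)) =
        (Bimod.reg k A).δ (fun l => evalLeft A w (θ l)) -
          (-1 : ℤ) ^ m • fun l => evalLeft A (f ∘ₗ φ) (θ l) := by
      rw [← hθ.evalLeft_comp_D, e6, evalLeft_sub, evalLeft_zsmul]
      rfl
    rw [evalLeft_defect, haug, ins_unitCochain_left, e5, e7, Bimod.δ_add, Bimod.δ_zsmul]
    have e8 : (fun l => evalLeft A f (X.comm A 1 X.μ (u l))) =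
        -(Bimod.reg k A).δ (fun l => evalLeft A f (v l)) -
          (fun l => evalLeft A (f ∘ₗ φ) (θ l)) := by
      rw [neg_one_zsmul, e4, sub_zero, one_smul, neg_one_zsmul, add_comm] at h2
      exact eq_sub_of_add_eq h2
    rw [e8]
    simp only [smul_sub, smul_neg, neg_sub, sub_zero]
    abel
  obtain ⟨v', hv₁, hv₂⟩ := C.null_homotopic (t := -(-1) ^ m) (by rw [neg_mul_neg, ← mul_pow]; simp)
    (multi_defect hθ.multi hm _ _ _) (tot_defect hθ hu hf.isCocycle hψ)
    ((hθ.multi.comp _).add' ((hv.comp _).zsmul _)) h3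
  -- With the augmentation exact, the defect is null-homotopic, so the cocycle `g` takes it to a
  -- Hochschild coboundary.
  have h4 := evalLeft_null_homotopic hg hv₂
  rw [evalLeft_defect, ← Bimod.δ_zsmul] at h4
  refine ⟨_, (hv₁.comp (evalLeft A g)).zsmul (-(-1) ^ m), ?_⟩
  rw [← h4, hs]
  abel

/-- The bracket computed from homotopy liftings represents the bracket of Hochschild cochains. -/
theorem IsTotalComparison.bracket (hθ : X.IsTotalComparison θ) (hN : Normal θ)
    (C : X.SignedContraction) {m n : ℕ} {f g : U →ₗ[A] Triv k A} (hf : X.IsDegCocycle m f)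
    (hg : X.IsDegCocycle n g) {ψf ψg : U →ₗ[A] U} (hψf : X.IsTotalLifting m f ψf)
    (hψg : X.IsTotalLifting n g ψg) :
    ∃ w : List A → A, Multi k w ∧
      listBracket m n (fun l => evalLeft A f (θ l)) (fun l => evalLeft A g (θ l)) =
        (fun l => evalLeft A (f ∘ₗ ψg - (-1 : ℤ) ^ ((m + 1) * (n + 1)) • (g ∘ₗ ψf)) (θ l)) +
        (Bimod.reg k A).δ w := by
  -- One homotopy `u` must serve both liftings; otherwise the two correction terms could not be
  -- compared.
  obtain ⟨u, hu, hu'⟩ := hθ.exists_homotopy C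
  obtain ⟨w₁, hw₁, h₁⟩ := hθ.lifting hN C hu hu' hg hf.D hψg
  obtain ⟨w₂, hw₂, h₂⟩ := hθ.lifting hN C hu hu' hf hg.D hψf
  refine ⟨(-1 : ℤ) ^ ((m + 1) * (n + 1)) • w₂ - w₁, (hw₂.zsmul _).sub hw₁, ?_⟩
  have e : (fun l => evalLeft A (f ∘ₗ ψg - (-1 : ℤ) ^ ((m + 1) * (n + 1)) • (g ∘ₗ ψf)) (θ l)) =
      (fun l => evalLeft A (f ∘ₗ ψg) (θ l)) - (-1 : ℤ) ^ ((m + 1) * (n + 1)) •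
        fun l => evalLeft A (g ∘ₗ ψf) (θ l) := by
    rw [evalLeft_sub, evalLeft_zsmul]; rfl
  have e' : (fun l => evalLeft A f (X.comm A ((-1) ^ n) g (u l))) =
      -((-1 : ℤ) ^ (m * n) • fun l => evalLeft A g (X.comm A ((-1) ^ m) f (u l))) :=
    funext fun l => evalLeft_comm_swap hf hg (u l)
  rw [e, h₁, h₂, e', Bimod.δ_sub, Bimod.δ_zsmul, listBracket]
  have e1 : (-1 : ℤ) ^ n * (-1) ^ (m * n) = -((-1) ^ ((m + 1) * (n + 1)) * (-1) ^ m) := by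
    rcases neg_one_pow_eq_or ℤ m with hm | hm <;> rcases neg_one_pow_eq_or ℤ n with hn | hn <;>
      simp [pow_mul, pow_succ, hm, hn]
  simp only [smul_add, smul_sub, smul_neg, smul_smul, e1]
  module

end TotalComplex
end TotalTheorem

/-! ### Existence of normalized comparison maps and uniqueness up to homotopy. -/

section TotalExistence

variable {k A U : Type*} [Field k] [Ring A] [HopfAlgebra k A] [AddCommGroup U]
    [Module k U] [Module A U] [IsScalarTower k A U]

theorem normal_of_nil {M : Type*} [AddCommGroup M] {c : List A → M}
    (h : ∀ a l, c (a :: l) = 0) : Normal c := by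
  intro x z; cases x <;> simp [h]

namespace TotalComplex
variable {X : TotalComplex k A U} {θ θ' : List A → U ⊗[k] A}

theorem SignedContraction.exists_normal (C : X.SignedContraction) :
    ∃ θ : List A → U ⊗[k] A, Multi k θ ∧ (fun l => X.tot 0 (θ l)) = (indBimod k A U).δ θ ∧
      (∀ l, evalLeft A X.μ (θ l) = unitCochain l) ∧ Normal θ := by
  set b : List A → U ⊗[k] A := fun l => C.ind.j (unitCochain l)
  have hb : Multi k b := Multi.unitCochain.comp _
  have hbn : Normal b := normal_of_nil fun a l => by simp [b, unitCochain]
  have hDb : (fun l => X.tot 0 (b l)) = 0 := funext fun l => C.ind.D_j _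
  have hεb : ∀ l, evalLeft A X.μ (b l) = unitCochain l := fun l => C.ind.ε_j _
  -- The cochain `b` has the right augmentation and satisfies `D b = 0`; to make `b + v` a chain
  -- map, `v` has to solve `δ b = D v - δ v`, hence `κ = -1`.
  obtain ⟨v, hv, h, hεv, hn⟩ := C.ind.solve X.isHom_ind_tot
    (isHom_evalLeft (Bimod.reg k A) X.μ) (-1) (c := (indBimod k A U).δ b) (hb.δ _)
    (by rw [Bimod.δ_δ, ← X.isHom_ind_tot.δ_comp, hDb, Bimod.δ_zero, smul_zero])
    (fun l => by
      have := congrFun ((isHom_evalLeft (Bimod.reg k A) X.μ).δ_comp b) l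
      rw [← this, funext hεb, δ_unitCochain]; rfl)
  refine ⟨b + v, hb.add' hv, ?_, fun l => ?_, fun x z => ?_⟩
  · rw [Bimod.δ_add, h]
    funext l
    have := congrFun hDb l
    simp only [Pi.zero_apply] at this
    simp [this]
  · rw [Pi.add_apply, map_add, hεv, hεb, add_zero]
  · rw [Pi.add_apply, hbn x z, hn (hbn.δ _) x z, add_zero]

/-- Two comparison maps give cohomologous Hochschild cochains. -/
theorem SignedContraction.comparison_unique (C : X.SignedContraction)
    (hθ : X.IsTotalComparison θ) (hθ' : X.IsTotalComparison θ') {f : U →ₗ[A] Triv k A}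
    (hf : ∀ x, f (X.D x) = 0) :
    ∃ w : List A → A, Multi k w ∧ (fun l => evalLeft A f (θ l)) =
      (fun l => evalLeft A f (θ' l)) + (Bimod.reg k A).δ w := by
  obtain ⟨v, hv, h, -, -⟩ := C.ind.solve X.isHom_ind_tot
    (isHom_evalLeft (Bimod.reg k A) X.μ) 1 (c := θ - θ') (hθ.multi.sub hθ'.multi)
    (by
      rw [one_smul, Bimod.δ_sub, ← hθ.D, ← hθ'.D]
      funext l; simp)
    (fun l => by rw [Pi.sub_apply, map_sub, hθ.aug, hθ'.aug, sub_self])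
  have h2 := evalLeft_null_homotopic hf h
  refine ⟨_, hv.comp (evalLeft A f), ?_⟩
  rw [one_smul] at h2
  rw [← h2]
  funext l
  simp

end TotalComplex
end TotalExistence

/-! ### The direct sum of a resolution as a total complex. -/

section DirectSumComplex

open DirectSum

variable {k A : Type*} [Field k] [Ring A] [HopfAlgebra k A]
  {P : ℕ → Type*} [∀ n, AddCommGroup (P n)] [∀ n, Module k (P n)] [∀ n, Module A (P n)]
  [∀ n, IsScalarTower k A (P n)]

/-- The sum of the terms of a resolution. -/
abbrev Tot (P : ℕ → Type*) [∀ n, AddCommGroup (P n)] := ⨁ n, P n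

variable (A P) in
/-- The inclusion of the term of degree `n`. -/
abbrev inc (n : ℕ) : P n →ₗ[A] Tot P := DirectSum.lof A ℕ P n

variable (A P) in
/-- The projection to the term of degree `n`. -/
abbrev cmp (n : ℕ) : Tot P →ₗ[A] P n := DirectSum.component A ℕ P n

theorem cmp_inc (n : ℕ) (x : P n) : cmp A P n (inc A P n x) = x :=
  DirectSum.component.lof_self A n x

theorem cmp_inc_ne {m n : ℕ} (h : n ≠ m) (x : P n) : cmp A P m (inc A P n x) = 0 := by
  rw [DirectSum.component.of, dif_neg h]

/-- The differential of the total module. -/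
def totD (d : ∀ n, P (n + 1) →ₗ[A] P n) : Tot P →ₗ[A] Tot P :=
  DirectSum.toModule A ℕ _ fun n => match n with
    | 0 => 0
    | n + 1 => inc A P n ∘ₗ d n

variable (d : ∀ n, P (n + 1) →ₗ[A] P n)

theorem totD_zero (x : P 0) : totD d (inc A P 0 x) = 0 := by
  simp [totD]

theorem totD_succ (n : ℕ) (x : P (n + 1)) :
    totD d (inc A P (n + 1) x) = inc A P n (d n x) := by
  simp [totD]

theorem cmp_totD (n : ℕ) (x : Tot P) : cmp A P n (totD d x) = d n (cmp A P (n + 1) x) := by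
  induction x using DirectSum.induction_on with
  | zero => simp
  | add x y hx hy => simp only [map_add, hx, hy]
  | of i x =>
    rw [← DirectSum.lof_eq_of A]
    cases i with
    | zero => rw [totD_zero, cmp_inc_ne (by omega)]; simp
    | succ i =>
      rw [totD_succ]
      by_cases h : i = n
      · subst h; rw [cmp_inc, cmp_inc]
      · rw [cmp_inc_ne h, cmp_inc_ne (by omega), map_zero]

variable (A P) in
/-- The sign operators of the total module. -/
def totSg (t : ℤ) : Tot P →ₗ[A] Tot P :=
  DirectSum.toModule A ℕ _ fun n => t ^ n • inc A P n

theorem totSg_inc (t : ℤ) (n : ℕ) (x : P n) : totSg A P t (inc A P n x) = t ^ n • inc A P n x := by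
  simp [totSg]

/-- The component of the diagonal map in degrees `(i, j)`. -/
def diagComponent (Δ : ∀ i j n : ℕ, i + j = n → P n →ₗ[k] P i ⊗[k] P j) (n i j : ℕ) :
    P n →ₗ[k] Tot P ⊗[k] Tot P :=
  if h : i + j = n then
    TensorProduct.map ((inc A P i).restrictScalars k) ((inc A P j).restrictScalars k) ∘ₗ Δ i j n h
  else 0

/-- The diagonal map of the total module. -/
def totΔ (Δ : ∀ i j n : ℕ, i + j = n → P n →ₗ[k] P i ⊗[k] P j) :
    Tot P →ₗ[k] Tot P ⊗[k] Tot P :=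
  DirectSum.toModule k ℕ _ fun n => ∑ p ∈ Finset.HasAntidiagonal.antidiagonal n, diagComponent (A := A) Δ n p.1 p.2

variable {d} {μ : P 0 →ₗ[A] Triv k A} {Δ : ∀ i j n : ℕ, i + j = n → P n →ₗ[k] P i ⊗[k] P j}

theorem diagComponent_apply {n i j : ℕ} (h : i + j = n) (x : P n) :
    diagComponent (A := A) Δ n i j x =
      TensorProduct.map ((inc A P i).restrictScalars k) ((inc A P j).restrictScalars k)
        (Δ i j n h x) := by
  rw [diagComponent, dif_pos h]; rfl

theorem totΔ_inc (n : ℕ) (x : P n) : totΔ (A := A) Δ (inc A P n x) =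
    ∑ p ∈ Finset.HasAntidiagonal.antidiagonal n, diagComponent (A := A) Δ n p.1 p.2 x := by
  have h : totΔ (A := A) Δ (DirectSum.lof k ℕ P n x) = _ := DirectSum.toModule_lof k n x
  rw [LinearMap.sum_apply] at h
  exact h

theorem diagonalAction_map {U V U' V' : Type*} [AddCommGroup U] [Module k U] [Module A U]
    [IsScalarTower k A U] [AddCommGroup V] [Module k V] [Module A V] [IsScalarTower k A V]
    [AddCommGroup U'] [Module k U'] [Module A U'] [IsScalarTower k A U'] [AddCommGroup V']
    [Module k V'] [Module A V'] [IsScalarTower k A V'] (φ : U →ₗ[A] U') (ψ : V →ₗ[A] V') (a : A)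
    (z : U ⊗[k] V) :
    TensorProduct.map (φ.restrictScalars k) (ψ.restrictScalars k) (diagonalAction U V a z) =
      diagonalAction U' V' a
        (TensorProduct.map (φ.restrictScalars k) (ψ.restrictScalars k) z) := by
  have key : ∀ t : A ⊗[k] A, TensorProduct.map (φ.restrictScalars k) (ψ.restrictScalars k)
      (Module.endTensorEndAlgHom (R := k) (S := k) (A := k) (M := U) (N := V)
        (Algebra.TensorProduct.map (Algebra.lsmul k k U) (Algebra.lsmul k k V) t) z) =
      Module.endTensorEndAlgHom (R := k) (S := k) (A := k) (M := U') (N := V')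
        (Algebra.TensorProduct.map (Algebra.lsmul k k U') (Algebra.lsmul k k V') t)
        (TensorProduct.map (φ.restrictScalars k) (ψ.restrictScalars k) z) := by
    intro t
    induction t using TensorProduct.induction_on with
    | zero => simp
    | add x y hx hy => simp only [map_add, LinearMap.add_apply, hx, hy]
    | tmul a b =>
      induction z using TensorProduct.induction_on with
      | zero => simp
      | add x y hx hy => simp only [map_add, hx, hy]
      | tmul u y =>
        change TensorProduct.map _ _ ((a • u) ⊗ₜ[k] (b • y)) = (a • φ u) ⊗ₜ[k] (b • ψ y)
        simp
  exact key _

/-- The total complex of a projective resolution with a diagonal map. -/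
def totalComplex (d : ∀ n, P (n + 1) →ₗ[A] P n) (μ : P 0 →ₗ[A] Triv k A)
    (hμ : ∀ x, μ (d 0 x) = 0)
    {Δ : ∀ i j n : ℕ, i + j = n → P n →ₗ[k] P i ⊗[k] P j} (hΔ : IsDiagonalMap d μ Δ) :
    TotalComplex k A (Tot P) where
  D := totD d
  sg := totSg A P
  μ := μ ∘ₗ cmp A P 0
  Δ := totΔ (A := A) Δ
  sg_D t ht x := by
    induction x using DirectSum.induction_on with
    | zero => simp
    | add x y hx hy => simp only [map_add, hx, hy, smul_add]
    | of i x =>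
      rw [← DirectSum.lof_eq_of A]
      cases i with
      | zero => simp [totD_zero, totSg_inc]
      | succ i =>
        rw [totD_succ, totSg_inc, totSg_inc, map_zsmul, totD_succ, smul_smul]
        congr 1
        rw [pow_succ, mul_comm, mul_assoc, ht, mul_one]
  μ_D x := by
    rw [LinearMap.comp_apply, cmp_totD, hμ]
  μ_sg t x := by
    induction x using DirectSum.induction_on with
    | zero => simp
    | add x y hx hy => simp only [map_add, hx, hy]
    | of i x =>
      rw [← DirectSum.lof_eq_of A]
      rw [totSg_inc]
      cases i with
      | zero => simp
      | succ i => simp only [map_zsmul, LinearMap.comp_apply]; rw [cmp_inc_ne (by omega)]; simp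
  Δ_smul a x := by
    induction x using DirectSum.induction_on with
    | zero => simp
    | add x y hx hy => simp only [smul_add, map_add, hx, hy]
    | of n x =>
      rw [← DirectSum.lof_eq_of A]
      rw [← map_smul, totΔ_inc, totΔ_inc, map_sum]
      refine Finset.sum_congr rfl fun p hp => ?_
      have h := Finset.HasAntidiagonal.mem_antidiagonal.mp hp
      rw [diagComponent_apply h, diagComponent_apply h, hΔ.map_smul, diagonalAction_map]
  Δ_D x := by
    induction x using DirectSum.induction_on with
    | zero => simp
    | add x y hx hy => simp only [map_add, hx, hy]; abel
    | of n x =>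
      rw [← DirectSum.lof_eq_of A]
      have h1 : ∀ (i j : ℕ) (z : P (i + 1) ⊗[k] P j), ((totD d).restrictScalars k).rTensor (Tot P)
          (TensorProduct.map ((inc A P (i + 1)).restrictScalars k)
            ((inc A P j).restrictScalars k) z) =
          TensorProduct.map ((inc A P i).restrictScalars k) ((inc A P j).restrictScalars k)
            (((d i).restrictScalars k).rTensor (P j) z) := by
        intro i j z
        induction z using TensorProduct.induction_on with
        | zero => simp
        | add x y hx hy => simp only [map_add, hx, hy]
        | tmul p q => simp [totD_succ]
      have h2 : ∀ (j : ℕ) (z : P 0 ⊗[k] P j), ((totD d).restrictScalars k).rTensor (Tot P)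
          (TensorProduct.map ((inc A P 0).restrictScalars k)
            ((inc A P j).restrictScalars k) z) = 0 := by
        intro j z
        induction z using TensorProduct.induction_on with
        | zero => simp
        | add x y hx hy => simp only [map_add, hx, hy, add_zero]
        | tmul p q => simp [totD_zero]
      have h3 : ∀ (i j : ℕ) (z : P i ⊗[k] P (j + 1)),
          TensorProduct.map ((totSg A P (-1)).restrictScalars k) ((totD d).restrictScalars k)
          (TensorProduct.map ((inc A P i).restrictScalars k)
            ((inc A P (j + 1)).restrictScalars k) z) =
          (-1 : ℤ) ^ i • TensorProduct.map ((inc A P i).restrictScalars k)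
            ((inc A P j).restrictScalars k) (((d j).restrictScalars k).lTensor (P i) z) := by
        intro i j z
        induction z using TensorProduct.induction_on with
        | zero => simp
        | add x y hx hy => simp only [map_add, hx, hy, smul_add]
        | tmul p q => simp [totD_succ, totSg_inc, TensorProduct.smul_tmul']
      have h4 : ∀ (i : ℕ) (z : P i ⊗[k] P 0),
          TensorProduct.map ((totSg A P (-1)).restrictScalars k) ((totD d).restrictScalars k)
          (TensorProduct.map ((inc A P i).restrictScalars k)
            ((inc A P 0).restrictScalars k) z) = 0 := by
        intro i z
        induction z using TensorProduct.induction_on with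
        | zero => simp
        | add x y hx hy => simp only [map_add, hx, hy, add_zero]
        | tmul p q => simp [totD_zero]
      rw [totΔ_inc, map_sum, map_sum]
      cases n with
      | zero =>
        rw [totD_zero]
        simp [diagComponent_apply (show 0 + 0 = 0 from rfl), h2, h4]
      | succ n =>
        -- Split off the component with first index `0` from one sum and the one with second index
        -- `0` from the other: the differential of that factor vanishes. The remaining components
        -- pair up as in the chain map equation.
        rw [totD_succ, totΔ_inc, Finset.Nat.sum_antidiagonal_succ,
          Finset.Nat.sum_antidiagonal_succ' (f := fun p => TensorProduct.map _ _ _),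
          diagComponent_apply (zero_add _), diagComponent_apply (add_zero _), h2, h4, zero_add,
          zero_add, ← Finset.sum_add_distrib]
        refine Finset.sum_congr rfl fun p hp => ?_
        have h := Finset.HasAntidiagonal.mem_antidiagonal.mp hp
        rw [diagComponent_apply h, diagComponent_apply (by omega), diagComponent_apply (by omega),
          hΔ.comm, h1, h3, map_add, map_zsmul]
  aug x := by
    induction x using DirectSum.induction_on with
    | zero => simp
    | add x y hx hy => simp only [map_add, hx, hy]
    | of n x =>
      rw [← DirectSum.lof_eq_of A]
      have h1 : ∀ (i j : ℕ) (z : P i ⊗[k] P j), i + j ≠ 0 →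
          (TensorProduct.map (Triv.toField k A ∘ₗ (μ ∘ₗ cmp A P 0).restrictScalars k)
          (Triv.toField k A ∘ₗ (μ ∘ₗ cmp A P 0).restrictScalars k))
          (TensorProduct.map ((inc A P i).restrictScalars k)
            ((inc A P j).restrictScalars k) z) = 0 := by
        intro i j z hij
        induction z using TensorProduct.induction_on with
        | zero => simp
        | add x y hx hy => simp only [map_add, hx, hy, add_zero]
        | tmul p q =>
          rcases Nat.eq_zero_or_pos i with hi | hi
          · have hj : j ≠ 0 := by omega
            have h : (μ ∘ₗ cmp A P 0) (inc A P j q) = 0 := by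
              rw [LinearMap.comp_apply, cmp_inc_ne hj, map_zero]
            simp only [TensorProduct.map_tmul, LinearMap.comp_apply,
              LinearMap.restrictScalars_apply] at h ⊢
            rw [h, map_zero, TensorProduct.tmul_zero]
          · have h : (μ ∘ₗ cmp A P 0) (inc A P i p) = 0 := by
              rw [LinearMap.comp_apply, cmp_inc_ne (by omega), map_zero]
            simp only [TensorProduct.map_tmul, LinearMap.comp_apply,
              LinearMap.restrictScalars_apply] at h ⊢
            rw [h, map_zero, TensorProduct.zero_tmul]
      rw [totΔ_inc, map_sum, LinearMap.comp_apply]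
      cases n with
      | zero =>
        rw [cmp_inc, ← hΔ.augmentation]
        simp only [Finset.sum_singleton,
          Finset.Nat.antidiagonal_zero, diagComponent_apply (show 0 + 0 = 0 from rfl)]
        generalize Δ 0 0 0 rfl x = z
        induction z using TensorProduct.induction_on with
        | zero => simp
        | add x y hx hy => simp only [map_add, hx, hy]
        | tmul p q =>
          simp only [TensorProduct.map_tmul, LinearMap.comp_apply,
              LinearMap.restrictScalars_apply]
          rw [cmp_inc, cmp_inc]
      | succ n =>
        rw [cmp_inc_ne (by omega), map_zero, map_zero, Finset.sum_eq_zero, map_zero]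
        intro p hp
        have h := Finset.HasAntidiagonal.mem_antidiagonal.mp hp
        rw [diagComponent_apply h, h1 _ _ _ (by omega)]

end DirectSumComplex

/-! ### Contractions, cocycles and homotopy liftings carried over to the direct sum. -/

section TotalLiftings

open DirectSum

variable {k A : Type*} [Field k] [Ring A] [HopfAlgebra k A]
  {P : ℕ → Type*} [∀ n, AddCommGroup (P n)] [∀ n, Module k (P n)] [∀ n, Module A (P n)]
  [∀ n, IsScalarTower k A (P n)]
  {d : ∀ n, P (n + 1) →ₗ[A] P n} {μ : P 0 →ₗ[A] Triv k A}
  {Δ : ∀ i j n : ℕ, i + j = n → P n →ₗ[k] P i ⊗[k] P j}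

/-- Over a field the map onto the range splits, and the splitting extends linearly from the range to
the whole space. -/
theorem _root_.LinearMap.exists_section_of_exact {X Y : Type*} [AddCommGroup X] [Module k X]
    [AddCommGroup Y] [Module k Y] (T : X →ₗ[k] Y) :
    ∃ s : Y →ₗ[k] X, ∀ y, y ∈ Set.range T → T (s y) = y := by
  obtain ⟨g, hg⟩ := LinearMap.exists_rightInverse_of_surjective T.rangeRestrict
    T.range_rangeRestrict
  obtain ⟨s, hs⟩ := LinearMap.exists_extend g
  refine ⟨s, fun y hy => ?_⟩
  have h1 : s y = g ⟨y, hy⟩ := LinearMap.congr_fun hs ⟨y, hy⟩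
  have h2 := congrArg Subtype.val (LinearMap.congr_fun hg ⟨y, hy⟩)
  rw [h1]
  exact h2

/-- An exact complex of vector spaces is contractible. The homotopy is only `k`-linear, which is
enough for values of cochains. -/
theorem IsProjectiveResolution.exists_contraction (hP : IsProjectiveResolution d μ) :
    ∃ (H : ∀ n, P n →ₗ[k] P (n + 1)) (η : k →ₗ[k] P 0),
      (∀ r, Triv.toField k A (μ (η r)) = r) ∧
      (∀ x, d 0 (H 0 x) = x - η (Triv.toField k A (μ x))) ∧
      ∀ n x, d (n + 1) (H (n + 1) x) = x - H n (d n x) := by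
  choose s hs using fun n => LinearMap.exists_section_of_exact ((d n).restrictScalars k)
  obtain ⟨η, hη⟩ := LinearMap.exists_section_of_exact
    (Triv.toField k A ∘ₗ μ.restrictScalars k)
  have hη' : ∀ r, Triv.toField k A (μ (η r)) = r := fun r => hη r (hP.surjective r)
  -- Recursively, `H (n + 1)` applies a section of `d (n + 1)` to `x - H n (d n x)`, which is a
  -- cycle by the equation one degree lower.
  let H : ∀ n, P n →ₗ[k] P (n + 1) := fun n =>
    Nat.rec (motive := fun n => P n →ₗ[k] P (n + 1))
      (s 0 ∘ₗ (LinearMap.id - η ∘ₗ (Triv.toField k A ∘ₗ μ.restrictScalars k)))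
      (fun n h => s (n + 1) ∘ₗ (LinearMap.id - h ∘ₗ (d n).restrictScalars k)) n
  have h0 : ∀ x, d 0 (H 0 x) = x - η (Triv.toField k A (μ x)) := by
    intro x
    refine hs 0 _ ((hP.exact_zero _).mp ?_)
    have := hη' (Triv.toField k A (μ x))
    change μ (x - η (Triv.toField k A (μ x))) = 0
    rw [map_sub, sub_eq_zero]
    exact this.symm
  refine ⟨H, η, hη', h0, fun n => ?_⟩
  induction n with
  | zero =>
    intro x
    refine hs 1 _ ((hP.exact_succ 0 _).mp ?_)
    change d 0 (x - H 0 (d 0 x)) = 0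
    rw [map_sub, h0, (hP.exact_zero (d 0 x)).mpr ⟨x, rfl⟩]
    simp
  | succ n ih =>
    intro x
    refine hs (n + 2) _ ((hP.exact_succ (n + 1) _).mp ?_)
    change d (n + 1) (x - H (n + 1) (d (n + 1) x)) = 0
    rw [map_sub, ih, (hP.exact_succ n (d (n + 1) x)).mpr ⟨x, rfl⟩]
    simp

theorem nonempty_signedContraction (hP : IsProjectiveResolution d μ)
    (hμ : ∀ x, μ (d 0 x) = 0) (hΔ : IsDiagonalMap d μ Δ) :
    Nonempty (totalComplex d μ hμ hΔ).SignedContraction := by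
  obtain ⟨H, η, h1, h2, h3⟩ := hP.exists_contraction
  let Ht : Tot P →ₗ[k] Tot P :=
    DirectSum.toModule k ℕ _ fun n => (inc A P (n + 1)).restrictScalars k ∘ₗ H n
  have hH : ∀ n (x : P n), Ht (inc A P n x) = inc A P (n + 1) (H n x) := fun n x =>
    DirectSum.toModule_lof k n x
  have hμ0 : ∀ x : P 0, (totalComplex d μ hμ hΔ).aug' (inc A P 0 x) = Triv.toField k A (μ x) :=
    fun x => congrArg (fun y => Triv.toField k A (μ y)) (cmp_inc 0 x)
  have hμs : ∀ n (x : P (n + 1)), (totalComplex d μ hμ hΔ).aug' (inc A P (n + 1) x) = 0 := by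
    intro n x
    have := congrArg (fun y => Triv.toField k A (μ y))
      (cmp_inc_ne (A := A) (m := 0) (n := n + 1) (by omega) x)
    exact this.trans (by simp)
  refine ⟨⟨⟨Ht, (inc A P 0).restrictScalars k ∘ₗ η, fun x => ?_, fun x => ?_, fun r => ?_,
    fun r => ?_⟩, fun x => ?_, fun r => ?_⟩⟩
  · change totD d (Ht x) + Ht (totD d x) = _
    induction x using DirectSum.induction_on with
    | zero => simp
    | add x y hx hy =>
      simp only [map_add]
      rw [add_add_add_comm, hx, hy]; abel
    | of n x =>
      rw [← DirectSum.lof_eq_of A]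
      cases n with
      | zero =>
        rw [hH, totD_succ, h2, totD_zero, hμ0]
        simp
      | succ n =>
        rw [hH, totD_succ, h3, totD_succ, hμs, hH]
        simp
  · induction x using DirectSum.induction_on with
    | zero => simp
    | add x y hx hy => simp only [map_add, hx, hy, add_zero]
    | of n x => rw [← DirectSum.lof_eq_of A, hH, hμs]
  · exact (hμ0 _).trans (h1 r)
  · exact totD_zero d (η r)
  · change totSg A P (-1) (Ht x) = -Ht (totSg A P (-1) x)
    induction x using DirectSum.induction_on with
    | zero => simp
    | add x y hx hy => simp only [map_add, hx, hy]; abel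
    | of n x =>
      rw [← DirectSum.lof_eq_of A, hH, totSg_inc, totSg_inc, map_zsmul, hH, pow_succ]
      simp
  · exact (totSg_inc (-1) 0 (η r)).trans (by simp)

theorem isDegCocycle_cmp (hμ : ∀ x, μ (d 0 x) = 0) (hΔ : IsDiagonalMap d μ Δ) {m : ℕ}
    {f : P m →ₗ[A] Triv k A} (hf : f ∘ₗ d m = 0) :
    (totalComplex d μ hμ hΔ).IsDegCocycle m (f ∘ₗ cmp A P m) where
  D x := by
    change f (cmp A P m (totD d x)) = 0
    rw [cmp_totD]
    exact LinearMap.congr_fun hf _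
  sg t x := by
    change f (cmp A P m (totSg A P t x)) = t ^ m • f (cmp A P m x)
    rw [← map_zsmul]
    congr 1
    induction x using DirectSum.induction_on with
    | zero => simp
    | add x y hx hy => simp only [map_add, hx, hy, smul_add]
    | of n x =>
      rw [← DirectSum.lof_eq_of A, totSg_inc, map_zsmul]
      by_cases h : n = m
      · subst h; rfl
      · rw [cmp_inc_ne h, smul_zero, smul_zero]

/-- The endomorphism of the total module given by a morphism of degree `m - 1`. -/
def DegreeMap.tot {m : ℕ} (ψ : DegreeMap A P m) : Tot P →ₗ[A] Tot P :=
  DirectSum.toModule A ℕ _ fun i =>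
    -- The condition says that the target degree is not negative, so that the truncated subtraction
    -- is a genuine one.
    if h : m ≤ i + 1 then inc A P (i + 1 - m) ∘ₗ ψ i (i + 1 - m) (by omega) else 0

theorem DegreeMap.tot_inc {m : ℕ} (ψ : DegreeMap A P m) {i j : ℕ} (h : i + 1 = j + m) (x : P i) :
    ψ.tot (inc A P i x) = inc A P j (ψ i j h x) := by
  obtain rfl : j = i + 1 - m := by omega
  rw [DegreeMap.tot, DirectSum.toModule_lof, dif_pos (by omega)]
  rfl

theorem DegreeMap.tot_inc_of_lt {m : ℕ} (ψ : DegreeMap A P m) {i : ℕ} (h : i + 1 < m) (x : P i) :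
    ψ.tot (inc A P i x) = 0 := by
  rw [DegreeMap.tot, DirectSum.toModule_lof, dif_neg (by omega)]
  rfl

theorem DegreeMap.tot_totD {m : ℕ} (ψ : DegreeMap A P m) {i j : ℕ} (h : i = j + m) (x : P i) :
    ψ.tot (totD d (inc A P i x)) = inc A P j (ψ.compD d i j h x) := by
  cases i with
  | zero => rw [totD_zero]; simp [DegreeMap.compD]
  | succ i =>
    rw [totD_succ, ψ.tot_inc h]
    rfl

theorem evalLeft_diagComponent {m : ℕ} (f : P m →ₗ[A] Triv k A) {n i j : ℕ} (h : m + j = n)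
    (hi : i = m) (x : P n) :
    evalLeft (Tot P) (f ∘ₗ cmp A P m) (diagComponent (A := A) Δ n i j x) =
      inc A P j (evalLeft (P j) f (Δ m j n h x)) := by
  subst hi
  rw [diagComponent_apply h]
  generalize Δ i j n h x = z
  induction z using TensorProduct.induction_on with
  | zero => simp
  | add x y hx hy => simp only [map_add, hx, hy]
  | tmul p q =>
    have h : (f ∘ₗ cmp A P i) (inc A P i p) = f p := congrArg f (cmp_inc i p)
    simp only [TensorProduct.map_tmul, LinearMap.restrictScalars_apply, evalLeft_tmul]
    rw [h]; simp

theorem evalLeft_diagComponent_of_ne {m : ℕ} (f : P m →ₗ[A] Triv k A) {n i j : ℕ}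
    (hi : i ≠ m) (x : P n) :
    evalLeft (Tot P) (f ∘ₗ cmp A P m) (diagComponent (A := A) Δ n i j x) = 0 := by
  by_cases h : i + j = n
  · rw [diagComponent_apply h]
    generalize Δ i j n h x = z
    induction z using TensorProduct.induction_on with
    | zero => simp
    | add x y hx hy => simp only [map_add, hx, hy, add_zero]
    | tmul p q =>
      have h : (f ∘ₗ cmp A P m) (inc A P i p) = 0 := by
        rw [LinearMap.comp_apply, cmp_inc_ne hi, map_zero]
      simp only [TensorProduct.map_tmul, LinearMap.restrictScalars_apply, evalLeft_tmul]
      rw [h]; simp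
  · simp [diagComponent, h]

theorem evalRight_diagComponent {m : ℕ} (t : ℤ) (f : P m →ₗ[A] Triv k A) {n i j : ℕ}
    (h : j + m = n) (hi : i = m) (x : P n) :
    evalRight (Tot P) (f ∘ₗ cmp A P m) (((totSg A P t).restrictScalars k).rTensor (Tot P)
      (diagComponent (A := A) Δ n j i x)) =
      t ^ j • inc A P j (evalRight (P j) f (Δ j m n h x)) := by
  subst hi
  rw [diagComponent_apply h]
  generalize Δ j i n h x = z
  induction z using TensorProduct.induction_on with
  | zero => simp
  | add x y hx hy => simp only [map_add, hx, hy, smul_add]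
  | tmul p q =>
    have h : (f ∘ₗ cmp A P i) (inc A P i q) = f q := congrArg f (cmp_inc i q)
    simp only [TensorProduct.map_tmul, LinearMap.restrictScalars_apply, evalRight_tmul,
      LinearMap.rTensor_tmul, totSg_inc]
    rw [h, smul_comm]; simp

theorem evalRight_diagComponent_of_ne {m : ℕ} (t : ℤ) (f : P m →ₗ[A] Triv k A) {n i j : ℕ}
    (hi : i ≠ m) (x : P n) :
    evalRight (Tot P) (f ∘ₗ cmp A P m) (((totSg A P t).restrictScalars k).rTensor (Tot P)
      (diagComponent (A := A) Δ n j i x)) = 0 := by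
  by_cases h : j + i = n
  · rw [diagComponent_apply h]
    generalize Δ j i n h x = z
    induction z using TensorProduct.induction_on with
    | zero => simp
    | add x y hx hy => simp only [map_add, hx, hy, add_zero]
    | tmul p q =>
      have h : (f ∘ₗ cmp A P m) (inc A P i q) = 0 := by
        rw [LinearMap.comp_apply, cmp_inc_ne hi, map_zero]
      simp only [TensorProduct.map_tmul, LinearMap.restrictScalars_apply, evalRight_tmul,
        LinearMap.rTensor_tmul]
      rw [h]; simp
  · simp [diagComponent, h]

theorem BoundaryEq.tot {m : ℕ} {f : P m →ₗ[A] Triv k A} {ψ : DegreeMap A P m}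
    (h : BoundaryEq d Δ f ψ) (hμ : ∀ x, μ (d 0 x) = 0) (hΔ : IsDiagonalMap d μ Δ) :
    (totalComplex d μ hμ hΔ).TotalBoundaryEq ((-1) ^ m) (f ∘ₗ cmp A P m) ψ.tot := by
  intro x
  change totD d (ψ.tot x) + (-1 : ℤ) ^ m • ψ.tot (totD d x) =
    evalLeft (Tot P) (f ∘ₗ cmp A P m) (totΔ (A := A) Δ x) -
    evalRight (Tot P) (f ∘ₗ cmp A P m) (((totSg A P ((-1) ^ m)).restrictScalars k).rTensor (Tot P)
      (totΔ (A := A) Δ x))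
  induction x using DirectSum.induction_on with
  | zero => simp
  | add x y hx hy =>
    simp only [map_add, smul_add]
    rw [add_add_add_comm, hx, hy]; abel
  | of i x =>
    rw [← DirectSum.lof_eq_of A, totΔ_inc]
    simp only [map_sum]
    by_cases him : m ≤ i
    · obtain ⟨j, rfl⟩ : ∃ j, i = j + m := ⟨i - m, by omega⟩
      -- As `f` lives in degree `m`, the map `f ⊗ 1` sees only the component of the diagonal in `P m
      -- ⊗ P j`, and `1 ⊗ f` only the one in `P j ⊗ P m`.
      rw [Finset.sum_eq_single (m, j), Finset.sum_eq_single (j, m),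
        evalLeft_diagComponent f (by omega) rfl, evalRight_diagComponent _ f rfl rfl,
        ψ.tot_inc (show j + m + 1 = j + 1 + m by omega), totD_succ]
      · have h1 := congrArg (inc A P j) (h (j + m) j rfl x)
        rw [ψ.tot_totD rfl]
        simp only [map_sub, map_zsmul] at h1
        rw [← pow_mul, ← h1, pow_succ]
        simp
      · intro p hp hne
        refine evalRight_diagComponent_of_ne _ f (fun h => hne ?_) x
        have := Finset.HasAntidiagonal.mem_antidiagonal.mp hp
        ext <;> simp <;> omega
      · intro hne
        exact absurd (by rw [Finset.HasAntidiagonal.mem_antidiagonal]) hne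
      · intro p hp hne
        refine evalLeft_diagComponent_of_ne f (fun h => hne ?_) x
        have := Finset.HasAntidiagonal.mem_antidiagonal.mp hp
        ext <;> simp <;> omega
      · intro hne
        exact absurd (by rw [Finset.HasAntidiagonal.mem_antidiagonal, add_comm]) hne
    · rw [Finset.sum_eq_zero, Finset.sum_eq_zero]
      · have h1 : totD d (ψ.tot (inc A P i x)) = 0 := by
          -- The borderline case is `i + 1 = m`: there `ψ` has a component, but it lands in `P 0`,
          -- where the differential is zero.
          by_cases h1 : i + 1 < m
          · rw [ψ.tot_inc_of_lt h1, map_zero]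
          · rw [ψ.tot_inc (show i + 1 = 0 + m by omega), totD_zero]
        have h2 : ψ.tot (totD d (inc A P i x)) = 0 := by
          cases i with
          | zero => rw [totD_zero, map_zero]
          | succ i => rw [totD_succ, ψ.tot_inc_of_lt (by omega)]
        rw [h1, h2]; simp
      · intro p hp
        have := Finset.HasAntidiagonal.mem_antidiagonal.mp hp
        exact evalRight_diagComponent_of_ne _ f (by omega) x
      · intro p hp
        have := Finset.HasAntidiagonal.mem_antidiagonal.mp hp
        exact evalLeft_diagComponent_of_ne f (by omega) x

/-- Evaluating a morphism of degree `m - 1` of the total module in degree `n`. -/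
theorem DegreeMap.cmp_tot {m n r : ℕ} (ψ : DegreeMap A P m) (h : r + 1 = n + m)
    (f : P n →ₗ[A] Triv k A) : (f ∘ₗ cmp A P n) ∘ₗ ψ.tot = (f ∘ₗ ψ r n h) ∘ₗ cmp A P r := by
  refine LinearMap.ext fun x => ?_
  simp only [LinearMap.comp_apply]
  induction x using DirectSum.induction_on with
  | zero => simp
  | add x y hx hy => simp only [map_add, hx, hy]
  | of i x =>
    rw [← DirectSum.lof_eq_of A]
    by_cases hi : i = r
    · subst hi
      rw [ψ.tot_inc h, cmp_inc, cmp_inc]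
    · rw [cmp_inc_ne hi, map_zero, map_zero]
      by_cases him : i + 1 < m
      · rw [ψ.tot_inc_of_lt him]; simp
      · rw [ψ.tot_inc (show i + 1 = (i + 1 - m) + m by omega), cmp_inc_ne (by omega), map_zero]

/-- Here `m = n = 0`: the map raises indices by one, so its image misses `P 0`. -/
theorem DegreeMap.cmp_tot_eq_zero {m n : ℕ} (ψ : DegreeMap A P m) (h : n + m = 0)
    (f : P n →ₗ[A] Triv k A) : (f ∘ₗ cmp A P n) ∘ₗ ψ.tot = 0 := by
  refine LinearMap.ext fun x => ?_
  simp only [LinearMap.comp_apply]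
  induction x using DirectSum.induction_on with
  | zero => simp
  | add x y hx hy => simp only [map_add, hx, hy]
  | of i x =>
    rw [← DirectSum.lof_eq_of A, ψ.tot_inc (show i + 1 = (i + 1 - m) + m by omega),
      cmp_inc_ne (by omega)]
    simp

theorem IsHomotopyLifting.tot {m : ℕ} {f : P m →ₗ[A] Triv k A} {ψ : DegreeMap A P m}
    (h : IsHomotopyLifting d μ Δ f ψ) (hμ : ∀ x, μ (d 0 x) = 0) (hΔ : IsDiagonalMap d μ Δ) :
    (totalComplex d μ hμ hΔ).IsTotalLifting m (f ∘ₗ cmp A P m) ψ.tot := by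
  obtain ⟨h1, φ, hφ, hw⟩ := h
  refine ⟨h1.tot hμ hΔ, φ.tot, by have := hφ.tot hμ hΔ; rwa [pow_zero] at this,
    LinearMap.congr_fun (φ.cmp_tot_eq_zero rfl μ), ?_⟩
  change ∃ w : Tot P →ₗ[A] Triv k A, ∀ x, ((μ ∘ₗ cmp A P 0) ∘ₗ ψ.tot) x +
    (-1 : ℤ) ^ m • ((f ∘ₗ cmp A P m) ∘ₗ φ.tot) x = w (totD d x)
  cases m with
  | zero =>
    -- In degree `m = 0` the augmentation condition is empty: both composites with `P 0` vanish for
    -- degree reasons.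
    refine ⟨0, fun x => ?_⟩
    rw [ψ.cmp_tot_eq_zero rfl, φ.cmp_tot_eq_zero rfl]
    simp
  | succ i =>
    have h2 := hw i rfl
    rw [ψ.cmp_tot (show i + 1 = 0 + (i + 1) by omega), φ.cmp_tot (show i + 1 = i + 1 + 0 from rfl)]
    have h3 : ∀ x, (μ ∘ₗ ψ i 0 (by omega)) x + (-1 : ℤ) ^ (i + 1) • (f ∘ₗ φ i (i + 1) rfl) x =
        (μ ∘ₗ ψ i 0 (by omega) - (-1 : ℤ) ^ (i + 1 + 1) • (f ∘ₗ φ i (i + 1) rfl)) x := by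
      intro x
      rw [LinearMap.sub_apply, LinearMap.smul_apply, pow_succ _ (i + 1)]
      simp
    cases i with
    | zero =>
      -- For `m = 1` the condition lives in degree `0`, where being cohomologous means being equal.
      refine ⟨0, fun x => ?_⟩
      have h4 := h3 (cmp A P 0 x)
      rw [sub_eq_zero.mpr h2] at h4
      exact h4
    | succ i =>
      obtain ⟨w, hw⟩ := h2
      refine ⟨w ∘ₗ cmp A P i, fun x => ?_⟩
      have h4 := h3 (cmp A P (i + 1) x)
      rw [hw] at h4
      exact h4.trans (congrArg w (cmp_totD d i x).symm)

end TotalLiftings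

/-! ### The bracket of two liftings is a cocycle. -/

section Cocycle

variable {k A U : Type*} [Field k] [Ring A] [HopfAlgebra k A] [AddCommGroup U]
    [Module k U] [Module A U] [IsScalarTower k A U]

/-- Applying `f` to the boundary equation of `ψg` kills the term with the outer differential and
leaves `f ψg D`; likewise with `g` and `ψf`. The right-hand sides agree up to sign by the
antisymmetry of the two evaluations. -/
theorem TotalComplex.bracket_comp_D {X : TotalComplex k A U} {m n : ℕ} {f g : U →ₗ[A] Triv k A}
    (hf : X.IsDegCocycle m f) (hg : X.IsDegCocycle n g) {ψf ψg : U →ₗ[A] U}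
    (hψf : X.TotalBoundaryEq ((-1) ^ m) f ψf) (hψg : X.TotalBoundaryEq ((-1) ^ n) g ψg) (x : U) :
    (f ∘ₗ ψg - (-1 : ℤ) ^ ((m + 1) * (n + 1)) • (g ∘ₗ ψf)) (X.D x) = 0 := by
  have h1 := congrArg f (hψg x)
  have h2 := congrArg g (hψf x)
  simp only [map_add, map_zsmul, hf.D, hg.D, zero_add] at h1 h2
  have key : ∀ z : U ⊗[k] U,
      f (evalLeft U g z - evalRight U g (((X.sg ((-1) ^ n)).restrictScalars k).rTensor U z)) =
      -((-1 : ℤ) ^ (m * n) • g (evalLeft U f z -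
        evalRight U f (((X.sg ((-1) ^ m)).restrictScalars k).rTensor U z))) := by
    intro z
    induction z using TensorProduct.induction_on with
    | zero => simp
    | add x y hx hy =>
      simp only [map_add] at hx hy ⊢
      rw [add_sub_add_comm, map_add, hx, hy, add_sub_add_comm, map_add]
      module
    | tmul p q =>
      have hk : ∀ (h : U →ₗ[A] Triv k A) (r : k) (u : U), h (r • u) = r • h u :=
        fun h r u => (h.restrictScalars k).map_smul r u
      have hc : ∀ x y : Triv k A, Triv.toField k A x • y = Triv.toField k A y • x :=
        fun x y => mul_comm (G := k) x y
      simp only [evalLeft_tmul, evalRight_tmul, LinearMap.rTensor_tmul,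
        LinearMap.restrictScalars_apply, map_sub, hk, hf.sg, hg.sg]
      rw [← pow_mul, ← pow_mul, mul_comm n m, hc (g q), hc (f q)]
      have h : (-1 : ℤ) ^ (m * n) * (-1 : ℤ) ^ (m * n) = 1 := by rw [← mul_pow]; simp
      simp only [smul_sub, map_zsmul, smul_assoc, smul_smul ((-1 : ℤ) ^ (m * n)) ((-1 : ℤ) ^ (m * n)), h,
        one_smul]
      abel
  rw [key] at h1
  rw [← h2] at h1
  have h3 : f (ψg (X.D x)) = (-1 : ℤ) ^ n • (-1 : ℤ) ^ n • f (ψg (X.D x)) := by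
    rw [smul_smul, ← mul_pow]; simp
  rw [LinearMap.sub_apply, LinearMap.smul_apply, LinearMap.comp_apply, LinearMap.comp_apply, h3,
    h1]
  rcases neg_one_pow_eq_or ℤ m with hm | hm <;> rcases neg_one_pow_eq_or ℤ n with hn | hn <;>
    simp [pow_mul, pow_succ, hm, hn]

end Cocycle

/-! ### The isomorphism between the induced module and `U ⊗ A`. -/

section Induction

variable {k A U V M N : Type*} [Field k] [Ring A] [HopfAlgebra k A]
  [AddCommGroup U] [Module k U] [Module A U] [IsScalarTower k A U]
  [AddCommGroup V] [Module k V] [Module A V] [IsScalarTower k A V]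
  [AddCommGroup M] [Module k M] [AddCommGroup N] [Module k N]

/-- The action of the enveloping algebra on a bimodule. -/
def Bimod.env (B : Bimod k A N) : Env k A →ₐ[k] Module.End k N :=
  Algebra.TensorProduct.lift B.L
    (AlgHom.ofLinearMap (B.R ∘ₗ (MulOpposite.opLinearEquiv k).symm.toLinearMap)
      (LinearMap.ext B.R_one) (fun a b => LinearMap.ext fun x => B.R_mul b.unop a.unop x))
    (fun a b => LinearMap.ext fun x => (B.comm a b.unop x).symm)

theorem Bimod.env_tmul (B : Bimod k A N) (a b : A) (x : N) :
    B.env (Env.tmul k A a b) x = B.L a (B.R b x) := by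
  exact LinearMap.congr_fun (Algebra.TensorProduct.lift_tmul B.L
    (AlgHom.ofLinearMap (B.R ∘ₗ (MulOpposite.opLinearEquiv k).symm.toLinearMap)
      (LinearMap.ext B.R_one) (fun a b => LinearMap.ext fun x => B.R_mul b.unop a.unop x))
    (fun a b => LinearMap.ext fun x => (B.comm a b.unop x).symm) a (MulOpposite.op b)) x

theorem Env.induction {p : Env k A → Prop} (h0 : p 0) (ha : ∀ x y, p x → p y → p (x + y))
    (ht : ∀ a b, p (Env.tmul k A a b)) (x : Env k A) : p x :=
  TensorProduct.induction_on (R := k) (M := A) (N := Aᵐᵒᵖ) (motive := p) x h0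
    (fun a b => ht a b.unop) ha

theorem Env.tmul_mul (a b a' b' : A) :
    Env.tmul k A a b * Env.tmul k A a' b' = Env.tmul k A (a * a') (b' * b) :=
  Algebra.TensorProduct.tmul_mul_tmul (R := k) _ _ _ _

/-- `Env.tmul` as a bilinear map. -/
def Env.mk (k A : Type*) [Field k] [Ring A] [HopfAlgebra k A] : A →ₗ[k] A →ₗ[k] Env k A :=
  (TensorProduct.mk k A Aᵐᵒᵖ).compl₂ (MulOpposite.opLinearEquiv k).toLinearMap

theorem Env.mk_apply (a b : A) : Env.mk k A a b = Env.tmul k A a b := rfl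

/-- The map `x ⊗ y ↦ x ⊗ S(y)` from `A ⊗ A` to the enveloping algebra. -/
def deltaTensor (k A : Type*) [Field k] [Ring A] [HopfAlgebra k A] : A ⊗[k] A →ₗ[k] Env k A :=
  TensorProduct.lift ((Env.mk k A).compl₂ (HopfAlgebra.antipode k (A := A)))

theorem deltaTensor_tmul (a b : A) :
    deltaTensor k A (a ⊗ₜ b) = Env.tmul k A a (HopfAlgebra.antipode k b) := rfl

theorem delta_eq (a : A) : delta k A a = deltaTensor k A (Coalgebra.comul (R := k) a) := by
  have h : (Algebra.TensorProduct.map (AlgHom.id k A)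
      (HopfAlgebra.antipodeAlgHomOp k A)).toLinearMap = deltaTensor k A :=
    TensorProduct.ext' fun a b => rfl
  exact LinearMap.congr_fun h _

/-- In Sweedler notation, `δ(a) (u ⊗ 1) = ∑ a₁ u ⊗ a₂ S(a₃) = a u ⊗ 1`. This is what makes the map
out of the induced module well defined. -/
theorem env_delta (a : A) (u : U) :
    (TotalComplex.indBimod k A U).env (delta k A a) (u ⊗ₜ 1) = (a • u) ⊗ₜ 1 := by
  -- multiply out the coproducts
  let G : A ⊗[k] (A ⊗[k] A) →ₗ[k] U ⊗[k] A :=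
    TensorProduct.map ((Algebra.lsmul k k U).toLinearMap.flip u)
      (LinearMap.mul' k A ∘ₗ (HopfAlgebra.antipode k (A := A)).lTensor A)
  have h1 : ∀ t : A ⊗[k] A, (TotalComplex.indBimod k A U).env (deltaTensor k A t) (u ⊗ₜ 1) =
      G (TensorProduct.assoc k A A A ((Coalgebra.comul (R := k) (A := A)).rTensor A t)) := by
    intro t
    induction t using TensorProduct.induction_on with
    | zero => simp
    | add x y hx hy => simp only [map_add, LinearMap.add_apply, hx, hy]
    | tmul x y =>
      refine ((TotalComplex.indBimod k A U).env_tmul x (HopfAlgebra.antipode k y) _).trans ?_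
      rw [Bimod.twist_L, LinearMap.rTensor_tmul]
      have h3 : (TotalComplex.indBimod k A U).R (HopfAlgebra.antipode k y) (u ⊗ₜ[k] (1 : A)) =
          u ⊗ₜ HopfAlgebra.antipode k y := by
        simp [Bimod.twist_R, Bimod.reg]
      rw [h3]
      generalize (Coalgebra.comul (R := k) x : A ⊗[k] A) = s
      induction s using TensorProduct.induction_on with
      | zero => simp
      | add x y hx hy => simp only [map_add, LinearMap.add_apply, TensorProduct.add_tmul, hx, hy]
      | tmul c d => simp [Bimod.pairAct_tmul, Bimod.reg, G]
  rw [delta_eq, h1]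
  have h4 : ∀ t : A ⊗[k] A, G ((Coalgebra.comul (R := k) (A := A)).lTensor A t) =
      ((Algebra.lsmul k k U).toLinearMap.flip u).rTensor A
        ((Algebra.linearMap k A ∘ₗ Coalgebra.counit).lTensor A t) := by
    intro t
    induction t using TensorProduct.induction_on with
    | zero => simp
    | add x y hx hy => simp only [map_add, hx, hy]
    | tmul x y =>
      simp only [LinearMap.lTensor_tmul, G, TensorProduct.map_tmul, LinearMap.comp_apply,
        HopfAlgebra.mul_antipode_lTensor_comul_apply, LinearMap.rTensor_tmul]
      rfl
  rw [Coalgebra.coassoc_apply, h4, LinearMap.lTensor_comp_apply, Coalgebra.lTensor_counit_comul]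
  simp

variable (k A U) in
/-- The map `A^e ⊗ U → U ⊗ A`, `x ⊗ u ↦ x (u ⊗ 1)`. -/
def envTensor : Env k A ⊗[k] U →ₗ[k] U ⊗[k] A :=
  TensorProduct.lift ((TotalComplex.indBimod k A U).env.toLinearMap.compl₂
    ((TensorProduct.mk k U A).flip 1) : Env k A →ₗ[k] U →ₗ[k] U ⊗[k] A)

theorem envTensor_tmul (x : Env k A) (u : U) :
    envTensor k A U (x ⊗ₜ u) = (TotalComplex.indBimod k A U).env x (u ⊗ₜ 1) := rfl

theorem envTensor_smul (x : Env k A) (z : Env k A ⊗[k] U) :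
    envTensor k A U (x • z) = (TotalComplex.indBimod k A U).env x (envTensor k A U z) := by
  induction z using TensorProduct.induction_on with
  | zero => simp
  | add y z hy hz => simp only [smul_add, map_add, hy, hz]
  | tmul y u => rw [TensorProduct.smul_tmul', envTensor_tmul, envTensor_tmul, smul_eq_mul, map_mul]; rfl

theorem envTensor_eq_zero {z : Env k A ⊗[k] U} (hz : z ∈ indRelations k A U) :
    envTensor k A U z = 0 := by
  induction hz using Submodule.span_induction with
  | zero => simp
  | add y z _ _ hy hz => rw [map_add, hy, hz, add_zero]
  | smul x z _ hz => rw [envTensor_smul, hz, map_zero]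
  | mem z hz =>
    obtain ⟨x, a, u, rfl⟩ := hz
    rw [map_sub, envTensor_tmul, envTensor_tmul, map_mul, Module.End.mul_apply, env_delta, sub_self]

variable (k A U) in
/-- The isomorphism `A^e ⊗_A U ≅ U ⊗ A`. -/
def indTo : Ind k A U →ₗ[k] U ⊗[k] A :=
  ((indRelations k A U).restrictScalars k).liftQ (envTensor k A U)
    (fun _ hz => envTensor_eq_zero hz) ∘ₗ
    (Submodule.Quotient.restrictScalarsEquiv k (indRelations k A U)).symm.toLinearMap

theorem indTo_mk (z : Env k A ⊗[k] U) :
    indTo k A U (Submodule.Quotient.mk z) = envTensor k A U z := rfl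

theorem indTo_smul (x : Env k A) (z : Ind k A U) :
    indTo k A U (x • z) = (TotalComplex.indBimod k A U).env x (indTo k A U z) := by
  obtain ⟨z, rfl⟩ := Submodule.Quotient.mk_surjective _ z
  rw [← Submodule.Quotient.mk_smul, indTo_mk, indTo_mk, envTensor_smul]

theorem indTo_smul_left (a : A) (z : Ind k A U) : indTo k A U (Env.tmul k A a 1 • z) =
    (TotalComplex.indBimod k A U).L a (indTo k A U z) := by
  rw [indTo_smul, Bimod.env_tmul, Bimod.R_one]

theorem indTo_smul_right (b : A) (z : Ind k A U) : indTo k A U (Env.tmul k A 1 b • z) =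
    (TotalComplex.indBimod k A U).R b (indTo k A U z) := by
  rw [indTo_smul, Bimod.env_tmul, map_one]; rfl

theorem ind_ext {N : Type*} [AddCommGroup N] [Module k N] {S T : Ind k A U →+ N}
    (h : ∀ a b u, S (Submodule.Quotient.mk (Env.tmul k A a b ⊗ₜ u)) =
      T (Submodule.Quotient.mk (Env.tmul k A a b ⊗ₜ u))) (z : Ind k A U) : S z = T z := by
  obtain ⟨z, rfl⟩ := Submodule.Quotient.mk_surjective _ z
  induction z using TensorProduct.induction_on with
  | zero => rw [Submodule.Quotient.mk_zero, map_zero, map_zero]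
  | add y z hy hz => rw [Submodule.Quotient.mk_add, map_add, map_add, hy, hz]
  | tmul x u =>
    induction x using Env.induction with
    | h0 => rw [TensorProduct.zero_tmul, Submodule.Quotient.mk_zero, map_zero, map_zero]
    | ha y z hy hz => rw [TensorProduct.add_tmul, Submodule.Quotient.mk_add, map_add, map_add, hy, hz]
    | ht a b => exact h a b u

theorem indTo_map (φ : U →ₗ[A] V) (z : Ind k A U) :
    indTo k A V (Ind.map k A φ z) = (φ.restrictScalars k).rTensor A (indTo k A U z) := by
  refine ind_ext (S := (indTo k A V).toAddMonoidHom.comp (Ind.map k A φ).toAddMonoidHom)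
    (T := (((φ.restrictScalars k).rTensor A) ∘ₗ indTo k A U).toAddMonoidHom) (fun a b u => ?_) z
  change envTensor k A V (Env.tmul k A a b ⊗ₜ φ u) =
    (φ.restrictScalars k).rTensor A (envTensor k A U (Env.tmul k A a b ⊗ₜ u))
  rw [envTensor_tmul, envTensor_tmul, Bimod.env_tmul, Bimod.env_tmul,
    (Bimod.IsHom.rTensor _ φ).L, (Bimod.IsHom.rTensor _ φ).R, LinearMap.rTensor_tmul]
  rfl

/-- Through the isomorphism with `U ⊗ A`, the map induced by `f` becomes `f ⊗ 1`; every Hochschild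
cochain of a cocycle is computed in this form. -/
theorem indTrivToAlg_eq (f : U →ₗ[A] Triv k A) (z : Ind k A U) :
    indTrivToAlg k A (Ind.map k A f z) = evalLeft A f (indTo k A U z) := by
  refine ind_ext (S := (indTrivToAlg k A).toAddMonoidHom.comp (Ind.map k A f).toAddMonoidHom)
    (T := ((evalLeft A f) ∘ₗ indTo k A U).toAddMonoidHom) (fun a b u => ?_) z
  change indTrivToAlg k A (Submodule.Quotient.mk (Env.tmul k A a b ⊗ₜ f u)) =
    evalLeft A f (envTensor k A U (Env.tmul k A a b ⊗ₜ u))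
  rw [envTensor_tmul, Bimod.env_tmul, indTrivToAlg_mk,
    (isHom_evalLeft _ f).L, (isHom_evalLeft _ f).R, evalLeft_tmul]
  simp [Bimod.reg]

variable (k A U) in
/-- The inverse of `indTo`. -/
def indInv : U ⊗[k] A →ₗ[k] Ind k A U :=
  TensorProduct.lift (LinearMap.mk₂ k
    (fun u b => Submodule.Quotient.mk (Env.tmul k A 1 b ⊗ₜ[k] u))
    (fun u v b => by rw [TensorProduct.tmul_add]; rfl)
    (fun r u b => by rw [TensorProduct.tmul_smul]; rfl)
    (fun u b c => by
      rw [← Env.mk_apply, map_add, TensorProduct.add_tmul]; rfl)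
    (fun r u b => by
      rw [← Env.mk_apply, map_smul, TensorProduct.smul_tmul, TensorProduct.tmul_smul]; rfl))

theorem indInv_tmul (u : U) (b : A) :
    indInv k A U (u ⊗ₜ b) = Submodule.Quotient.mk (Env.tmul k A 1 b ⊗ₜ[k] u) := rfl

theorem indTo_indInv (z : U ⊗[k] A) : indTo k A U (indInv k A U z) = z := by
  induction z using TensorProduct.induction_on with
  | zero => simp
  | add y z hy hz => simp only [map_add, hy, hz]
  | tmul u b =>
    rw [indInv_tmul, indTo_mk, envTensor_tmul, Bimod.env_tmul, map_one]
    simp [TotalComplex.indBimod, Bimod.twist_R, Bimod.reg]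

theorem mk_tmul_smul (x : Env k A) (a : A) (u : U) :
    (Submodule.Quotient.mk (x ⊗ₜ[k] (a • u)) : Ind k A U) =
      Submodule.Quotient.mk ((x * delta k A a) ⊗ₜ[k] u) := by
  have h : (x * delta k A a) ⊗ₜ[k] u - x ⊗ₜ[k] (a • u) ∈ indRelations k A U :=
    Submodule.subset_span ⟨x, a, u, rfl⟩
  exact ((Submodule.Quotient.eq _).2 h).symm

/-- Moving `a₁` across the tensor product by `δ` gives `∑ (1 ⊗ a₂ b) ⊗ a₁ u = ∑ (a₁ ⊗ S(a₂) a₃ b) ⊗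
u`, and the other antipode axiom collapses this to `(a ⊗ b) ⊗ u`. -/
theorem indInv_env (a b : A) (u : U) :
    indInv k A U ((TotalComplex.indBimod k A U).env (Env.tmul k A a b) (u ⊗ₜ 1)) =
      Submodule.Quotient.mk (Env.tmul k A a b ⊗ₜ u) := by
  let q : Env k A →ₗ[k] Ind k A U :=
    (((indRelations k A U).mkQ.restrictScalars k) ∘ₗ (TensorProduct.mk k (Env k A) U).flip u)
  let G : A ⊗[k] (A ⊗[k] A) →ₗ[k] Ind k A U :=
    q ∘ₗ TensorProduct.lift (Env.mk k A) ∘ₗ (LinearMap.mulRight k b ∘ₗ LinearMap.mul' k A ∘ₗ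
      (HopfAlgebra.antipode k (A := A)).rTensor A).lTensor A
  have h1 : ∀ t : A ⊗[k] A, indInv k A U ((Bimod.reg k A).pairAct U t (u ⊗ₜ b)) =
      G (TensorProduct.assoc k A A A ((Coalgebra.comul (R := k) (A := A)).rTensor A t)) := by
    intro t
    induction t using TensorProduct.induction_on with
    | zero => simp
    | add x y hx hy => simp only [map_add, LinearMap.add_apply, hx, hy]
    | tmul x y =>
      rw [Bimod.pairAct_tmul, indInv_tmul, mk_tmul_smul, delta_eq, LinearMap.rTensor_tmul]
      have h3 : ∀ s : A ⊗[k] A, q (Env.tmul k A 1 (y * b) * deltaTensor k A s) =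
          G (TensorProduct.assoc k A A A (s ⊗ₜ y)) := by
        intro s
        induction s using TensorProduct.induction_on with
        | zero => simp
        | add c d hc hd => simp only [map_add, mul_add, TensorProduct.add_tmul, hc, hd]
        | tmul c d =>
          rw [deltaTensor_tmul, Env.tmul_mul]
          simp [G, Env.mk_apply, mul_assoc]
      exact h3 _
  have h2 : (TotalComplex.indBimod k A U).env (Env.tmul k A a b) (u ⊗ₜ 1) =
      (Bimod.reg k A).pairAct U (Coalgebra.comul (R := k) a) (u ⊗ₜ b) := by
    rw [Bimod.env_tmul, TotalComplex.indBimod, Bimod.twist_L, Bimod.twist_R]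
    simp [Bimod.reg]
  rw [h2, h1, Coalgebra.coassoc_apply]
  have h4 : ∀ t : A ⊗[k] A, G ((Coalgebra.comul (R := k) (A := A)).lTensor A t) =
      q (TensorProduct.lift (Env.mk k A) ((LinearMap.mulRight k b ∘ₗ
        Algebra.linearMap k A).lTensor A (Coalgebra.counit.lTensor A t))) := by
    intro t
    induction t using TensorProduct.induction_on with
    | zero => simp
    | add x y hx hy => simp only [map_add, hx, hy]
    | tmul x y =>
      simp only [LinearMap.lTensor_tmul, G, LinearMap.comp_apply,
        HopfAlgebra.mul_antipode_rTensor_comul_apply]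
      rfl
  rw [h4, Coalgebra.lTensor_counit_comul]
  simp [Env.mk_apply]
  rfl

theorem indInv_indTo (z : Ind k A U) : indInv k A U (indTo k A U z) = z := by
  refine ind_ext (S := (indInv k A U ∘ₗ indTo k A U).toAddMonoidHom)
    (T := AddMonoidHom.id _) (fun a b u => ?_) z
  exact indInv_env a b u

end Induction

/-! ### Passing between functions on lists and multilinear maps on `A ^ n`. -/

section Translation

variable {k A M N : Type*} [Field k] [Ring A] [HopfAlgebra k A]
  [AddCommGroup M] [Module k M] [AddCommGroup N] [Module k N]

/-- The function on lists, supported on lists of length `n`, given by a function on `A ^ n`. -/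
def ofFun {n : ℕ} (φ : (Fin n → A) → M) : List A → M :=
  fun l => if h : l.length = n then φ (fun i => l.get (i.cast h.symm)) else 0

theorem supp_ofFun {n : ℕ} (φ : (Fin n → A) → M) : Supp n (ofFun φ) :=
  fun _ hl => dif_neg hl

theorem ofFun_of_length {n : ℕ} (φ : (Fin n → A) → M) {l : List A} (h : l.length = n) :
    ofFun φ l = φ (fun i => l[(i : ℕ)]'(by omega)) := dif_pos h

theorem ofFun_ofFn {n : ℕ} (φ : (Fin n → A) → M) (a : Fin n → A) : ofFun φ (List.ofFn a) = φ a := by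
  rw [ofFun_of_length φ (List.length_ofFn)]
  simp

theorem exists_ofFn {n : ℕ} {l : List A} (h : l.length = n) : ∃ a : Fin n → A, l = List.ofFn a := by
  subst h
  exact ⟨l.get, (List.ofFn_get l).symm⟩

theorem multi_ofFun {n : ℕ} (φ : MultilinearMap k (fun _ : Fin n => A) M) :
    Multi k (ofFun φ : List A → M) := by
  have key : ∀ (x z : List A) (h : x.length < n) (h' : (x ++ 0 :: z).length = n) (a : A),
      ofFun φ (x ++ a :: z) =
        φ (Function.update (fun i : Fin n => (x ++ 0 :: z)[(i : ℕ)]'(by omega)) ⟨x.length, h⟩ a) := by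
    intro x z h h' a
    rw [ofFun_of_length φ (by simpa using h')]
    congr 1
    funext i
    by_cases hi : i = ⟨x.length, h⟩
    · subst hi; simp
    · have hi' : (i : ℕ) ≠ x.length := fun h => hi (Fin.ext h)
      rw [Function.update_of_ne hi]
      rcases lt_or_gt_of_ne hi' with h1 | h1
      · rw [List.getElem_append_left h1, List.getElem_append_left h1]
      · rw [List.getElem_append_right h1.le, List.getElem_append_right h1.le]
        obtain ⟨j, hj⟩ : ∃ j, (i : ℕ) - x.length = j + 1 := ⟨i - x.length - 1, by omega⟩
        simp [hj]
  constructor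
  · intro x a b z
    by_cases h' : (x ++ 0 :: z).length = n
    · have h : x.length < n := by simp at h'; omega
      rw [key x z h h', key x z h h', key x z h h', MultilinearMap.map_update_add]
    · have h2 : ∀ a : A, ofFun φ (x ++ a :: z) = 0 := fun a => supp_ofFun _ _ (by simpa using h')
      simp [h2]
  · intro x r a z
    by_cases h' : (x ++ 0 :: z).length = n
    · have h : x.length < n := by simp at h'; omega
      rw [key x z h h', key x z h h', MultilinearMap.map_update_smul]
    · have h2 : ∀ a : A, ofFun φ (x ++ a :: z) = 0 := fun a => supp_ofFun _ _ (by simpa using h')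
      simp [h2]

theorem ofFn_update {n : ℕ} (a : Fin n → A) (i : Fin n) (x : A) :
    List.ofFn (Function.update a i x) =
      (List.ofFn a).take i ++ x :: (List.ofFn a).drop (i + 1) := by
  have h : (List.ofFn a).set i x = (List.ofFn a).take i ++ x :: (List.ofFn a).drop (i + 1) := by
    rw [List.set_eq_take_append_cons_drop, if_pos (by simp)]
  rw [← h]
  refine List.ext_getElem (by simp) fun j h1 h2 => ?_
  rw [List.getElem_set, List.getElem_ofFn, List.getElem_ofFn, Function.update_apply]
  simp only [Fin.ext_iff, eq_comm]

/-- The restriction of a multilinear function on lists to `A ^ n`. -/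
def Multi.toMultilinearMap {c : List A → M} (hc : Multi k c) (n : ℕ) :
    MultilinearMap k (fun _ : Fin n => A) M where
  toFun a := c (List.ofFn a)
  map_update_add' {inst} a i x y := by
    rw [Subsingleton.elim inst (instDecidableEqFin n), ofFn_update, ofFn_update, ofFn_update, hc.add]
  map_update_smul' {inst} a i r x := by
    rw [Subsingleton.elim inst (instDecidableEqFin n), ofFn_update, ofFn_update, hc.smul]

theorem ofFn_contractNth_succ {n : ℕ} (a : Fin (n + 2) → A) (i : Fin n) :
    List.ofFn (i.succ.castSucc.contractNth (· * ·) a) =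
      a 0 :: List.ofFn (i.castSucc.contractNth (· * ·) (fun j => a j.succ)) := by
  rw [List.ofFn_succ]
  congr 1
  congr 1
  funext j
  simp [Fin.contractNth]

theorem Bimod.E_ofFn (B : Bimod k A M) : ∀ {n : ℕ} (c : List A → M) (a : Fin (n + 1) → A),
    B.E c (List.ofFn a) =
      ∑ i : Fin n, (-1 : ℤ) ^ (i : ℕ) • c (List.ofFn (i.castSucc.contractNth (· * ·) a))
        + (-1 : ℤ) ^ n • B.R (a (Fin.last n)) (c (List.ofFn fun i : Fin n => a i.castSucc))
  | 0, c, a => by simp [B.E_single]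
  | n + 1, c, a => by
    have h : List.ofFn a = a 0 :: a 1 :: List.ofFn (fun i : Fin n => a i.succ.succ) := by
      rw [List.ofFn_succ, List.ofFn_succ]; rfl
    have h' : a 1 :: List.ofFn (fun i : Fin n => a i.succ.succ) =
      List.ofFn (fun i : Fin (n + 1) => a i.succ) := by rw [List.ofFn_succ]; rfl
    rw [h, B.E_cons, h', B.E_ofFn, Fin.sum_univ_succ]
    have h0 : List.ofFn ((0 : Fin (n + 1)).castSucc.contractNth (· * ·) a) =
        a 0 * a 1 :: List.ofFn (fun i : Fin n => a i.succ.succ) := by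
      rw [List.ofFn_succ]
      simp [Fin.contractNth]
    have h1 : (List.ofFn fun i : Fin (n + 1) => a i.castSucc) =
        a 0 :: List.ofFn fun i : Fin n => a i.castSucc.succ := by
      rw [List.ofFn_succ]; rfl
    simp only [ofFn_contractNth_succ, h0, h1, Fin.val_succ, pow_succ, mul_neg, mul_one, neg_smul,
      Finset.sum_neg_distrib, Fin.succ_last, Fin.val_zero, pow_zero, one_smul]
    abel

theorem Bimod.δ_ofFn [Module (Env k A) N] (B : Bimod k A M) (T : N →+ M)
    (hL : ∀ a x, T (Env.tmul k A a 1 • x) = B.L a (T x))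
    (hR : ∀ a x, T (Env.tmul k A 1 a • x) = B.R a (T x)) {n : ℕ} {c : List A → M}
    {φ : (Fin n → A) → N} (h : ∀ a, c (List.ofFn a) = T (φ a)) (a : Fin (n + 1) → A) :
    B.δ c (List.ofFn a) = T (hochschildD k φ a) := by
  have h1 : B.δ c (List.ofFn a) = B.L (a 0) (c (List.ofFn fun i => a i.succ)) -
      B.E c (List.ofFn a) := by rw [List.ofFn_succ, B.δ_cons]
  rw [h1, B.E_ofFn, hochschildD, map_add, map_add, map_sum, hL, h]
  simp only [map_zsmul, map_neg, hR, h, pow_succ, mul_neg, mul_one, neg_smul, Finset.sum_neg_distrib]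
  abel

theorem δ_reg_ofFn {n : ℕ} {c : List A → A} {φ : (Fin n → A) → A}
    (h : ∀ a, c (List.ofFn a) = φ a) (a : Fin (n + 1) → A) :
    (Bimod.reg k A).δ c (List.ofFn a) = hochschildD k φ a :=
  (Bimod.reg k A).δ_ofFn (AddMonoidHom.id A)
    (fun a x => by simp [Env.tmul_smul, Bimod.reg]) (fun a x => by simp [Env.tmul_smul, Bimod.reg])
    h a

/-- Degree zero needs no separate clause on lists, because `δ` vanishes on the empty list. -/
theorem hochschildCohomologous_iff {n : ℕ} {c c' : List A → A} {Φ Φ' : (Fin n → A) → A}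
    (h : ∀ a, c (List.ofFn a) = Φ a) (h' : ∀ a, c' (List.ofFn a) = Φ' a) :
    HochschildCohomologous k n Φ Φ' ↔
      ∃ w, Multi k w ∧ ∀ l, l.length = n → c l = c' l + (Bimod.reg k A).δ w l := by
  cases n with
  | zero =>
    constructor
    · rintro rfl
      refine ⟨0, .zero, fun l hl => ?_⟩
      obtain ⟨a, rfl⟩ := exists_ofFn hl
      rw [h, h', Bimod.δ_zero]; simp
    · rintro ⟨w, -, hw⟩
      funext a
      rw [← h, ← h', hw _ (by simp)]
      simp [Bimod.δ_nil]
  | succ n =>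
    constructor
    · rintro ⟨w, hw⟩
      refine ⟨ofFun w, multi_ofFun w, fun l hl => ?_⟩
      obtain ⟨a, rfl⟩ := exists_ofFn hl
      rw [δ_reg_ofFn (ofFun_ofFn w), ← hw, h, h']
      abel
    · rintro ⟨w, hw, hw'⟩
      refine ⟨hw.toMultilinearMap n, fun a => ?_⟩
      rw [← h, ← h', hw' _ (by simp), δ_reg_ofFn (φ := hw.toMultilinearMap n) (fun a => rfl)]
      abel

/-- For homogeneous `Γ` only the prefix of length `n` contributes; every other prefix puts `0` into
an argument of `c`. -/
theorem insHead_eq {c : List A → M} (hc : Multi k c) : ∀ {n : ℕ} {Γ : List A → A}, Supp n Γ →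
    ∀ l, insHead Γ c l = c (Γ (l.take n) :: l.drop n)
  | n, Γ, hΓ, [] => by simp [insHead_nil]
  | 0, Γ, hΓ, a :: l => by
    have h : (fun l => Γ (a :: l)) = 0 := funext fun l => hΓ _ (by simp)
    rw [insHead_cons, h, insHead_zero_left hc]
    simp
  | n + 1, Γ, hΓ, a :: l => by
    have h : Supp n fun l => Γ (a :: l) := fun l hl => hΓ _ (by simpa using hl)
    rw [insHead_cons, insHead_eq hc h, hΓ [] (by simp), hc.zero_head]
    simp

theorem ins_eq (s : ℤ) {n : ℕ} {Γ : List A → A} (hΓ : Supp n Γ) :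
    ∀ {c : List A → M}, Multi k c → ∀ l, ins s c Γ l =
      ∑ i ∈ Finset.range (l.length + 1),
        s ^ i • c (l.take i ++ Γ ((l.drop i).take n) :: l.drop (i + n))
  | c, hc, [] => by simp [ins_nil]
  | c, hc, a :: l => by
    rw [ins_cons, insHead_eq hc hΓ, ins_eq s hΓ (hc.shift a), List.length_cons,
      Finset.sum_range_succ' _ (l.length + 1), add_comm, Finset.smul_sum]
    simp [pow_succ', mul_smul, add_right_comm]

theorem circ_eq {m n r : ℕ} (h : r + 1 = m + n) (Φ : MultilinearMap k (fun _ : Fin m => A) A)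
    (Γ : MultilinearMap k (fun _ : Fin n => A) A) (a : Fin r → A) :
    ins ((-1) ^ (n + 1)) (ofFun Φ) (ofFun Γ) (List.ofFn a) = circ h Φ Γ a := by
  rw [ins_eq _ (supp_ofFun _) (multi_ofFun Φ), List.length_ofFn, h, Finset.sum_range_add]
  -- For a starting position `m + i`, fewer than `n` entries are left, so the truncated segment lies
  -- outside the support of `Γ`.
  rw [Finset.sum_eq_zero (s := Finset.range n) fun i hi => by
    rw [supp_ofFun Γ _ (by have := Finset.mem_range.1 hi; simp; omega),
      (multi_ofFun Φ).zero_mid, smul_zero], add_zero]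
  rw [circ, Finset.sum_range]
  refine Finset.sum_congr rfl fun i _ => ?_
  rw [← pow_mul, mul_comm (n + 1), ofFun_of_length Φ (by simp; omega)]
  congr 2
  funext j
  rw [ofFun_of_length Γ (by simp; omega)]
  -- The argument with index `j` lies before the inserted value, is that value, or lies behind it
  -- with its position shifted by `n - 1`.
  split_ifs with h1 h3
  · rw [List.getElem_append_left (by simp; omega)]
    simp
  · subst h3
    have hj : (j : ℕ) ≤ r := by omega
    rw [List.getElem_append_right (by simp)]
    simp [hj]
  · have hi : (i : ℕ) ≤ r := by omega
    have hij : (i : ℕ) < j :=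
      lt_of_le_of_ne (not_lt.1 h1) fun h => h3 (Fin.ext h.symm)
    obtain ⟨t, ht⟩ : ∃ t, (j : ℕ) = i + t + 1 := ⟨j - i - 1, by omega⟩
    have ht' : (j : ℕ) - i = t + 1 := by omega
    rw [List.getElem_append_right (by simp; omega)]
    simp only [List.length_take, List.length_ofFn, min_eq_left hi, ht', List.getElem_cons_succ,
      List.getElem_drop, List.getElem_ofFn]
    congr 1
    ext
    simp only
    omega

theorem gerstenhaberBracket_eq {m n r : ℕ} (h : r + 1 = m + n)
    (Φ : MultilinearMap k (fun _ : Fin m => A) A) (Γ : MultilinearMap k (fun _ : Fin n => A) A)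
    (a : Fin r → A) :
    listBracket m n (ofFun Φ) (ofFun Γ) (List.ofFn a) = gerstenhaberBracket h Φ Γ a := by
  rw [gerstenhaberBracket, ← circ_eq, ← circ_eq]
  rfl

end Translation

/-! ### Comparison maps in components and in total form. -/

section Comparison

variable {k A : Type*} [Field k] [Ring A] [HopfAlgebra k A]
  {P : ℕ → Type*} [∀ n, AddCommGroup (P n)] [∀ n, Module k (P n)] [∀ n, Module A (P n)]
  [∀ n, IsScalarTower k A (P n)]
  {d : ∀ n, P (n + 1) →ₗ[A] P n} {μ : P 0 →ₗ[A] Triv k A}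
  {Δ : ∀ i j n : ℕ, i + j = n → P n →ₗ[k] P i ⊗[k] P j}
  {θ : ∀ n, MultilinearMap k (fun _ : Fin n => A) (Ind k A (P n))}

theorem Multi.of_length {M : Type*} [AddCommGroup M] [Module k M] {c : List A → M}
    (h : ∀ n : ℕ, ∃ e : List A → M, Multi k e ∧ ∀ l, l.length = n → c l = e l) : Multi k c where
  add x a b z := by
    obtain ⟨e, he, h⟩ := h (x.length + (z.length + 1))
    rw [h _ (by simp), h _ (by simp), h _ (by simp), he.add]
  smul x r a z := by
    obtain ⟨e, he, h⟩ := h (x.length + (z.length + 1))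
    rw [h _ (by simp), h _ (by simp), he.smul]

variable (k A P) in
/-- The inclusion `P n ⊗ A → P ⊗ A`. -/
def incInd (n : ℕ) : P n ⊗[k] A →ₗ[k] Tot P ⊗[k] A := ((inc A P n).restrictScalars k).rTensor A

variable (k A P) in
/-- The projection `P ⊗ A → P n ⊗ A`. -/
def cmpInd (n : ℕ) : Tot P ⊗[k] A →ₗ[k] P n ⊗[k] A := ((cmp A P n).restrictScalars k).rTensor A

theorem rTensor_comp_apply' {U V W N : Type*} [AddCommGroup U] [Module k U] [Module A U]
    [IsScalarTower k A U] [AddCommGroup V] [Module k V] [Module A V] [IsScalarTower k A V]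
    [AddCommGroup W] [Module k W] [Module A W] [IsScalarTower k A W] [AddCommGroup N] [Module k N]
    (φ : V →ₗ[A] W) (χ : U →ₗ[A] V) (x : U ⊗[k] N) :
    (φ.restrictScalars k).rTensor N ((χ.restrictScalars k).rTensor N x) =
      ((φ ∘ₗ χ).restrictScalars k).rTensor N x := by
  rw [← LinearMap.rTensor_comp_apply]; rfl

theorem isHom_cmpInd (n : ℕ) : (TotalComplex.indBimod k A (Tot P)).IsHom
    (TotalComplex.indBimod k A (P n)) (cmpInd k A P n) := .rTensor _ _

theorem isHom_incInd (n : ℕ) : (TotalComplex.indBimod k A (P n)).IsHom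
    (TotalComplex.indBimod k A (Tot P)) (incInd k A P n) := .rTensor _ _

/-- The total cochain of a comparison map. -/
def totComparison (θ : ∀ n, MultilinearMap k (fun _ : Fin n => A) (Ind k A (P n))) :
    List A → Tot P ⊗[k] A :=
  fun l => incInd k A P l.length (indTo k A (P l.length) (θ l.length l.get))

theorem totComparison_of_length {n : ℕ} {l : List A} (h : l.length = n) :
    totComparison θ l = incInd k A P n (indTo k A (P n) (ofFun (θ n) l)) := by
  subst h
  rw [ofFun_of_length _ rfl]; rfl

theorem totComparison_ofFn {n : ℕ} (a : Fin n → A) :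
    totComparison θ (List.ofFn a) = incInd k A P n (indTo k A (P n) (θ n a)) := by
  rw [totComparison_of_length (List.length_ofFn), ofFun_ofFn]

theorem evalLeft_totComparison {n : ℕ} (f : P n →ₗ[A] Triv k A) (a : Fin n → A) :
    evalLeft A (f ∘ₗ cmp A P n) (totComparison θ (List.ofFn a)) =
      indTrivToAlg k A (Ind.map k A f (θ n a)) := by
  rw [totComparison_ofFn, incInd, TotalComplex.evalLeft_rTensor, indTrivToAlg_eq]
  congr 2
  ext x
  exact congrArg f (cmp_inc n x)

theorem IsComparison.total (hθ : IsComparison d μ θ) (hμ : ∀ x, μ (d 0 x) = 0)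
    (hΔ : IsDiagonalMap d μ Δ) :
    (totalComplex d μ hμ hΔ).IsTotalComparison (totComparison θ) where
  multi := .of_length fun n => ⟨_, ((multi_ofFun (θ n)).comp (indTo k A (P n))).comp
    (incInd k A P n), fun l hl => totComparison_of_length hl⟩
  D := by
    funext l
    rw [TotalComplex.tot_zero]
    change ((totD d).restrictScalars k).rTensor A _ = _
    obtain ⟨n, hn⟩ : ∃ n, l.length = n := ⟨_, rfl⟩
    obtain ⟨a, rfl⟩ := exists_ofFn hn
    cases n with
    | zero =>
      rw [totComparison_ofFn, incInd, rTensor_comp_apply',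
        show totD d ∘ₗ inc A P 0 = 0 from LinearMap.ext (totD_zero d), List.ofFn_zero,
        Bimod.δ_nil]
      simp
    | succ n =>
      rw [totComparison_ofFn, incInd, rTensor_comp_apply',
        show totD d ∘ₗ inc A P (n + 1) = inc A P n ∘ₗ d n from LinearMap.ext (totD_succ d n),
        ← rTensor_comp_apply', ← indTo_map, hθ.comm,
        (TotalComplex.indBimod k A (Tot P)).δ_ofFn
          (incInd k A P n ∘ₗ indTo k A (P n)).toAddMonoidHom
          (fun a x => ?_) (fun a x => ?_) (fun a => totComparison_ofFn a)]
      · rfl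
      · change incInd k A P n (indTo k A (P n) _) = _
        rw [indTo_smul_left, (isHom_incInd n).L]; rfl
      · change incInd k A P n (indTo k A (P n) _) = _
        rw [indTo_smul_right, (isHom_incInd n).R]; rfl
  aug l := by
    change evalLeft A (μ ∘ₗ cmp A P 0) _ = _
    obtain ⟨n, hn⟩ : ∃ n, l.length = n := ⟨_, rfl⟩
    cases n with
    | zero =>
      obtain rfl := List.length_eq_zero_iff.1 hn
      have := evalLeft_totComparison (θ := θ) μ ![]
      rw [List.ofFn_zero] at this
      rw [this, hθ.augmentation]; rfl
    | succ n =>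
      rw [totComparison_of_length hn, incInd, TotalComplex.evalLeft_rTensor,
        show (μ ∘ₗ cmp A P 0) ∘ₗ inc A P (n + 1) = 0 from LinearMap.ext fun x => by
          simp [cmp_inc_ne (A := A) (P := P) (Nat.succ_ne_zero n)]]
      rw [supp_unitCochain l (by omega)]
      simp [evalLeft]
  sg t := by
    funext l
    change ((totSg A P t).restrictScalars k).rTensor A _ = t ^ l.length • _
    rw [totComparison, incInd, rTensor_comp_apply',
      show totSg A P t ∘ₗ inc A P l.length = t ^ l.length • inc A P l.length from
        LinearMap.ext (totSg_inc t _)]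
    generalize indTo k A (P l.length) _ = z
    induction z using TensorProduct.induction_on with
    | zero => simp
    | add x y hx hy => simp only [map_add, hx, hy, smul_add]
    | tmul u y => simp [TensorProduct.smul_tmul']

theorem indTo_injective {U : Type*} [AddCommGroup U] [Module k U] [Module A U] [IsScalarTower k A U] :
    Function.Injective (indTo k A U) :=
  Function.LeftInverse.injective (g := indInv k A U) indInv_indTo

/-- The components of a total cochain. -/
def ofTotal {Θ : List A → Tot P ⊗[k] A} (hΘ : Multi k Θ) (n : ℕ) :
    MultilinearMap k (fun _ : Fin n => A) (Ind k A (P n)) :=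
  ((hΘ.comp (cmpInd k A P n)).comp (indInv k A (P n))).toMultilinearMap n

theorem indTo_ofTotal {Θ : List A → Tot P ⊗[k] A} (hΘ : Multi k Θ) (n : ℕ) (a : Fin n → A) :
    indTo k A (P n) (ofTotal hΘ n a) = cmpInd k A P n (Θ (List.ofFn a)) :=
  indTo_indInv _

theorem isComparison_ofTotal {Θ : List A → Tot P ⊗[k] A} (hΘ : Multi k Θ)
    (hD : (fun l => ((totD d).restrictScalars k).rTensor A (Θ l)) =
      (TotalComplex.indBimod k A (Tot P)).δ Θ)
    (hε : ∀ l, evalLeft A (μ ∘ₗ cmp A P 0) (Θ l) = unitCochain l) :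
    IsComparison d μ (ofTotal hΘ) where
  comm n a := by
    apply indTo_injective
    rw [indTo_map, indTo_ofTotal, cmpInd, rTensor_comp_apply',
      show d n ∘ₗ cmp A P (n + 1) = cmp A P n ∘ₗ totD d from LinearMap.ext fun x =>
        (cmp_totD d n x).symm, ← rTensor_comp_apply', congrFun hD (List.ofFn a)]
    change cmpInd k A P n _ = _
    rw [← congrFun ((isHom_cmpInd n).δ_comp Θ) (List.ofFn a)]
    exact (TotalComplex.indBimod k A (P n)).δ_ofFn (indTo k A (P n)).toAddMonoidHom
      indTo_smul_left indTo_smul_right (fun a => (indTo_ofTotal hΘ n a).symm) a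
  augmentation := by
    rw [indTrivToAlg_eq, indTo_ofTotal, cmpInd, TotalComplex.evalLeft_rTensor, hε]
    rfl

theorem exists_normal_comparison (hP : IsProjectiveResolution d μ) (hμ : ∀ x, μ (d 0 x) = 0)
    (hΔ : IsDiagonalMap d μ Δ) :
    ∃ θ : ∀ n, MultilinearMap k (fun _ : Fin n => A) (Ind k A (P n)), IsComparison d μ θ ∧
      Normal (totComparison θ) := by
  obtain ⟨C⟩ := nonempty_signedContraction hP hμ hΔ
  obtain ⟨Θ, hΘ, hD, hε, hN⟩ := C.exists_normal
  rw [TotalComplex.tot_zero] at hD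
  refine ⟨ofTotal hΘ, isComparison_ofTotal hΘ hD hε, fun x z => ?_⟩
  obtain ⟨n, hn⟩ : ∃ n, (x ++ 1 :: z).length = n := ⟨_, rfl⟩
  obtain ⟨a, ha⟩ := exists_ofFn hn
  rw [ha, totComparison_ofFn, indTo_ofTotal, ← ha, hN x z, map_zero, map_zero]

/-- Since comparison maps are unique up to homotopy, the comparison map quantified in
`RepresentsImage` can be exchanged for one fixed in advance, in particular for a normalized one. -/
theorem representsImage_iff (hP : IsProjectiveResolution d μ) (hμ : ∀ x, μ (d 0 x) = 0)
    (hΔ : IsDiagonalMap d μ Δ) (hθ : IsComparison d μ θ) {m : ℕ} {f : P m →ₗ[A] Triv k A}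
    (hf : f ∘ₗ d m = 0) {Φ : (Fin m → A) → A} {c : List A → A} (hc : ∀ a, c (List.ofFn a) = Φ a) :
    RepresentsImage d μ f Φ ↔ ∃ w, Multi k w ∧ ∀ l, l.length = m →
      c l = evalLeft A (f ∘ₗ cmp A P m) (totComparison θ l) + (Bimod.reg k A).δ w l := by
  constructor
  · rintro ⟨θ', hθ', h⟩
    obtain ⟨w, hw, h⟩ := (hochschildCohomologous_iff hc
      (c' := fun l => evalLeft A (f ∘ₗ cmp A P m) (totComparison θ' l))
      (evalLeft_totComparison f)).1 h
    obtain ⟨C⟩ := nonempty_signedContraction hP hμ hΔ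
    obtain ⟨v, hv, h'⟩ := C.comparison_unique (hθ'.total hμ hΔ) (hθ.total hμ hΔ)
      (isDegCocycle_cmp hμ hΔ hf).D
    refine ⟨v + w, hv.add' hw, fun l hl => ?_⟩
    rw [h l hl, Bimod.δ_add]
    have := congrFun h' l
    simp only [Pi.add_apply] at this ⊢
    rw [this, add_assoc]
  · rintro h
    exact ⟨θ, hθ, (hochschildCohomologous_iff hc
      (c' := fun l => evalLeft A (f ∘ₗ cmp A P m) (totComparison θ l))
      (evalLeft_totComparison f)).2 h⟩

end Comparison

/-! ### The bar resolution of `k`, built from the universal multilinear function on lists. -/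

section UniversalCochain

variable (k A : Type*) [Field k] [Ring A] [HopfAlgebra k A]

/-- The relations of multilinearity. -/
def listRelations : Submodule k (List A →₀ k) :=
  Submodule.span k ({t | ∃ x a b z, t = Finsupp.single (x ++ (a + b) :: z) 1 -
      (Finsupp.single (x ++ a :: z) 1 + Finsupp.single (x ++ b :: z) 1)} ∪
    {t | ∃ (x : List A) (r : k) (a : A) (z : List A), t = Finsupp.single (x ++ (r • a) :: z) 1 -
      r • Finsupp.single (x ++ a :: z) 1})

/-- The target of the universal multilinear function on lists. -/
abbrev ListQuot := (List A →₀ k) ⧸ listRelations k A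

/-- The left module `A ⊗ (⨁ n, A^{⊗ n})`, the sum of the terms of the bar resolution of `k`. -/
abbrev BarTot := A ⊗[k] ListQuot k A

variable {A}

/-- The universal multilinear function on lists. -/
def listMk (l : List A) : ListQuot k A := Submodule.Quotient.mk (Finsupp.single l 1)

theorem multi_listMk : Multi k (listMk k : List A → ListQuot k A) where
  add x a b z := (Submodule.Quotient.eq _).2 (Submodule.subset_span (Or.inl ⟨x, a, b, z, rfl⟩))
  smul x r a z := (Submodule.Quotient.eq _).2 (Submodule.subset_span (Or.inr ⟨x, r, a, z, rfl⟩))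

variable {k} {M : Type*} [AddCommGroup M] [Module k M]

/-- The linear map induced by a multilinear function on lists. -/
def Multi.lift {c : List A → M} (hc : Multi k c) : ListQuot k A →ₗ[k] M :=
  (listRelations k A).liftQ (Finsupp.lift M k (List A) c) (by
    rw [listRelations, Submodule.span_le]
    rintro _ (⟨x, a, b, z, rfl⟩ | ⟨x, r, a, z, rfl⟩)
    · simp only [SetLike.mem_coe, LinearMap.mem_ker, map_sub, map_add]
      simp [Finsupp.lift_apply, hc.add]
    · simp only [SetLike.mem_coe, LinearMap.mem_ker, map_sub, map_smul]
      simp [Finsupp.lift_apply, hc.smul])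

theorem Multi.lift_mk {c : List A → M} (hc : Multi k c) (l : List A) :
    hc.lift (listMk k l) = c l := by
  change Finsupp.lift M k (List A) c (Finsupp.single l 1) = _
  simp

theorem listQuot_ext {S T : ListQuot k A →ₗ[k] M} (h : ∀ l, S (listMk k l) = T (listMk k l)) :
    S = T := by
  refine Submodule.linearMap_qext _ (Finsupp.lhom_ext' fun l => LinearMap.ext_ring ?_)
  exact h l

variable (k) in
/-- The universal cochain with values in a left module. -/
def barMk (l : List A) : BarTot k A := 1 ⊗ₜ listMk k l

theorem multi_barMk : Multi k (barMk k : List A → BarTot k A) :=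
  (multi_listMk k).comp (TensorProduct.mk k A _ 1)

theorem smul_barMk (a : A) (l : List A) : a • barMk k l = a ⊗ₜ[k] listMk k l := by
  rw [barMk, TensorProduct.smul_tmul', smul_eq_mul, mul_one]

theorem barTot_ext {S T : BarTot k A →ₗ[k] M}
    (h : ∀ (a : A) l, S (a • barMk k l) = T (a • barMk k l)) : S = T := by
  refine TensorProduct.ext (LinearMap.ext fun a => listQuot_ext fun l => ?_)
  simpa [smul_barMk] using h a l

variable [Module A M] [IsScalarTower k A M]

/-- The `A`-linear map induced by a multilinear function on lists. -/
def Multi.barLift {c : List A → M} (hc : Multi k c) : BarTot k A →ₗ[A] M :=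
  TensorProduct.AlgebraTensorModule.lift
    ((LinearMap.toSpanSingleton A (ListQuot k A →ₗ[k] M) hc.lift))

theorem Multi.barLift_mk {c : List A → M} (hc : Multi k c) (l : List A) :
    hc.barLift (barMk k l) = c l := by
  simp [Multi.barLift, barMk, hc.lift_mk]

theorem barTot_ext' {S T : BarTot k A →ₗ[A] M} (h : ∀ l, S (barMk k l) = T (barMk k l)) :
    S = T := by
  have : S.restrictScalars k = T.restrictScalars k := barTot_ext fun a l => by simp [h]
  exact LinearMap.ext fun x => LinearMap.congr_fun this x

variable (k A M) in
/-- A left module as a bimodule with right action through the counit. -/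
def Bimod.ofModule : Bimod k A M where
  L := Algebra.lsmul k k M
  R := LinearMap.toSpanSingleton k _ LinearMap.id ∘ₗ Coalgebra.counit
  R_one := by simp
  R_mul a b x := by simp [smul_smul]
  comm a b x := smul_comm (Coalgebra.counit (R := k) b) a x

theorem Bimod.ofModule_L (a : A) (x : M) : (ofModule k A M).L a x = a • x := rfl

theorem Bimod.ofModule_R (a : A) (x : M) :
    (ofModule k A M).R a x = Coalgebra.counit (R := k) a • x := rfl

theorem isHom_ofModule {N : Type*} [AddCommGroup N] [Module k N] [Module A N]
    [IsScalarTower k A N] (φ : M →ₗ[A] N) :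
    (Bimod.ofModule k A M).IsHom (Bimod.ofModule k A N) (φ.restrictScalars k) where
  L _ x := φ.map_smul _ x
  R _ x := (φ.restrictScalars k).map_smul _ x

theorem LinearMap.δ_ofModule {N : Type*} [AddCommGroup N] [Module k N] [Module A N]
    [IsScalarTower k A N] (φ : M →ₗ[A] N) (c : List A → M) (l : List A) :
    (Bimod.ofModule k A N).δ (fun l => φ (c l)) l = φ ((Bimod.ofModule k A M).δ c l) :=
  congrFun ((isHom_ofModule φ).δ_comp c) l

variable (k A) in
/-- The differential of the bar resolution. -/
def barD : BarTot k A →ₗ[A] BarTot k A :=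
  ((multi_barMk (k := k) (A := A)).δ (Bimod.ofModule k A _)).barLift

theorem barD_mk (l : List A) : barD k A (barMk k l) = (Bimod.ofModule k A _).δ (barMk k) l :=
  Multi.barLift_mk _ l

variable (k A) in
/-- The contraction `a₀ ⊗ (a₁, …, aₙ) ↦ 1 ⊗ (a₀, …, aₙ)`. -/
def barH : BarTot k A →ₗ[k] BarTot k A :=
  TensorProduct.lift
    { toFun := fun a => ((multi_barMk (k := k)).shift a).lift
      map_add' := fun a b => listQuot_ext fun l => by
        simp [Multi.lift_mk, multi_barMk.add_head]
      map_smul' := fun r a => listQuot_ext fun l => by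
        simp [Multi.lift_mk, multi_barMk.smul_head] }

theorem barH_mk (a : A) (l : List A) : barH k A (a • barMk k l) = barMk k (a :: l) := by
  rw [smul_barMk]
  exact Multi.lift_mk ((multi_barMk (k := k)).shift a) l

variable (k A) in
/-- The term of degree `n` of the bar resolution. -/
def barTerm (n : ℕ) : Submodule A (BarTot k A) :=
  Submodule.span A (Set.range fun a : Fin n → A => barMk k (List.ofFn a))

theorem barMk_mem {n : ℕ} {l : List A} (h : l.length = n) : barMk k l ∈ barTerm k A n := by
  obtain ⟨a, rfl⟩ := exists_ofFn h
  exact Submodule.subset_span ⟨a, rfl⟩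

theorem barTerm_induction {n : ℕ} {p : BarTot k A → Prop} (h0 : p 0)
    (ha : ∀ x y, p x → p y → p (x + y)) (h : ∀ (a : A) l, l.length = n → p (a • barMk k l))
    {x : BarTot k A} (hx : x ∈ barTerm k A n) : p x := by
  refine Submodule.closure_induction (p := fun x _ => p x) h0 (fun x y _ _ => ha x y) ?_ hx
  rintro a _ ⟨b, rfl⟩
  exact h a _ List.length_ofFn

theorem barTerm_congr {n : ℕ} {S T : BarTot k A →ₗ[A] M}
    (h : ∀ l, l.length = n → S (barMk k l) = T (barMk k l)) {x : BarTot k A}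
    (hx : x ∈ barTerm k A n) : S x = T x := by
  refine barTerm_induction (p := fun x => S x = T x) (by simp) (fun x y hx hy => by simp [hx, hy])
    (fun a l hl => by simp [h l hl]) hx

theorem barH_mem {n : ℕ} {x : BarTot k A} (hx : x ∈ barTerm k A n) :
    barH k A x ∈ barTerm k A (n + 1) := by
  refine barTerm_induction (p := fun x => barH k A x ∈ barTerm k A (n + 1)) (by simp) (fun x y hx hy => by rw [map_add]; exact add_mem hx hy)
    (fun a l hl => ?_) hx
  rw [barH_mk]
  exact barMk_mem (by simpa using hl)

/-- Prepending the coefficient `a` to the list creates one new leading term in the differential,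
which is the original element; the rest cancels. In degree zero the counit would leave an extra
term, hence the restriction to positive degree. -/
theorem barD_barH {n : ℕ} {x : BarTot k A} (hx : x ∈ barTerm k A (n + 1)) :
    barD k A (barH k A x) + barH k A (barD k A x) = x := by
  refine barTerm_induction (p := fun x => barD k A (barH k A x) + barH k A (barD k A x) = x)
    (by simp) (fun x y hx hy => ?_) (fun a l hl => ?_) hx
  · simp only [map_add]
    rw [add_add_add_comm, hx, hy]
  · cases l with
    | nil => simp at hl
    | cons b l =>
      -- The right action is by scalars of `k`, so any `k`-linear map commutes with `E`; here it is
      -- multiplication by `a` followed by the contraction.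
      have h1 : ∀ l : List A, (Bimod.ofModule k A _).E (fun l => barMk k (a :: l)) l =
          barH k A (a • (Bimod.ofModule k A _).E (barMk k) l) := by
        intro l
        have h2 : (fun l => barMk k (a :: l)) = fun l =>
            (barH k A ∘ₗ Algebra.lsmul k k (BarTot k A) a) (barMk k l) :=
          funext fun l => (barH_mk a l).symm
        rw [h2]
        refine congrFun ((Bimod.ofModule k A _).E_comp (Bimod.ofModule k A _) (fun b x => ?_) _) l
        simp [Bimod.ofModule_R]
      rw [barH_mk, barD_mk, map_smul, barD_mk, Bimod.δ_cons, Bimod.δ_cons, Bimod.ofModule_L,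
        Bimod.ofModule_L, Bimod.E_cons, h1, smul_sub, map_sub, smul_smul, barH_mk]
      abel

theorem barD_single (a : A) : barD k A (barMk k [a]) =
    a • barMk k [] - Coalgebra.counit (R := k) a • barMk k [] := by
  rw [barD_mk, Bimod.δ_cons, Bimod.E_single]; rfl

end UniversalCochain

/-! ### The embedding into Hochschild cohomology is injective. -/

section Injectivity

variable {k A : Type*} [Field k] [Ring A] [HopfAlgebra k A]

theorem _root_.Module.Projective.exists_lift {R P M N : Type*} [Ring R] [AddCommGroup P]
    [Module R P] [AddCommGroup M] [Module R M] [AddCommMonoid N] [Module R N]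
    (hP : Module.Projective R P) (f : P →ₗ[R] M) (g : N →ₗ[R] M) (h : ∀ x, f x ∈ LinearMap.range g) :
    ∃ s : P →ₗ[R] N, ∀ x, g (s x) = f x := by
  obtain ⟨s, hs⟩ := Module.projective_lifting_property g.rangeRestrict
    (f.codRestrict (LinearMap.range g) h) g.surjective_rangeRestrict
  exact ⟨s, fun x => congrArg Subtype.val (LinearMap.congr_fun hs x)⟩

theorem exists_dependent_seq {S : ℕ → Type*} (r : ∀ n, S n → S (n + 1) → Prop) (s₀ : S 0)
    (h : ∀ n s, ∃ s', r n s s') : ∃ s : ∀ n, S n, s 0 = s₀ ∧ ∀ n, r n (s n) (s (n + 1)) := by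
  choose F hF using h
  exact ⟨fun n => Nat.rec s₀ F n, rfl, fun n => hF n _⟩

variable {P : ℕ → Type*} [∀ n, AddCommGroup (P n)] [∀ n, Module k (P n)] [∀ n, Module A (P n)]
  [∀ n, IsScalarTower k A (P n)]
  {d : ∀ n, P (n + 1) →ₗ[A] P n} {μ : P 0 →ₗ[A] Triv k A}

/-- A chain endomorphism lifting the identity of `k` is homotopic to the identity. -/
theorem IsProjectiveResolution.exists_homotopy (hP : IsProjectiveResolution d μ)
    (α : ∀ n, P n →ₗ[A] P n) (hα : ∀ n x, d n (α (n + 1) x) = α n (d n x))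
    (hμ : ∀ x, μ (α 0 x) = μ x) :
    ∃ s : ∀ n, P n →ₗ[A] P (n + 1), (∀ x, d 0 (s 0 x) = α 0 x - x) ∧
      ∀ n x, d (n + 1) (s (n + 1) x) = α (n + 1) x - x - s n (d n x) := by
  have hdd : ∀ n x, d n (d (n + 1) x) = 0 := fun n => (hP.exact_succ n).apply_apply_eq_zero
  obtain ⟨s0, hs0⟩ := (hP.projective 0).exists_lift (α 0 - LinearMap.id) (d 0) fun x =>
    (hP.exact_zero _).1 (by simp [hμ])
  -- Each stage carries the proof that the next right-hand side is a cycle, which is what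
  -- projectivity and exactness need to continue.
  obtain ⟨S, hS0, hS⟩ := exists_dependent_seq
    (S := fun n => {s : P n →ₗ[A] P (n + 1) // ∀ x, d n (α (n + 1) x - x - s (d n x)) = 0})
    (fun n s s' => ∀ x, d (n + 1) (s'.1 x) = α (n + 1) x - x - s.1 (d n x))
    ⟨s0, fun x => by
      have := hs0 (d 0 x)
      simp only [LinearMap.sub_apply, LinearMap.id_apply] at this
      rw [map_sub, map_sub, hα, this]
      simp⟩ (by
    rintro n ⟨s, hs⟩
    obtain ⟨s', hs'⟩ := (hP.projective (n + 1)).exists_lift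
      (α (n + 1) - LinearMap.id - s ∘ₗ d n) (d (n + 1)) fun x =>
        (hP.exact_succ n _).1 (hs x)
    refine ⟨⟨s', fun x => ?_⟩, hs'⟩
    have := hs' (d (n + 1) x)
    simp only [LinearMap.sub_apply, LinearMap.id_apply, LinearMap.comp_apply, hdd, map_zero,
      sub_zero] at this
    rw [map_sub, map_sub, hα, this]
    abel)
  exact ⟨fun n => (S n).1, by beta_reduce; rw [hS0]; exact hs0, hS⟩

variable (d μ) in
/-- There is a chain map from a projective resolution of `k` to the bar resolution. -/
theorem IsProjectiveResolution.exists_toBar (hP : IsProjectiveResolution d μ) :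
    ∃ ρ : ∀ n, P n →ₗ[A] BarTot k A, (∀ n x, ρ n x ∈ barTerm k A n) ∧
      (∀ n x, barD k A (ρ (n + 1) x) = ρ n (d n x)) ∧
      ∀ x, ∃ a : A, ρ 0 x = a • barMk k [] ∧ Coalgebra.counit (R := k) a = Triv.toField k A (μ x) := by
  have hdd : ∀ n x, d n (d (n + 1) x) = 0 := fun n => (hP.exact_succ n).apply_apply_eq_zero
  -- This is the counit, seen as an `A`-linear augmentation of the degree zero term; lifting `μ`
  -- through it starts the chain map.
  let π : A →ₗ[A] Triv k A := LinearMap.toSpanSingleton A (Triv k A) (show Triv k A from (1 : k))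
  have hπ : ∀ a, Triv.toField k A (π a) = Coalgebra.counit (R := k) a := fun a => mul_one _
  obtain ⟨σ, hσ⟩ := (hP.projective 0).exists_lift μ π fun x =>
    ⟨algebraMap k A (Triv.toField k A (μ x)), (hπ _).trans (Bialgebra.counit_algebraMap _)⟩
  let ρ₀ : P 0 →ₗ[A] barTerm k A 0 :=
    LinearMap.toSpanSingleton A _ ⟨barMk k [], barMk_mem rfl⟩ ∘ₗ σ
  obtain ⟨S, hS0, hS⟩ := exists_dependent_seq
    (S := fun n => {ρ : P n →ₗ[A] barTerm k A n //
      ∀ x, ∃ z : barTerm k A (n + 1), barD k A z = ρ (d n x)})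
    (fun n ρ ρ' => ∀ x, barD k A (ρ'.1 x) = ρ.1 (d n x))
    ⟨ρ₀, fun x => ⟨⟨barMk k [σ (d 0 x)], barMk_mem rfl⟩, by
      have h0 : Coalgebra.counit (R := k) (σ (d 0 x)) = 0 := by
        rw [← hπ, hσ, hP.exact_zero.apply_apply_eq_zero x, map_zero]
      refine (barD_single _).trans ?_
      rw [h0, zero_smul, sub_zero]; rfl⟩⟩ (by
    rintro n ⟨ρ, hρ⟩
    obtain ⟨ρ', hρ'⟩ := (hP.projective (n + 1)).exists_lift
      ((barTerm k A n).subtype ∘ₗ ρ ∘ₗ d n)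
      (barD k A ∘ₗ (barTerm k A (n + 1)).subtype) hρ
    refine ⟨⟨ρ', fun x => ?_⟩, hρ'⟩
    -- The bar contraction exhibits this cycle as the boundary of its image under `barH`, which lies
    -- in the next term.
    have h1 : barD k A (ρ' (d (n + 1) x)) = 0 := by
      refine (hρ' _).trans ?_
      simp [hdd]
    have h2 := barD_barH (ρ' (d (n + 1) x)).2
    rw [h1, map_zero, add_zero] at h2
    exact ⟨⟨_, barH_mem (ρ' (d (n + 1) x)).2⟩, h2⟩)
  refine ⟨fun n => (barTerm k A n).subtype ∘ₗ (S n).1, fun n x => ((S n).1 x).2, hS,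
    fun x => ⟨σ x, ?_, (hπ _).symm.trans (congrArg (Triv.toField k A) (hσ x))⟩⟩
  beta_reduce
  rw [hS0]; rfl

/-- The map from the induced module which applies the counit to the algebra. -/
def counitRight (k A U : Type*) [Field k] [Ring A] [HopfAlgebra k A] [AddCommGroup U] [Module k U] :
    U ⊗[k] A →ₗ[k] U :=
  (TensorProduct.rid k U).toLinearMap ∘ₗ (Coalgebra.counit (R := k) (A := A)).lTensor U

theorem counitRight_tmul {U : Type*} [AddCommGroup U] [Module k U] (u : U) (a : A) :
    counitRight k A U (u ⊗ₜ a) = Coalgebra.counit (R := k) a • u := rfl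

/-- Left linearity is the counit axiom on the second factor, `∑ ε(a₂) a₁ = a`. This map undoes
induction: it turns cochains in `U ⊗ A` into cochains in `U` with right action through the counit.
-/
theorem isHom_counitRight (U : Type*) [AddCommGroup U] [Module k U] [Module A U]
    [IsScalarTower k A U] :
    (TotalComplex.indBimod k A U).IsHom (Bimod.ofModule k A U) (counitRight k A U) where
  L a x := by
    induction x using TensorProduct.induction_on with
    | zero => simp
    | add x y hx hy => simp only [map_add, hx, hy]
    | tmul u b =>
      rw [Bimod.ofModule_L, Bimod.twist_L, counitRight_tmul]
      have h : ∀ t : A ⊗[k] A, counitRight k A U ((Bimod.reg k A).pairAct U t (u ⊗ₜ b)) =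
          Coalgebra.counit (R := k) b • (TensorProduct.rid k A
            ((Coalgebra.counit (R := k) (A := A)).lTensor A t)) • u := by
        intro t
        induction t using TensorProduct.induction_on with
        | zero => simp
        | add x y hx hy =>
          simp only [map_add, LinearMap.add_apply, hx, hy, add_smul, smul_add]
        | tmul x y =>
          rw [Bimod.pairAct_tmul, counitRight_tmul]
          change Coalgebra.counit (R := k) (y * b) • x • u = _
          rw [Bialgebra.counit_mul, mul_comm, mul_smul, LinearMap.lTensor_tmul,
            TensorProduct.rid_tmul, smul_assoc]
      rw [h, Coalgebra.lTensor_counit_comul, TensorProduct.rid_tmul, one_smul, smul_comm]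
  R a x := by
    induction x using TensorProduct.induction_on with
    | zero => simp
    | add x y hx hy => simp only [map_add, hx, hy]
    | tmul u b =>
      rw [Bimod.ofModule_R, Bimod.twist_R, LinearMap.lTensor_tmul, counitRight_tmul,
        counitRight_tmul]
      change Coalgebra.counit (R := k) (b * a) • u = _
      rw [Bialgebra.counit_mul, mul_comm, mul_smul]

/-- The counit as a map to the trivial module. -/
def counitTriv (k A : Type*) [Field k] [Ring A] [HopfAlgebra k A] : A →ₗ[k] Triv k A :=
  Coalgebra.counit (R := k) (A := A)

theorem isHom_counitTriv :
    (Bimod.reg k A).IsHom (Bimod.ofModule k A (Triv k A)) (counitTriv k A) where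
  L a x := Bialgebra.counit_mul (R := k) a x
  R a x := (Bialgebra.counit_mul (R := k) x a).trans (mul_comm (G := k) _ _)

theorem counitTriv_evalLeft {U : Type*} [AddCommGroup U] [Module k U] [Module A U]
    [IsScalarTower k A U] (h : U →ₗ[A] Triv k A) (x : U ⊗[k] A) :
    counitTriv k A (evalLeft A h x) = h (counitRight k A U x) := by
  induction x using TensorProduct.induction_on with
  | zero => simp
  | add x y hx hy => simp only [map_add, hx, hy]
  | tmul u b =>
    rw [counitRight_tmul, evalLeft_tmul, map_smul]
    refine Eq.trans ?_ ((h.restrictScalars k).map_smul _ u).symm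
    exact mul_comm (G := k) _ _

variable {Δ : ∀ i j n : ℕ, i + j = n → P n →ₗ[k] P i ⊗[k] P j}
  {θ : List A → Tot P ⊗[k] A}

/-- A cocycle of `P` whose Hochschild cochain is a coboundary is a coboundary. -/
theorem TotalComplex.IsTotalComparison.cohomologous_zero (hP : IsProjectiveResolution d μ)
    {hμ : ∀ x, μ (d 0 x) = 0} {hΔ : IsDiagonalMap d μ Δ}
    (hθ : (totalComplex d μ hμ hΔ).IsTotalComparison θ) {r : ℕ} {h : P r →ₗ[A] Triv k A}
    (hh : h ∘ₗ d r = 0) {w : List A → A} (hw : Multi k w)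
    (hwθ : ∀ l, l.length = r → evalLeft A (h ∘ₗ cmp A P r) (θ l) = (Bimod.reg k A).δ w l) :
    Cohomologous d r h 0 := by
  have hϑ : Multi k fun l => counitRight k A (Tot P) (θ l) := hθ.multi.comp _
  have hβ : Multi k fun l => counitTriv k A (w l) := hw.comp _
  have hD : ∀ x, totD d (hϑ.barLift x) = hϑ.barLift (barD k A x) := by
    refine LinearMap.congr_fun (f := totD d ∘ₗ hϑ.barLift) (g := hϑ.barLift ∘ₗ barD k A)
      (barTot_ext' fun l => ?_)
    simp only [LinearMap.comp_apply]
    rw [barD_mk, ← LinearMap.δ_ofModule, hϑ.barLift_mk, funext hϑ.barLift_mk,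
      (isHom_counitRight _).δ_comp, ← hθ.D, TotalComplex.tot_zero]
    change totD d _ = counitRight k A (Tot P) (((totD d).restrictScalars k).rTensor A (θ l))
    generalize θ l = z
    induction z using TensorProduct.induction_on with
    | zero => simp
    | add x y hx hy => simp only [map_add, hx, hy]
    | tmul u b =>
      rw [LinearMap.rTensor_tmul, counitRight_tmul, counitRight_tmul]
      exact ((totD d).restrictScalars k).map_smul _ u
  obtain ⟨ρ, hρ, hdρ, hρ0⟩ := hP.exists_toBar d μ
  -- Go from `P` to the bar resolution of `k`, and back by the comparison map with the counit
  -- applied on the right.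
  let α : ∀ n, P n →ₗ[A] P n := fun n => cmp A P n ∘ₗ hϑ.barLift ∘ₗ ρ n
  have hα : ∀ n x, d n (α (n + 1) x) = α n (d n x) := fun n x => by
    simp only [α, LinearMap.comp_apply]
    rw [← cmp_totD, hD, hdρ]
  have hα0 : ∀ x, μ (α 0 x) = μ x := fun x => by
    obtain ⟨a, ha, ha'⟩ := hρ0 x
    have h1 : μ (cmp A P 0 (counitRight k A (Tot P) (θ []))) = (show Triv k A from (1 : k)) := by
      have h2 := congrArg (counitTriv k A) (hθ.aug [])
      rw [counitTriv_evalLeft] at h2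
      exact h2.trans (Bialgebra.counit_one (R := k))
    simp only [α, LinearMap.comp_apply]
    rw [ha, map_smul, map_smul, map_smul, hϑ.barLift_mk, h1, Triv.smul_def, ha']
    exact mul_one (M := k) _
  obtain ⟨s, hs0, hs⟩ := hP.exists_homotopy α hα hα0
  -- Applying the counit to the assumed Hochschild coboundary shows that `h`, pulled back along `α`,
  -- is the coboundary of the cochain `ε w`.
  have hhα : ∀ x, h (α r x) = hβ.barLift (barD k A (ρ r x)) := fun x =>
    barTerm_congr (S := h ∘ₗ cmp A P r ∘ₗ hϑ.barLift) (T := hβ.barLift ∘ₗ barD k A) (fun l hl => by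
      simp only [LinearMap.comp_apply]
      rw [barD_mk, ← LinearMap.δ_ofModule, hϑ.barLift_mk, funext hβ.barLift_mk,
        isHom_counitTriv.δ_comp]
      beta_reduce
      rw [← hwθ l hl, counitTriv_evalLeft]
      rfl) (hρ r x)
  have hhd : ∀ x, h (d r x) = 0 := LinearMap.congr_fun hh
  cases r with
  | zero =>
    refine LinearMap.ext fun x => ?_
    obtain ⟨a, ha, -⟩ := hρ0 x
    have h1 := congrArg h (hs0 x)
    rw [hhd, map_sub, hhα, ha, map_smul, barD_mk, Bimod.δ_nil, smul_zero, map_zero, zero_sub] at h1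
    simpa using h1
  | succ r =>
    -- As `h` kills boundaries, the homotopy equation gives `h = h α - h s d`, and the first term
    -- factors through `d` because `ρ` is a chain map.
    refine ⟨hβ.barLift ∘ₗ ρ r - h ∘ₗ s r, LinearMap.ext fun x => ?_⟩
    have h1 := congrArg h (hs r x)
    rw [hhd, map_sub, map_sub, hhα, hdρ] at h1
    rw [sub_zero]
    simp only [LinearMap.sub_apply, LinearMap.comp_apply]
    rw [eq_comm, sub_right_comm, sub_eq_zero] at h1
    exact h1.symm

end Injectivity

/-! ### Independence of representatives, and the bracket in cohomology. -/

section Bracket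

variable {k A : Type*} [Field k] [Ring A] [HopfAlgebra k A]

/-- `c` and `e` differ by the coboundary of a cochain. -/
def ListCohomologous (k : Type*) {A : Type*} [Field k] [Ring A] [HopfAlgebra k A]
    (c e : List A → A) : Prop :=
  ∃ w : List A → A, Multi k w ∧ c = e + (Bimod.reg k A).δ w

namespace ListCohomologous

variable {c e e' : List A → A}

theorem trans (h : ListCohomologous k c e) (h' : ListCohomologous k e e') :
    ListCohomologous k c e' := by
  obtain ⟨w, hw, rfl⟩ := h
  obtain ⟨w', hw', rfl⟩ := h'
  exact ⟨w' + w, hw'.add' hw, by rw [Bimod.δ_add, add_assoc]⟩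

theorem zsmul (h : ListCohomologous k c e) (t : ℤ) : ListCohomologous k (t • c) (t • e) := by
  obtain ⟨w, hw, rfl⟩ := h
  exact ⟨t • w, hw.zsmul t, by rw [Bimod.δ_zsmul, smul_add]⟩

theorem δ_eq (h : ListCohomologous k c e) : (Bimod.reg k A).δ c = (Bimod.reg k A).δ e := by
  obtain ⟨w, -, rfl⟩ := h
  rw [Bimod.δ_add, Bimod.δ_δ, add_zero]

end ListCohomologous

theorem Multi.restrict {c : List A → A} (hc : Multi k c) (n : ℕ) :
    Multi k fun l => if l.length = n then c l else 0 :=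
  .of_length fun i => by
    by_cases h : i = n
    · exact ⟨c, hc, fun l hl => if_pos (hl.trans h)⟩
    · exact ⟨0, .zero, fun l hl => if_neg (hl ▸ h)⟩

/-- The agreement up to a coboundary is given on lists of length `m` only; cutting `w` down to one
degree makes it an identity of mixed cochains, and then `listBracket_coboundary` applies. -/
theorem listBracket_cohomologous_left {m n : ℕ} {c e Γ : List A → A} (hc : Supp m c)
    (he : Supp m e) (h : ∃ w, Multi k w ∧ ∀ l, l.length = m → c l = e l + (Bimod.reg k A).δ w l)
    (hΓ : Multi k Γ) (hs : Supp n Γ) (hδ : (Bimod.reg k A).δ Γ = 0) :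
    ListCohomologous k (listBracket m n c Γ) (listBracket m n e Γ) ∧ ListCohomologous k c e := by
  obtain ⟨w, hw, h⟩ := h
  cases m with
  | zero =>
    obtain rfl : c = e := by
      funext l
      by_cases hl : l.length = 0
      · obtain rfl := List.length_eq_zero_iff.1 hl
        rw [h _ hl, Bimod.δ_nil, add_zero]
      · rw [hc l hl, he l hl]
    have : ∀ c : List A → A, ListCohomologous k c c := fun c => ⟨0, .zero, by rw [Bimod.δ_zero, add_zero]⟩
    exact ⟨this _, this _⟩
  | succ m =>
    -- In degree `m + 1` the coboundary depends only on the component of `w` of degree `m`; dropping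
    -- the others makes both sides vanish in all other degrees.
    set b : List A → A := fun l => if l.length = m then w l else 0
    have hb : Multi k b := hw.restrict m
    have hbs : Supp m b := fun l hl => if_neg hl
    have hcb : c = e + (Bimod.reg k A).δ b := by
      funext l
      by_cases hl : l.length = m + 1
      · rw [h _ hl, Pi.add_apply, (Bimod.reg k A).δ_congr (c := b) (e := w)
          (fun l hl => if_pos hl) l hl]
      · rw [Pi.add_apply, hc l hl, he l hl, zero_add]
        cases l with
        | nil => rw [Bimod.δ_nil]
        | cons a l =>
          rw [(Bimod.reg k A).δ_congr (n := l.length) (c := b) (e := 0)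
            (fun l' hl' => if_neg fun h => hl (by simp [← h, hl'])) (a :: l) rfl, Bimod.δ_zero]
          rfl
    refine ⟨?_, b, hb, hcb⟩
    obtain ⟨v, hv, hv'⟩ := listBracket_coboundary m n hb hbs hΓ hs hδ
    exact ⟨v, hv, by rw [hcb, listBracket_add_left _ _ hΓ, hv']⟩

/-- Replace one argument at a time; graded symmetry of the bracket moves the second argument into
first place. -/
theorem listBracket_cohomologous {m n : ℕ} {c e Γ Λ : List A → A} (hc : Supp m c)
    (he : Supp m e) (h : ∃ w, Multi k w ∧ ∀ l, l.length = m → c l = e l + (Bimod.reg k A).δ w l)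
    (hΓs : Supp n Γ) (hΛs : Supp n Λ)
    (h' : ∃ w, Multi k w ∧ ∀ l, l.length = n → Γ l = Λ l + (Bimod.reg k A).δ w l)
    (hΓ : Multi k Γ) (hem : Multi k e) (hδe : (Bimod.reg k A).δ e = 0)
    (hδ : (Bimod.reg k A).δ Λ = 0) :
    ListCohomologous k (listBracket m n c Γ) (listBracket m n e Λ) := by
  obtain ⟨h1, h2⟩ := listBracket_cohomologous_left hΓs hΛs h' hem he hδe
  refine (listBracket_cohomologous_left hc he h hΓ hΓs (h2.δ_eq.trans hδ)).1.trans ?_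
  rw [listBracket_symm n m Γ e, listBracket_symm n m Λ e]
  exact h1.zsmul _

variable {P : ℕ → Type*} [∀ n, AddCommGroup (P n)] [∀ n, Module k (P n)] [∀ n, Module A (P n)]
  [∀ n, IsScalarTower k A (P n)]
  {d : ∀ n, P (n + 1) →ₗ[A] P n} {μ : P 0 →ₗ[A] Triv k A}
  {Δ : ∀ i j n : ℕ, i + j = n → P n →ₗ[k] P i ⊗[k] P j}
  {m n r : ℕ} {f : P m →ₗ[A] Triv k A} {g : P n →ₗ[A] Triv k A}
  {ψf : DegreeMap A P m} {ψg : DegreeMap A P n}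
  {θ : ∀ n, MultilinearMap k (fun _ : Fin n => A) (Ind k A (P n))}

theorem supp_evalLeft_totComparison (f : P m →ₗ[A] Triv k A) :
    Supp m fun l => evalLeft A (f ∘ₗ cmp A P m) (totComparison θ l) := by
  intro l hl
  beta_reduce
  rw [totComparison_of_length rfl, incInd, TotalComplex.evalLeft_rTensor,
    show (f ∘ₗ cmp A P m) ∘ₗ inc A P l.length = 0 from LinearMap.ext fun x => by
      simp [cmp_inc_ne (A := A) (P := P) hl]]
  simp [evalLeft]

theorem liftingBracket_cmp (e : r + 1 = m + n) :
    liftingBracket e f g ψf ψg ∘ₗ cmp A P r = (f ∘ₗ cmp A P m) ∘ₗ ψg.tot -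
      (-1 : ℤ) ^ ((m + 1) * (n + 1)) • ((g ∘ₗ cmp A P n) ∘ₗ ψf.tot) := by
  rw [ψg.cmp_tot e f, ψf.cmp_tot (e.trans (add_comm m n)) g]
  rfl

theorem liftingBracket_comp_d (hμ : ∀ x, μ (d 0 x) = 0) (hΔ : IsDiagonalMap d μ Δ)
    (e : r + 1 = m + n) (hf : f ∘ₗ d m = 0) (hg : g ∘ₗ d n = 0)
    (hψf : BoundaryEq d Δ f ψf) (hψg : BoundaryEq d Δ g ψg) :
    liftingBracket e f g ψf ψg ∘ₗ d r = 0 := by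
  refine LinearMap.ext fun x => ?_
  have h := TotalComplex.bracket_comp_D (isDegCocycle_cmp hμ hΔ hf) (isDegCocycle_cmp hμ hΔ hg)
    (hψf.tot hμ hΔ) (hψg.tot hμ hΔ) (inc A P (r + 1) x)
  rw [← liftingBracket_cmp e] at h
  change liftingBracket e f g ψf ψg (cmp A P r (totD d (inc A P (r + 1) x))) = 0 at h
  rwa [totD_succ, cmp_inc] at h

/-- The bracket of any Hochschild cochains which represent the images of the two classes is
represented by the bracket computed from homotopy liftings. -/
theorem representsImage_liftingBracket (hP : IsProjectiveResolution d μ)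
    (hΔ : IsDiagonalMap d μ Δ) (e : r + 1 = m + n) (hf : f ∘ₗ d m = 0) (hg : g ∘ₗ d n = 0)
    (hψf : IsHomotopyLifting d μ Δ f ψf) (hψg : IsHomotopyLifting d μ Δ g ψg)
    {Φ : MultilinearMap k (fun _ : Fin m => A) A} {Γ : MultilinearMap k (fun _ : Fin n => A) A}
    (hΦ : RepresentsImage d μ f Φ) (hΓ : RepresentsImage d μ g Γ) :
    RepresentsImage d μ (liftingBracket e f g ψf ψg) (gerstenhaberBracket e Φ Γ) := by
  have hμ : ∀ x, μ (d 0 x) = 0 := hP.exact_zero.apply_apply_eq_zero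
  obtain ⟨θ, hθ, hN⟩ := exists_normal_comparison hP hμ hΔ
  obtain ⟨C⟩ := nonempty_signedContraction hP hμ hΔ
  have hT := hθ.total hμ hΔ
  have hF := isDegCocycle_cmp hμ hΔ hf
  have hG := isDegCocycle_cmp hμ hΔ hg
  rw [representsImage_iff hP hμ hΔ hθ (liftingBracket_comp_d hμ hΔ e hf hg hψf.1 hψg.1)
    (gerstenhaberBracket_eq e Φ Γ)]
  -- Replace the given representatives by the cochains of `f` and `g` along the normalized
  -- comparison map, the only ones to which the bracket formula applies directly.
  have h1 := listBracket_cohomologous (supp_ofFun Φ) (supp_evalLeft_totComparison f)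
    ((representsImage_iff hP hμ hΔ hθ hf (ofFun_ofFn Φ)).1 hΦ) (supp_ofFun Γ)
    (supp_evalLeft_totComparison g) ((representsImage_iff hP hμ hΔ hθ hg (ofFun_ofFn Γ)).1 hΓ)
    (multi_ofFun Γ) (hT.multi.comp _) (hT.cocycle hF.D) (hT.cocycle hG.D)
  have h2 : ListCohomologous k _ _ :=
    hT.bracket hN C hF hG (hψf.tot hμ hΔ) (hψg.tot hμ hΔ)
  obtain ⟨w, hw, h3⟩ := h1.trans h2
  rw [← liftingBracket_cmp e] at h3
  exact ⟨w, hw, fun l _ => congrFun h3 l⟩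

theorem exists_representsImage (hP : IsProjectiveResolution d μ) (hΔ : IsDiagonalMap d μ Δ)
    (hf : f ∘ₗ d m = 0) :
    ∃ Φ : MultilinearMap k (fun _ : Fin m => A) A, RepresentsImage d μ f Φ := by
  have hμ : ∀ x, μ (d 0 x) = 0 := hP.exact_zero.apply_apply_eq_zero
  obtain ⟨θ, hθ, -⟩ := exists_normal_comparison hP hμ hΔ
  have hm := (hθ.total hμ hΔ).multi.comp (evalLeft A (f ∘ₗ cmp A P m))
  exact ⟨hm.toMultilinearMap m, (representsImage_iff hP hμ hΔ hθ hf
    (c := fun l => evalLeft A (f ∘ₗ cmp A P m) (totComparison θ l)) (fun a => rfl)).2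
    ⟨0, .zero, fun l _ => by rw [Bimod.δ_zero]; exact (add_zero _).symm⟩⟩

/-- The embedding of the cohomology of `A` into its Hochschild cohomology is injective. -/
theorem cohomologous_of_representsImage (hP : IsProjectiveResolution d μ)
    (hΔ : IsDiagonalMap d μ Δ) {h h' : P r →ₗ[A] Triv k A} (hh : h ∘ₗ d r = 0)
    (hh' : h' ∘ₗ d r = 0) {Φ : (Fin r → A) → A} (hΦ : RepresentsImage d μ h Φ)
    (hΦ' : RepresentsImage d μ h' Φ) : Cohomologous d r h h' := by
  have hμ : ∀ x, μ (d 0 x) = 0 := hP.exact_zero.apply_apply_eq_zero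
  obtain ⟨θ, hθ, -⟩ := exists_normal_comparison hP hμ hΔ
  have hT := hθ.total hμ hΔ
  obtain ⟨w, hw, h1⟩ := (representsImage_iff hP hμ hΔ hθ hh (ofFun_ofFn Φ)).1 hΦ
  obtain ⟨w', hw', h1'⟩ := (representsImage_iff hP hμ hΔ hθ hh' (ofFun_ofFn Φ)).1 hΦ'
  -- Both cocycles induce the same cochain up to coboundaries, so the cochain of their difference is
  -- a coboundary and the vanishing criterion applies to it.
  have h2 : Cohomologous d r (h - h') 0 :=
    hT.cohomologous_zero hP (by rw [LinearMap.sub_comp, hh, hh', sub_zero]) (hw'.sub hw)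
      fun l hl => by
        have h3 := (h1 l hl).symm.trans (h1' l hl)
        rw [LinearMap.sub_comp, TotalComplex.evalLeft_sub, LinearMap.sub_apply, Bimod.δ_sub,
          Pi.sub_apply, sub_eq_sub_iff_add_eq_add, h3, add_comm]
  cases r with
  | zero => exact sub_eq_zero.1 h2
  | succ r => simpa only [Cohomologous, sub_zero] using h2

end Bracket

end HopfBracket

end

/-! ### The main theorem. -/

theorem theorem4p1 {k : Type*} {A : Type*} [Field k] [Ring A] [HopfAlgebra k A]
    (hS : Function.Bijective (HopfAlgebra.antipode k (A := A)))
    {P : ℕ → Type*} [∀ n, AddCommGroup (P n)] [∀ n, Module k (P n)] [∀ n, Module A (P n)]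
    [∀ n, IsScalarTower k A (P n)]
    (d : ∀ n, P (n + 1) →ₗ[A] P n) (μ : P 0 →ₗ[A] Triv k A) (hP : IsProjectiveResolution d μ)
    (Δ : ∀ i j n : ℕ, i + j = n → P n →ₗ[k] TensorProduct k (P i) (P j))
    (hΔ : IsDiagonalMap d μ Δ)
    {m n r : ℕ} (e : r + 1 = m + n)
    (f : P m →ₗ[A] Triv k A) (hf : f ∘ₗ d m = 0)
    (g : P n →ₗ[A] Triv k A) (hg : g ∘ₗ d n = 0)
    (ψf : DegreeMap A P m) (hψf : IsHomotopyLifting d μ Δ f ψf)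
    (ψg : DegreeMap A P n) (hψg : IsHomotopyLifting d μ Δ g ψg) :
    -- `[f, g] = f ψ_g - (-1) ^ ((m - 1) (n - 1)) g ψ_f` represents the Gerstenhaber bracket
    RepresentsBracket d μ e f g (liftingBracket e f g ψf ψg) ∧
    -- for any choice of Hochschild cocycles representing the images of the two classes
    (∀ (Φ : MultilinearMap k (fun _ : Fin m => A) A) (Γ : MultilinearMap k (fun _ : Fin n => A) A),
      RepresentsImage d μ f Φ → RepresentsImage d μ g Γ →
        RepresentsImage d μ (liftingBracket e f g ψf ψg) (gerstenhaberBracket e Φ Γ)) ∧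
    -- and the bracket is thereby determined as an element of `H^r(A, k)`
    (∀ h : P r →ₗ[A] Triv k A, RepresentsBracket d μ e f g h →
      Cohomologous d r h (liftingBracket e f g ψf ψg)) := by
  have hμ : ∀ x, μ (d 0 x) = 0 := hP.exact_zero.apply_apply_eq_zero
  have hc := liftingBracket_comp_d hμ hΔ e hf hg hψf.1 hψg.1
  have key : ∀ (Φ : MultilinearMap k (fun _ : Fin m => A) A)
      (Γ : MultilinearMap k (fun _ : Fin n => A) A), RepresentsImage d μ f Φ →
      RepresentsImage d μ g Γ →
        RepresentsImage d μ (liftingBracket e f g ψf ψg) (gerstenhaberBracket e Φ Γ) :=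
    fun Φ Γ hΦ hΓ => representsImage_liftingBracket hP hΔ e hf hg hψf hψg hΦ hΓ
  refine ⟨⟨hc, ?_⟩, key, ?_⟩
  · obtain ⟨Φ, hΦ⟩ := exists_representsImage hP hΔ hf
    obtain ⟨Γ, hΓ⟩ := exists_representsImage hP hΔ hg
    exact ⟨Φ, Γ, hΦ, hΓ, key Φ Γ hΦ hΓ⟩
  -- For the representatives that come with `h`, the bracket of liftings represents the same
  -- Hochschild cochain, and injectivity of the embedding concludes.
  · rintro h ⟨hh, Φ, Γ, hΦ, hΓ, hB⟩
    exact cohomologous_of_representsImage hP hΔ hh hc hB (key Φ Γ hΦ hΓ)
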